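/- **Model.** Let $\{\mathcal D_\mu:\mu\in[\mu_{\min},\mu_{\max}]\}$ be a family of probability distributions on $\mathbb R$, where $\mathcal D_\mu$ has mean $\mu$ and $\mathbb P_{X\sim\mathcal D_\mu}(|X|>x)\le 2e^{-x^2/\delta^2}$ for all $x\ge 0$, with $\delta>0$ fixed. Let $\emptyset\neq Q\subseteq[0,Q_{\max}]$ be the set of order quantities. For $b\in[0,b_{\max}]$, $h\in[0,h_{\max}]$ put $C(\mu,b,h,q)=\mathbb E_{d\sim\mathcal D_\mu}[b(d-q)^++h(q-d)^+]$, and assume that $\mu\mapsto C(\mu,b,h,q)$ is $\ell$-Lipschitz on $[\mu_{\min},\mu_{\max}]$ for all such $b,h$ and all $q\in Q$. The horizon is $T\ge 2$; the costs $b_t\in[0,b_{\max}]$, $h_t\in[0,h_{\max}]$ ($1\le t\le T$) are known; write $C_t(\mu,q)=C(\mu,b_t,h_t,q)$ and assume that $\operatorname{argmin}_{q\in Q}C_t(m,q)$ is nonempty for $m\in[\mu_{\min},\mu_{\max}]$, with a minimizer chosen measurably in $m$. The demands $d_t\sim\mathcal D_{\mu_t}$ are independent. In period $t$ a (possibly randomized)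 policy chooses $q_t\in Q$ from $d_1,\dots,d_{t-1}$ and deterministic predictions $a_1,\dots,a_t\in\mathbb R$, and then observes $d_t$. For $v,a\in[0,1]$ the worst-case regret is $$\mathcal R^\pi(T)=\sup\ \mathbb E\Big[\sum_{t=1}^T\big(C_t(\mu_t,q_t)-\min_{q\in Q}C_t(\mu_t,q)\big)\Big],$$ the supremum being over all $\mu_1,\dots,\mu_T\in[\mu_{\min},\mu_{\max}]$ with $\max\sum_{k=1}^K|\mu_{t_k}-\mu_{t_{k-1}}|^2\le T^v$ (maximum over $1\le t_0<\dots<t_K\le T$) and all predictions with $\sum_{t=1}^T|a_t-\mu_t|\le T^a$. **Policies.** Rounding means rounding to the nearest point of $[\mu_{\min},\mu_{\max}]$. *Prediction Policy*: $q_t\in\operatorname{argmin}_{q\in Q}C_t(\hat\mu_t,q)$, where $\hat\mu_t$ is $a_t$ rounded. *Shrinking-Time-Window Policy*, with constants $\kappa>0$ and $\gamma>0$ such that $\kappa\gamma^2/(144e\,\delta^2)\ge 5/2$: let $v_j=(1+\frac1{\log T})^{j-1}\frac1{\log T}$ for $j=1,\dots,k$, where $k$ is the least index with $v_k\ge1$;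 let $n_j=\lceil\kappa T^{(1-v_j)/2}\rceil$, and let $\hat\mu_t^j$ be $\frac1{n_j}\sum_{s=t-n_j}^{t-1}d_s$ rounded (with $d_s=0$ for $s\le0$). For $t\le T^{3/4}$ choose $q_t\in Q$ arbitrarily (as any measurable function of $d_1,\dots,d_{t-1}$). Then set $i=1$, $t_{\rm if}=\lfloor T^{3/4}\rfloor+1$, and for $t=\lfloor T^{3/4}\rfloor+1,\dots,T$: if $\sum_{s=t_{\rm if}}^t|\hat\mu^i_s-\hat\mu^j_s|\ge2(\gamma\sqrt{\log T}+\sqrt\kappa)T^{(3+v_j)/4}$ for some $j\in\{i+1,\dots,k\}$, replace $i$ by $i+1$ and put $t_{\rm if}=t$; then choose $q_t\in\operatorname{argmin}_{q\in Q}C_t(\hat\mu^i_t,q)$. *Exp3* over these two policies: let $C_{\max}=\sup C(\mu,b,h,q)$ over $\mu\in[\mu_{\min},\mu_{\max}]$, $q\in Q$, $b\in[0,b_{\max}]$, $h\in[0,h_{\max}]$, and $\eta=\min\{1,\sqrt{2\ln2/((e-1)C_{\max}T)}\}$. Both policies have initial weight $1$. In period $t$, with current weights $w$ and $w'$, follow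 the policy of weight $w$ with probability $p=(1-\eta)\frac{w}{w+w'}+\frac\eta2$ and the other one with probability $1-p$. After observing $d_t$, multiply the weight of the policy just followed by $\exp(-\eta\,c/(2p))$, where $c=b_t(d_t-q_t)^++h_t(q_t-d_t)^+$ is the realized cost and $p$ is the probability with which that policy was followed; the other weight is unchanged. *Divide-Into-Cases Policy* $\pi^{\rm Divide}$, which knows $a$ but not $v$: the Prediction Policy if $a\le\frac12$, and Exp3 over the Shrinking-Time-Window and Prediction Policies if $a>\frac12$. **Claim.** There is a constant $C$, depending only on $b_{\max},h_{\max},Q_{\max},\delta,\ell,\kappa,\gamma$, such that for every such model, every $T\ge2$, all costs $b_t,h_t$, all choices left open in the policies, and all $v,a\in[0,1]$, $$\mathcal R^{\pi^{\rm Divide}}(T)\le C\,T^{\min\{(3+v)/4,\,a\}}\log^{5/2}T .$$ -/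

import Mathlib

open MeasureTheory
open scoped ENNReal

noncomputable section

namespace Newsvendor

/-- The data of a newsvendor model: the mean range `[muMin, muMax]`, the demand family
`dist μ` (relevant for `μ ∈ [muMin, muMax]`), the set `Q` of order quantities, and the bounds on
the per-unit underage and overage costs. -/
structure Model where
  muMin : ℝ
  muMax : ℝ
  dist : ℝ → Measure ℝ
  Q : Set ℝ
  bMax : ℝ
  hMax : ℝ

/-- Realized cost `b (d - q)⁺ + h (q - d)⁺`. -/
def cost (b h d q : ℝ) : ℝ := b * max (d - q) 0 + h * max (q - d) 0

/-- Expected cost `C(μ, b, h, q)` under the demand distribution with mean `μ`. -/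
def Model.expCost (M : Model) (b h μ q : ℝ) : ℝ := ∫ d, cost b h d q ∂(M.dist μ)

/-- The standing assumptions on the model: the demand distributions are probability measures
parameterized by their mean, with sub-Gaussian norm at most `δ`; `Q` is a nonempty subset of
`[0, QMax]`; the expected cost is `ℓ`-Lipschitz in the mean. -/
structure Model.Valid (M : Model) (QMax δ ℓ : ℝ) : Prop where
  mu_le : M.muMin ≤ M.muMax
  prob : ∀ μ ∈ Set.Icc M.muMin M.muMax, IsProbabilityMeasure (M.dist μ)
  subGaussian : ∀ μ ∈ Set.Icc M.muMin M.muMax, ∀ x : ℝ, 0 ≤ x →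
    (M.dist μ).real {y | x < |y|} ≤ 2 * Real.exp (-x ^ 2 / δ ^ 2)
  mean : ∀ μ ∈ Set.Icc M.muMin M.muMax, ∫ x, x ∂(M.dist μ) = μ
  Q_nonempty : M.Q.Nonempty
  Q_subset : M.Q ⊆ Set.Icc 0 QMax
  lipschitz : ∀ b ∈ Set.Icc 0 M.bMax, ∀ h ∈ Set.Icc 0 M.hMax, ∀ q ∈ M.Q,
    ∀ μ₁ ∈ Set.Icc M.muMin M.muMax, ∀ μ₂ ∈ Set.Icc M.muMin M.muMax,
      |M.expCost b h μ₁ q - M.expCost b h μ₂ q| ≤ ℓ * |μ₁ - μ₂|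

/-! ### Instances and regret; periods are numbered `1, …, T` -/

/-- The demand variation of `μ 1, …, μ T`: the maximum, over all `t₀ < ⋯ < t_K` in `{1, …, T}`,
of the sum of the squared increments (a maximum of finitely many values). -/
def demandVariation (T : ℕ) (μ : ℕ → ℝ) : ℝ :=
  sSup {x | ∃ (K : ℕ) (t : Fin (K + 1) → ℕ), StrictMono t ∧ (∀ k, t k ∈ Finset.Icc 1 T) ∧
    x = ∑ k : Fin K, |μ (t k.succ) - μ (t k.castSucc)| ^ 2}

/-- The mean sequences of the demand sequences in `𝒟(v)`. -/
def Model.instances (M : Model) (T : ℕ) (v : ℝ) : Set (ℕ → ℝ) :=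
  {μ | (∀ t ∈ Finset.Icc 1 T, μ t ∈ Set.Icc M.muMin M.muMax) ∧
    demandVariation T μ ≤ (T : ℝ) ^ v}

/-- The prediction error `∑ |a_t - μ_t|`. -/
def predictionError (T : ℕ) (pred μ : ℕ → ℝ) : ℝ := ∑ t ∈ Finset.Icc 1 T, |pred t - μ t|

/-- A (randomized) policy computes the order quantity of period `t` from the predictions, the
demands and the random seeds, in this order. All policies below use in period `t` only the
predictions and seeds up to `t` and the demands before `t`. -/
abbrev Policy := (ℕ → ℝ) → (ℕ → ℝ) → (ℕ → ℝ) → ℕ → ℝ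

/-- View a tuple indexed by `1, …, T` as a sequence. -/
def extend {T : ℕ} (x : Finset.Icc 1 T → ℝ) (t : ℕ) : ℝ :=
  if ht : t ∈ Finset.Icc 1 T then x ⟨t, ht⟩ else 0

/-- The joint law of the independent demands `d_t ∼ dist (μ t)` and the independent seeds, which
are uniform on `[0, 1]` and independent of the demands. -/
def Model.law (M : Model) (T : ℕ) (μ : ℕ → ℝ) :
    Measure ((Finset.Icc 1 T → ℝ) × (Finset.Icc 1 T → ℝ)) :=
  (Measure.pi fun t : Finset.Icc 1 T => M.dist (μ t)).prod
    (Measure.pi fun _ : Finset.Icc 1 T => (volume : Measure ℝ).restrict (Set.Icc 0 1))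

/-- `min_{q ∈ Q} C(μ, b, h, q)`, the expected cost of the clairvoyant. -/
def Model.optCost (M : Model) (b h μ : ℝ) : ℝ := sInf (M.expCost b h μ '' M.Q)

/-- The expected regret of a policy ordering in `Q`: the expectation of the sum of the
(nonnegative) differences `C_t(μ_t, q_t) - C_t(μ_t, q_t^*)`. -/
def Model.regret (M : Model) (T : ℕ) (b h : ℕ → ℝ) (π : Policy) (μ pred : ℕ → ℝ) : ℝ≥0∞ :=
  ∫⁻ ω, ENNReal.ofReal (∑ t ∈ Finset.Icc 1 T,
    (M.expCost (b t) (h t) (μ t) (π pred (extend ω.1) (extend ω.2) t)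
      - M.optCost (b t) (h t) (μ t))) ∂(M.law T μ)

/-- The worst-case regret with variation parameter `v` and accuracy parameter `a`. -/
def Model.worstCaseRegret (M : Model) (T : ℕ) (b h : ℕ → ℝ) (v a : ℝ) (π : Policy) : ℝ≥0∞ :=
  ⨆ (μ : ℕ → ℝ) (_ : μ ∈ M.instances T v) (pred : ℕ → ℝ)
    (_ : predictionError T pred μ ≤ (T : ℝ) ^ a), M.regret T b h π μ pred

/-! ### Choices left open by the policies -/

/-- `best t m` is an element of `argmin_{q ∈ Q} C_t(m, q)` (ties are broken in any measurable
way). -/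
structure Model.IsBestResponse (M : Model) (T : ℕ) (b h : ℕ → ℝ) (best : ℕ → ℝ → ℝ) :
    Prop where
  measurable : ∀ t ∈ Finset.Icc 1 T, Measurable (best t)
  mem : ∀ t ∈ Finset.Icc 1 T, ∀ m ∈ Set.Icc M.muMin M.muMax, best t m ∈ M.Q
  isMin : ∀ t ∈ Finset.Icc 1 T, ∀ m ∈ Set.Icc M.muMin M.muMax, ∀ q ∈ M.Q,
    M.expCost (b t) (h t) m (best t m) ≤ M.expCost (b t) (h t) m q

/-- An arbitrary rule for the order quantities of the initial periods: `init t d` lies in `Q` and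
depends, measurably, on the demands before period `t` only. -/
structure Model.IsInitialRule (M : Model) (T : ℕ) (init : ℕ → (ℕ → ℝ) → ℝ) : Prop where
  measurable : ∀ t ∈ Finset.Icc 1 T, Measurable (init t)
  mem : ∀ t ∈ Finset.Icc 1 T, ∀ d, init t d ∈ M.Q
  adapted : ∀ t ∈ Finset.Icc 1 T, ∀ d d' : ℕ → ℝ,
    (∀ s ∈ Finset.Ico 1 t, d s = d' s) → init t d = init t d'

/-! ### The policies -/

/-- Round to the nearest value in `[muMin, muMax]`. -/
def Model.clip (M : Model) (x : ℝ) : ℝ := max M.muMin (min x M.muMax)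

/-- The Prediction Policy. -/
def Model.predictionPolicy (M : Model) (best : ℕ → ℝ → ℝ) : Policy :=
  fun pred _ _ t => best t (M.clip (pred t))

/-- The candidate variation parameters `v_j`, `j ≥ 1`. -/
def candidate (T : ℕ) (j : ℕ) : ℝ :=
  (1 + 1 / Real.log T) ^ (j - 1) * (1 / Real.log T)

/-- The number `k` of candidates: the least `k ≥ 1` with `v_k ≥ 1`. -/
def numCandidates (T : ℕ) : ℕ := sInf {k | 1 ≤ k ∧ 1 ≤ candidate T k}

/-- The window sizes `n_j = ⌈κ T^((1 - v_j) / 2)⌉`. -/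
def window (κ : ℝ) (T j : ℕ) : ℕ := ⌈κ * (T : ℝ) ^ ((1 - candidate T j) / 2)⌉₊

/-- The estimate of the mean of period `t` from the last `n_j` demands (demands of periods before
period `1` are counted as `0`). -/
def Model.windowEstimate (M : Model) (κ : ℝ) (T : ℕ) (d : ℕ → ℝ) (j t : ℕ) : ℝ :=
  M.clip ((∑ s ∈ Finset.Ico (max 1 (t - window κ T j)) t, d s) / (window κ T j : ℝ))

/-- The length of the initial phase. -/
def initialLength (T : ℕ) : ℕ := ⌊(T : ℝ) ^ (3 / 4 : ℝ)⌋₊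

open Classical in
/-- The pair `(i, t_if)` of the Shrinking-Time-Window Policy, after the test of period `t`. -/
def Model.shrinkingState (M : Model) (κ γ : ℝ) (T : ℕ) (d : ℕ → ℝ) : ℕ → ℕ × ℕ
  | 0 => (1, initialLength T + 1)
  | t + 1 =>
    let i := (M.shrinkingState κ γ T d t).1
    let tif := (M.shrinkingState κ γ T d t).2
    if initialLength T < t + 1 ∧ ∃ j, i < j ∧ j ≤ numCandidates T ∧
        2 * (γ * √(Real.log T) + √κ) * (T : ℝ) ^ ((3 + candidate T j) / 4) ≤
          ∑ s ∈ Finset.Icc tif (t + 1),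
            |M.windowEstimate κ T d i s - M.windowEstimate κ T d j s|
    then (i + 1, t + 1)
    else (i, tif)

/-- The Shrinking-Time-Window Policy. -/
def Model.shrinkingPolicy (M : Model) (κ γ : ℝ) (T : ℕ) (best : ℕ → ℝ → ℝ)
    (init : ℕ → (ℕ → ℝ) → ℝ) : Policy :=
  fun _ d _ t =>
    if t ≤ initialLength T then init t d
    else best t (M.windowEstimate κ T d (M.shrinkingState κ γ T d t).1 t)

/-- `C_max`, the supremum of the expected costs. -/
def Model.costSup (M : Model) : ℝ :=
  sSup {c | ∃ μ ∈ Set.Icc M.muMin M.muMax, ∃ q ∈ M.Q, ∃ b ∈ Set.Icc 0 M.bMax,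
    ∃ h ∈ Set.Icc 0 M.hMax, c = M.expCost b h μ q}

/-- The parameter of Exp3. (If `C_max = 0`, all costs vanish and its value is immaterial.) -/
def Model.exp3Rate (M : Model) (T : ℕ) : ℝ :=
  min 1 (√(2 * Real.log 2 / ((Real.exp 1 - 1) * M.costSup * T)))

/-- The probability of the arm with weight `w` when the other arm has weight `w'`. -/
def Model.exp3Prob (M : Model) (T : ℕ) (w w' : ℝ) : ℝ :=
  (1 - M.exp3Rate T) * (w / (w + w')) + M.exp3Rate T / 2

/-- Exp3 weights of two policies with order quantities `q₁ t`, `q₂ t`: the value at `t` is the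
pair of weights at the beginning of period `t + 1`. In a period with weights `w`, the first policy
is followed iff the uniform seed is less than its probability. -/
def Model.exp3Weights (M : Model) (T : ℕ) (b h : ℕ → ℝ) (q₁ q₂ d u : ℕ → ℝ) : ℕ → ℝ × ℝ
  | 0 => (1, 1)
  | t + 1 =>
    let w := M.exp3Weights T b h q₁ q₂ d u t
    let p₁ := M.exp3Prob T w.1 w.2
    let p₂ := M.exp3Prob T w.2 w.1
    let c := fun q : ℝ => cost (b (t + 1)) (h (t + 1)) (d (t + 1)) q
    if u (t + 1) < p₁ then
      (w.1 * Real.exp (-M.exp3Rate T * (c (q₁ (t + 1)) / p₁) / 2), w.2)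
    else
      (w.1, w.2 * Real.exp (-M.exp3Rate T * (c (q₂ (t + 1)) / p₂) / 2))

/-- Exp3 over the two policies `π₁` and `π₂`. -/
def Model.exp3Policy (M : Model) (T : ℕ) (b h : ℕ → ℝ) (π₁ π₂ : Policy) : Policy :=
  fun pred d u t =>
    let w := M.exp3Weights T b h (π₁ pred d u) (π₂ pred d u) d u (t - 1)
    if u t < M.exp3Prob T w.1 w.2 then π₁ pred d u t else π₂ pred d u t

/-- The Divide-Into-Cases Policy, with known accuracy parameter `a`. -/
def Model.dividePolicy (M : Model) (κ γ : ℝ) (T : ℕ) (b h : ℕ → ℝ) (best : ℕ → ℝ → ℝ)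
    (init : ℕ → (ℕ → ℝ) → ℝ) (a : ℝ) : Policy :=
  if a ≤ 1 / 2 then M.predictionPolicy best
  else M.exp3Policy T b h (M.shrinkingPolicy κ γ T best init) (M.predictionPolicy best)

end Newsvendor

end

/-!
For `a ≤ 1/2` the policy is the Prediction Policy, and the Lipschitz condition bounds its regret by
`2 ℓ T ^ a` (`Model.Valid.regret_predictionPolicy_le`). For `a > 1/2` the policy is Exp3, whose
regret exceeds that of the better arm by `O(√T)`; this is within the claimed bound, since both
exponents are at least `1/2` then. It remains to bound the regret of the Shrinking-Time-Window
Policy.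

*Windows.* Take a candidate `v_j ≥ v`. Splitting the lag-`r` increments of the means into `r`
chains shows that the sum of their squares is at most `r T ^ v`, so by Cauchy–Schwarz a moving
average of length `n ≈ κ T ^ ((1 - v_j) / 2)` has total bias at most
`√κ T ^ ((3 + v_j) / 4)` (`sum_avg_bias_le`). The tail assumption yields a sub-Gaussian moment
generating function (`hasSubgaussianMGF_of_tail`), and the condition on `κ γ²` makes the noise of
every window in every period at most `γ √(log T) T ^ (-(1 - v_j) / 4)`, outside an event of
probability `O(log² T / T)` (`Model.Valid.measure_noiseEvent_le`). Hence the total error of window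
`j` is at most half of the value tested by the policy.

*Tests.* Let `v_j` be the least candidate that is at least `v`. By the above the policy never
leaves window `j`, and as long as it uses an earlier window, the failed tests against `j` keep its
estimates close to those of window `j` (`Model.sum_abs_shrinking_sub_le`). There are `O(log² T)`
epochs, each contributing `O(√(log T) T ^ ((3 + v_j) / 4))`, and `v_j ≤ v + 1 / log T`.

*Exp3.* Losses are unbounded, but nonnegative, so the potential argument works with
`exp (-z) ≤ 1 - z + z² / 2` and needs second moments only (`exponential_weights`). The arms do not
react to the choices of Exp3, so the loss estimates are unbiased given the past; this is expressed
by resampling the demand and the seed of a single period (`lintegral_law_resample`). The rate is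
tuned to `C_max`; the second-order term is compatible with that because the second moment of the
cost is `O(√C_max)` (`Model.integral_cost_sq_le`).
-/

namespace Newsvendor

/-! ### Moments of a distribution with a sub-Gaussian tail -/

section Tail

variable {ν : Measure ℝ} [IsProbabilityMeasure ν] {δ : ℝ}

/-- By the layer cake formula: the level `t > 1` is exceeded with probability at most `2 / t²`. -/
lemma lintegral_exp_sq_le (hδ : 0 < δ)
    (htail : ∀ x : ℝ, 0 ≤ x → ν.real {y | x < |y|} ≤ 2 * Real.exp (-x ^ 2 / δ ^ 2)) :
    ∫⁻ x, ENNReal.ofReal (Real.exp (x ^ 2 / (2 * δ ^ 2))) ∂ν ≤ 3 := by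
  rw [lintegral_eq_lintegral_meas_lt ν (ae_of_all _ fun x => (Real.exp_pos _).le)
    (by fun_prop), ← Set.Ioc_union_Ioi_eq_Ioi (zero_le_one (α := ℝ))]
  have h1 : ∫⁻ t in Set.Ioc (0 : ℝ) 1, ν {a | t < Real.exp (a ^ 2 / (2 * δ ^ 2))} ≤ 1 := by
    calc _ ≤ ∫⁻ t in Set.Ioc (0 : ℝ) 1, 1 := lintegral_mono fun t => prob_le_one
      _ = 1 := by simp
  have h2 : ∫⁻ t in Set.Ioi (1 : ℝ), ν {a | t < Real.exp (a ^ 2 / (2 * δ ^ 2))} ≤ 2 := by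
    calc _ ≤ ∫⁻ t in Set.Ioi (1 : ℝ), ENNReal.ofReal (2 * t ^ (-2 : ℝ)) := by
          refine setLIntegral_mono' measurableSet_Ioi fun t ht => ?_
          have ht1 : (1 : ℝ) < t := ht
          have hlog : 0 < Real.log t := Real.log_pos ht1
          have hsub : {a : ℝ | t < Real.exp (a ^ 2 / (2 * δ ^ 2))} ⊆
              {y | δ * √(2 * Real.log t) < |y|} := by
            intro a ha
            have ha' : Real.log t < a ^ 2 / (2 * δ ^ 2) :=
              (Real.log_lt_iff_lt_exp (by linarith)).2 ha
            rw [lt_div_iff₀ (by positivity)] at ha'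
            refine lt_of_pow_lt_pow_left₀ 2 (abs_nonneg a) ?_
            rw [mul_pow, Real.sq_sqrt (by positivity), sq_abs]
            linarith
          refine (measure_mono hsub).trans ?_
          rw [← ofReal_measureReal]
          refine ENNReal.ofReal_le_ofReal ((htail _ (by positivity)).trans_eq ?_)
          rw [mul_pow, Real.sq_sqrt (by positivity), Real.rpow_def_of_pos (by linarith)]
          congr 2
          field_simp
      _ = ENNReal.ofReal (∫ t in Set.Ioi (1 : ℝ), 2 * t ^ (-2 : ℝ)) := by
          rw [ofReal_integral_eq_lintegral_ofReal]
          · exact (integrableOn_Ioi_rpow_of_lt (by norm_num) one_pos).const_mul 2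
          · filter_upwards [ae_restrict_mem measurableSet_Ioi] with t ht
            have : (1 : ℝ) < t := ht
            positivity
      _ = 2 := by
          rw [integral_const_mul, integral_Ioi_rpow_of_lt (by norm_num) one_pos]
          norm_num
  calc _ ≤ _ := lintegral_union_le _ _ _
    _ ≤ 1 + 2 := add_le_add h1 h2
    _ = 3 := by norm_num

lemma integrable_exp_sq (hδ : 0 < δ)
    (htail : ∀ x : ℝ, 0 ≤ x → ν.real {y | x < |y|} ≤ 2 * Real.exp (-x ^ 2 / δ ^ 2)) :
    Integrable (fun x : ℝ => Real.exp (x ^ 2 / (2 * δ ^ 2))) ν := by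
  refine ⟨by fun_prop, ?_⟩
  rw [hasFiniteIntegral_iff_ofReal (ae_of_all _ fun x => (Real.exp_pos _).le)]
  exact (lintegral_exp_sq_le hδ htail).trans_lt (by norm_num)

lemma integral_exp_sq_le (hδ : 0 < δ)
    (htail : ∀ x : ℝ, 0 ≤ x → ν.real {y | x < |y|} ≤ 2 * Real.exp (-x ^ 2 / δ ^ 2)) :
    ∫ x, Real.exp (x ^ 2 / (2 * δ ^ 2)) ∂ν ≤ 3 := by
  rw [integral_eq_lintegral_of_nonneg_ae (ae_of_all _ fun x => (Real.exp_pos _).le)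
    (by fun_prop)]
  exact ENNReal.toReal_le_of_le_ofReal (by norm_num)
    ((lintegral_exp_sq_le hδ htail).trans (by norm_num))

lemma sq_le_two_mul_exp (hδ : 0 < δ) (x : ℝ) :
    x ^ 2 ≤ 2 * δ ^ 2 * (Real.exp (x ^ 2 / (2 * δ ^ 2)) - 1) := by
  have h := Real.add_one_le_exp (x ^ 2 / (2 * δ ^ 2))
  have h2 : x ^ 2 = 2 * δ ^ 2 * (x ^ 2 / (2 * δ ^ 2)) := by field_simp
  calc x ^ 2 = 2 * δ ^ 2 * (x ^ 2 / (2 * δ ^ 2)) := h2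
    _ ≤ _ := by gcongr; linarith

lemma integrable_sq (hδ : 0 < δ)
    (htail : ∀ x : ℝ, 0 ≤ x → ν.real {y | x < |y|} ≤ 2 * Real.exp (-x ^ 2 / δ ^ 2)) :
    Integrable (fun x : ℝ => x ^ 2) ν := by
  refine (((integrable_exp_sq hδ htail).sub (integrable_const 1)).const_mul (2 * δ ^ 2)).mono'
    (by fun_prop) (ae_of_all _ fun x => ?_)
  rw [Real.norm_of_nonneg (sq_nonneg x)]
  exact sq_le_two_mul_exp hδ x

lemma integrable_id_of_tail (hδ : 0 < δ)
    (htail : ∀ x : ℝ, 0 ≤ x → ν.real {y | x < |y|} ≤ 2 * Real.exp (-x ^ 2 / δ ^ 2)) :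
    Integrable (fun x : ℝ => x) ν := by
  refine ((integrable_sq hδ htail).add (integrable_const 1)).mono'
    (by fun_prop) (ae_of_all _ fun x => ?_)
  rw [Real.norm_eq_abs]
  simp only [Pi.add_apply]
  nlinarith [sq_abs x, sq_nonneg (|x| - 1)]

lemma sq_mean_le (hδ : 0 < δ)
    (htail : ∀ x : ℝ, 0 ≤ x → ν.real {y | x < |y|} ≤ 2 * Real.exp (-x ^ 2 / δ ^ 2)) :
    (∫ x, x ∂ν) ^ 2 ≤ 4 * δ ^ 2 := by
  have hsq : ∫ x, x ^ 2 ∂ν ≤ 4 * δ ^ 2 := by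
    have h := integral_mono (integrable_sq hδ htail)
      (((integrable_exp_sq hδ htail).sub (integrable_const 1)).const_mul (2 * δ ^ 2))
      (fun x => sq_le_two_mul_exp hδ x)
    simp only [Pi.sub_apply] at h
    rw [integral_const_mul, integral_sub (integrable_exp_sq hδ htail) (integrable_const 1)] at h
    simp only [integral_const, probReal_univ, smul_eq_mul, mul_one] at h
    have := integral_exp_sq_le hδ htail
    nlinarith [sq_nonneg δ]
  set m := ∫ x, x ∂ν with hm
  have h := integral_mono (((integrable_id_of_tail hδ htail).const_mul (2 * m)).sub
    (integrable_const (m ^ 2))) (integrable_sq hδ htail)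
    (fun x => by simp only [Pi.sub_apply]; nlinarith [sq_nonneg (x - m)])
  simp only [Pi.sub_apply] at h
  rw [integral_sub ((integrable_id_of_tail hδ htail).const_mul (2 * m)) (integrable_const _),
    integral_const_mul, ← hm] at h
  simp only [integral_const, probReal_univ, smul_eq_mul, one_mul] at h
  nlinarith

lemma abs_mean_le (hδ : 0 < δ)
    (htail : ∀ x : ℝ, 0 ≤ x → ν.real {y | x < |y|} ≤ 2 * Real.exp (-x ^ 2 / δ ^ 2)) :
    |∫ x, x ∂ν| ≤ 2 * δ := by
  refine abs_le_of_sq_le_sq ?_ (by positivity)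
  calc _ ≤ 4 * δ ^ 2 := sq_mean_le hδ htail
    _ = _ := by ring

end Tail

lemma cost_nonneg {b h : ℝ} (hb : 0 ≤ b) (hh : 0 ≤ h) (d q : ℝ) : 0 ≤ cost b h d q := by
  unfold cost; positivity

lemma measurable_cost (b h : ℝ) : Measurable fun x : ℝ × ℝ => cost b h x.1 x.2 := by
  unfold cost; fun_prop

/-- The factor in the bound `cost_le_exp` of the realized cost. -/
def costScale (bMax hMax QMax δ : ℝ) : ℝ := (bMax + hMax) * (1 + |QMax|) * (1 + 2 * δ)

lemma costScale_nonneg {bMax hMax QMax δ : ℝ} (hb : 0 ≤ bMax) (hh : 0 ≤ hMax) (hδ : 0 < δ) :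
    0 ≤ costScale bMax hMax QMax δ := by
  unfold costScale; positivity

/-- The exponent is a third of the one in `integral_exp_sq_le`, so that the third moment of the
cost is bounded. -/
lemma cost_le_exp {b h bMax hMax q QMax δ : ℝ} (hδ : 0 < δ) (hb : b ∈ Set.Icc 0 bMax)
    (hh : h ∈ Set.Icc 0 hMax) (hq : q ∈ Set.Icc 0 QMax) (d : ℝ) :
    cost b h d q ≤ costScale bMax hMax QMax δ * Real.exp (d ^ 2 / (6 * δ ^ 2)) := by
  have hQ : |QMax| = QMax := abs_of_nonneg (hq.1.trans hq.2)
  have hQ0 : 0 ≤ QMax := hq.1.trans hq.2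
  have hb0 : 0 ≤ bMax := hb.1.trans hb.2
  have hh0 : 0 ≤ hMax := hh.1.trans hh.2
  have h1 : max (d - q) 0 ≤ (1 + QMax) * (1 + |d|) :=
    max_le (by nlinarith [le_abs_self d, hq.1, abs_nonneg d]) (by positivity)
  have h2 : max (q - d) 0 ≤ (1 + QMax) * (1 + |d|) :=
    max_le (by nlinarith [neg_abs_le d, hq.2, abs_nonneg d]) (by positivity)
  have h3 : 1 + |d| ≤ (1 + 2 * δ) * Real.exp (d ^ 2 / (6 * δ ^ 2)) := by
    have he := Real.add_one_le_exp (d ^ 2 / (6 * δ ^ 2))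
    have hy : d ^ 2 / (6 * δ ^ 2) = (|d| / δ) ^ 2 / 6 := by
      rw [div_pow, sq_abs]; field_simp
    rw [hy] at he ⊢
    have hd : |d| = δ * (|d| / δ) := by field_simp
    have hz : 0 ≤ |d| / δ := by positivity
    set z := |d| / δ
    rw [hd]
    have h4 : δ * z ≤ δ * (2 * Real.exp (z ^ 2 / 6)) := by
      gcongr
      nlinarith [sq_nonneg (z - 3)]
    nlinarith [sq_nonneg z]
  unfold cost costScale
  rw [hQ]
  calc b * max (d - q) 0 + h * max (q - d) 0
      ≤ bMax * ((1 + QMax) * (1 + |d|)) + hMax * ((1 + QMax) * (1 + |d|)) := by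
        gcongr
        · exact hb.2
        · exact hh.2
    _ = (bMax + hMax) * (1 + QMax) * (1 + |d|) := by ring
    _ ≤ (bMax + hMax) * (1 + QMax) * ((1 + 2 * δ) * Real.exp (d ^ 2 / (6 * δ ^ 2))) := by gcongr
    _ = _ := by ring

namespace Model

variable {M : Model} {QMax δ ℓ : ℝ}

lemma Valid.abs_mu_le (hM : M.Valid QMax δ ℓ) (hδ : 0 < δ) {μ : ℝ}
    (hμ : μ ∈ Set.Icc M.muMin M.muMax) : |μ| ≤ 2 * δ := by
  have := hM.prob μ hμ
  have h := abs_mean_le hδ (hM.subGaussian μ hμ)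
  rwa [hM.mean μ hμ] at h

lemma Valid.range_le (hM : M.Valid QMax δ ℓ) (hδ : 0 < δ) : M.muMax - M.muMin ≤ 4 * δ := by
  have h1 := hM.abs_mu_le hδ (Set.left_mem_Icc.2 hM.mu_le)
  have h2 := hM.abs_mu_le hδ (Set.right_mem_Icc.2 hM.mu_le)
  rw [abs_le] at h1 h2
  linarith [h1.1, h2.2]

lemma expCost_nonneg {b h : ℝ} (hb : 0 ≤ b) (hh : 0 ≤ h) (μ q : ℝ) : 0 ≤ M.expCost b h μ q :=
  integral_nonneg fun d => cost_nonneg hb hh d q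

lemma optCost_le {b h q : ℝ} (hb : 0 ≤ b) (hh : 0 ≤ h) (μ : ℝ) (hq : q ∈ M.Q) :
    M.optCost b h μ ≤ M.expCost b h μ q := by
  refine csInf_le ⟨0, ?_⟩ ⟨q, hq, rfl⟩
  rintro _ ⟨q', _, rfl⟩
  exact expCost_nonneg hb hh _ _

lemma optCost_nonneg {b h : ℝ} (hb : 0 ≤ b) (hh : 0 ≤ h) (μ : ℝ) : 0 ≤ M.optCost b h μ := by
  refine Real.sInf_nonneg ?_
  rintro _ ⟨q', _, rfl⟩
  exact expCost_nonneg hb hh _ _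

lemma measurable_expCost (M : Model) (b h : ℝ) {μ : ℝ} [IsProbabilityMeasure (M.dist μ)] :
    Measurable (M.expCost b h μ) :=
  ((measurable_cost b h).stronglyMeasurable.integral_prod_left (μ := M.dist μ)).measurable

lemma measurable_cost_left (b h q : ℝ) : Measurable fun d => cost b h d q := by
  unfold cost; fun_prop

section

variable (hM : M.Valid QMax δ ℓ) (hδ : 0 < δ) {b h μ q : ℝ} (hb : b ∈ Set.Icc 0 M.bMax)
  (hh : h ∈ Set.Icc 0 M.hMax) (hμ : μ ∈ Set.Icc M.muMin M.muMax) (hq : q ∈ M.Q)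

include hM hδ hb hh hμ hq

lemma integrable_cost_pow {m : ℕ} (hm : m ≤ 3) :
    Integrable (fun d => cost b h d q ^ m) (M.dist μ) := by
  have := hM.prob μ hμ
  have hs := costScale_nonneg (QMax := QMax) (hb.1.trans hb.2) (hh.1.trans hh.2) hδ
  refine ((integrable_exp_sq hδ (hM.subGaussian μ hμ)).const_mul
    (costScale M.bMax M.hMax QMax δ ^ m)).mono'
    ((measurable_cost_left b h q).pow_const m).aestronglyMeasurable (ae_of_all _ fun d => ?_)
  have hc := cost_nonneg hb.1 hh.1 d q
  rw [Real.norm_of_nonneg (by positivity)]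
  calc cost b h d q ^ m ≤ (costScale M.bMax M.hMax QMax δ * Real.exp (d ^ 2 / (6 * δ ^ 2))) ^ m := by
        gcongr; exact cost_le_exp hδ hb hh (hM.Q_subset hq) d
    _ = costScale M.bMax M.hMax QMax δ ^ m * Real.exp (d ^ 2 / (6 * δ ^ 2)) ^ m := mul_pow ..
    _ ≤ costScale M.bMax M.hMax QMax δ ^ m * Real.exp (d ^ 2 / (6 * δ ^ 2)) ^ 3 := by
        gcongr
        exact Real.one_le_exp (by positivity)
    _ = _ := by
        rw [← Real.exp_nat_mul]
        congr 2
        push_cast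
        field_simp
        ring

lemma integrable_cost : Integrable (fun d => cost b h d q) (M.dist μ) := by
  simpa using integrable_cost_pow hM hδ hb hh hμ hq (m := 1) (by norm_num)

lemma integral_cost_cube_le :
    ∫ d, cost b h d q ^ 3 ∂(M.dist μ) ≤ 3 * costScale M.bMax M.hMax QMax δ ^ 3 := by
  have := hM.prob μ hμ
  have hs := costScale_nonneg (QMax := QMax) (hb.1.trans hb.2) (hh.1.trans hh.2) hδ
  calc ∫ d, cost b h d q ^ 3 ∂(M.dist μ)
      ≤ ∫ d, costScale M.bMax M.hMax QMax δ ^ 3 * Real.exp (d ^ 2 / (2 * δ ^ 2)) ∂(M.dist μ) := by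
        refine integral_mono (integrable_cost_pow hM hδ hb hh hμ hq le_rfl)
          ((integrable_exp_sq hδ (hM.subGaussian μ hμ)).const_mul _) fun d => ?_
        have hc := cost_nonneg hb.1 hh.1 d q
        calc cost b h d q ^ 3
            ≤ (costScale M.bMax M.hMax QMax δ * Real.exp (d ^ 2 / (6 * δ ^ 2))) ^ 3 := by
              gcongr; exact cost_le_exp hδ hb hh (hM.Q_subset hq) d
          _ = _ := by
              rw [mul_pow, ← Real.exp_nat_mul]
              congr 2
              push_cast
              field_simp
              ring
    _ ≤ _ := by
        rw [integral_const_mul]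
        have := integral_exp_sq_le hδ (hM.subGaussian μ hμ)
        have h3 : 0 ≤ costScale M.bMax M.hMax QMax δ ^ 3 := by positivity
        nlinarith

lemma expCost_le : M.expCost b h μ q ≤ 3 * costScale M.bMax M.hMax QMax δ := by
  have := hM.prob μ hμ
  have hs := costScale_nonneg (QMax := QMax) (hb.1.trans hb.2) (hh.1.trans hh.2) hδ
  calc M.expCost b h μ q
      ≤ ∫ d, costScale M.bMax M.hMax QMax δ * Real.exp (d ^ 2 / (2 * δ ^ 2)) ∂(M.dist μ) := by
        refine integral_mono (integrable_cost hM hδ hb hh hμ hq)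
          ((integrable_exp_sq hδ (hM.subGaussian μ hμ)).const_mul _) fun d => ?_
        refine (cost_le_exp hδ hb hh (hM.Q_subset hq) d).trans ?_
        gcongr
        norm_num
    _ ≤ _ := by
        rw [integral_const_mul]
        have := integral_exp_sq_le hδ (hM.subGaussian μ hμ)
        nlinarith

lemma expCost_le_costSup : M.expCost b h μ q ≤ M.costSup := by
  refine le_csSup ⟨3 * costScale M.bMax M.hMax QMax δ, ?_⟩ ⟨μ, hμ, q, hq, b, hb, h, hh, rfl⟩
  rintro c ⟨μ', hμ', q', hq', b', hb', h', hh', rfl⟩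
  exact expCost_le hM hδ hb' hh' hμ' hq'

lemma costSup_le : M.costSup ≤ 3 * costScale M.bMax M.hMax QMax δ := by
  refine csSup_le ⟨_, μ, hμ, q, hq, b, hb, h, hh, rfl⟩ ?_
  rintro c ⟨μ', hμ', q', hq', b', hb', h', hh', rfl⟩
  exact expCost_le hM hδ hb' hh' hμ' hq'

/-- The second moment of the cost is small when its mean is, at the rate of a square root. This
is the Cauchy–Schwarz bound `E c² ≤ √(E c) √(E c³)`, obtained from
`2 c² ≤ x c + c³ / x` with `x = 1 / √costSup`. -/
lemma integral_cost_sq_le (hpos : 0 < M.costSup) :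
    ∫ d, cost b h d q ^ 2 ∂(M.dist μ) ≤
      (1 + 3 * costScale M.bMax M.hMax QMax δ ^ 3) / 2 * √M.costSup := by
  have hr : 0 < √M.costSup := Real.sqrt_pos.2 hpos
  have hr2 : √M.costSup ^ 2 = M.costSup := Real.sq_sqrt hpos.le
  have hC := expCost_le_costSup hM hδ hb hh hμ hq
  have h3 := integral_cost_cube_le hM hδ hb hh hμ hq
  have hi1 := integrable_cost hM hδ hb hh hμ hq
  have hi3 := integrable_cost_pow hM hδ hb hh hμ hq (m := 3) le_rfl
  set r := √M.costSup
  calc ∫ d, cost b h d q ^ 2 ∂(M.dist μ)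
      ≤ ∫ d, (1 / (2 * r) * cost b h d q + r / 2 * cost b h d q ^ 3) ∂(M.dist μ) := by
        refine integral_mono (integrable_cost_pow hM hδ hb hh hμ hq (by norm_num))
          ((hi1.const_mul _).add (hi3.const_mul _)) fun d => ?_
        have hc := cost_nonneg hb.1 hh.1 d q
        have key : 1 / (2 * r) * cost b h d q + r / 2 * cost b h d q ^ 3 - cost b h d q ^ 2
            = cost b h d q / (2 * r) * (r * cost b h d q - 1) ^ 2 := by
          field_simp
          ring
        have : 0 ≤ cost b h d q / (2 * r) * (r * cost b h d q - 1) ^ 2 := by positivity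
        simp only
        linarith
    _ = 1 / (2 * r) * M.expCost b h μ q + r / 2 * ∫ d, cost b h d q ^ 3 ∂(M.dist μ) := by
        rw [integral_add (hi1.const_mul _) (hi3.const_mul _), integral_const_mul,
          integral_const_mul]
        rfl
    _ ≤ 1 / (2 * r) * r ^ 2 + r / 2 * (3 * costScale M.bMax M.hMax QMax δ ^ 3) := by
        rw [hr2]; gcongr
    _ = _ := by field_simp

end

end Model

/-! ### Concentration of averages of independent demands -/

lemma sinh_le_mul_cosh {y : ℝ} (hy : 0 ≤ y) : Real.sinh y ≤ y * Real.cosh y := by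
  have h := (convex_Icc 0 y).image_sub_le_mul_sub_of_deriv_le (f := Real.sinh) (C := Real.cosh y)
    Real.continuous_sinh.continuousOn Real.differentiable_sinh.differentiableOn
    (fun x hx => by
      rw [interior_Icc] at hx
      rw [Real.deriv_sinh, Real.cosh_le_cosh, abs_of_pos hx.1, abs_of_nonneg hy]
      exact hx.2.le) 0 (Set.left_mem_Icc.2 hy) y (Set.right_mem_Icc.2 hy) hy
  rw [Real.sinh_zero] at h
  linarith

lemma exp_le_self_add_exp_sq (y : ℝ) : Real.exp y ≤ y + Real.exp (y ^ 2) := by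
  have hc := Real.cosh_le_exp_half_sq y
  have hsq : Real.exp (y ^ 2) = Real.exp (y ^ 2 / 2) ^ 2 := by
    rw [← Real.exp_nat_mul]; congr 1; push_cast; ring
  have h1 : y ^ 2 / 2 + 1 ≤ Real.exp (y ^ 2 / 2) := Real.add_one_le_exp _
  rw [← Real.cosh_add_sinh, hsq]
  set E := Real.exp (y ^ 2 / 2)
  have hE : 1 ≤ E := by nlinarith [sq_nonneg y]
  rcases le_total 0 y with hy | hy
  · have h2 := sinh_le_mul_cosh hy
    have h3 : y ≤ E := by nlinarith [sq_nonneg (y - 1)]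
    nlinarith [mul_le_mul_of_nonneg_left hc hy]
  · have h2 : Real.sinh y ≤ y := Real.sinh_le_self_iff.2 hy
    nlinarith

section Tail

variable {ν : Measure ℝ} [IsProbabilityMeasure ν] {δ : ℝ}

lemma centered_sq_le (hδ : 0 < δ) {m : ℝ} (hm : m ^ 2 ≤ 4 * δ ^ 2) (x : ℝ) :
    Real.exp ((x - m) ^ 2 / (4 * δ ^ 2)) ≤ Real.exp 2 * Real.exp (x ^ 2 / (2 * δ ^ 2)) := by
  rw [← Real.exp_add, Real.exp_le_exp]
  have h2 : 2 + x ^ 2 / (2 * δ ^ 2) = (8 * δ ^ 2 + 2 * x ^ 2) / (4 * δ ^ 2) := by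
    field_simp; ring
  rw [h2]
  gcongr
  nlinarith [sq_nonneg (x + m)]

/-- A centered random variable with tail `2 exp (-x² / δ²)` has a moment generating function
bounded by that of a Gaussian. For `t² ≤ s = 1 / (4 δ²)` the linear term of
`exp y ≤ y + exp y²` integrates to zero and convexity reduces `exp (t² Y²)` to `exp (s Y²)`; for
`t² > s` one uses `t Y ≤ t² / (4 s) + s Y²`. -/
lemma hasSubgaussianMGF_of_tail (hδ : 0 < δ)
    (htail : ∀ x : ℝ, 0 ≤ x → ν.real {y | x < |y|} ≤ 2 * Real.exp (-x ^ 2 / δ ^ 2)) :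
    ProbabilityTheory.HasSubgaussianMGF (fun x => x - ∫ y, y ∂ν)
      (Real.toNNReal (24 * Real.exp 2 * δ ^ 2)) ν := by
  have hmsq := sq_mean_le hδ htail
  set m := ∫ y, y ∂ν with hm
  set K := 3 * Real.exp 2 with hK
  have hint : Integrable (fun x => Real.exp ((x - m) ^ 2 / (4 * δ ^ 2))) ν := by
    refine ((integrable_exp_sq hδ htail).const_mul (Real.exp 2)).mono' (by fun_prop)
      (ae_of_all _ fun x => ?_)
    rw [Real.norm_of_nonneg (Real.exp_pos _).le]
    exact centered_sq_le hδ hmsq x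
  have hEK : ∫ x, Real.exp ((x - m) ^ 2 / (4 * δ ^ 2)) ∂ν ≤ K := by
    have h := integral_mono hint ((integrable_exp_sq hδ htail).const_mul (Real.exp 2))
      (centered_sq_le hδ hmsq)
    rw [integral_const_mul] at h
    have h3 := integral_exp_sq_le hδ htail
    have := Real.exp_pos 2
    nlinarith
  have hyoung : ∀ t x : ℝ, Real.exp (t * (x - m)) ≤
      Real.exp (t ^ 2 * δ ^ 2) * Real.exp ((x - m) ^ 2 / (4 * δ ^ 2)) := by
    intro t x
    rw [← Real.exp_add, Real.exp_le_exp]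
    have : t ^ 2 * δ ^ 2 + (x - m) ^ 2 / (4 * δ ^ 2) - t * (x - m)
        = (t * δ - (x - m) / (2 * δ)) ^ 2 := by field_simp; ring
    nlinarith [sq_nonneg (t * δ - (x - m) / (2 * δ))]
  refine ⟨fun t => ?_, fun t => ?_⟩
  · refine (hint.const_mul (Real.exp (t ^ 2 * δ ^ 2))).mono' (by fun_prop)
      (ae_of_all _ fun x => ?_)
    rw [Real.norm_of_nonneg (Real.exp_pos _).le]
    exact hyoung t x
  rw [Real.coe_toNNReal _ (by positivity)]
  unfold ProbabilityTheory.mgf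
  have hK1 : 1 ≤ K := by have := Real.add_one_le_exp 2; linarith
  rcases le_total (t ^ 2 * (4 * δ ^ 2)) 1 with ht | ht
  · set θ := t ^ 2 * (4 * δ ^ 2) with hθ
    have hθ0 : 0 ≤ θ := by positivity
    have hlin : Integrable (fun x => t * (x - m)) ν :=
      ((integrable_id_of_tail hδ htail).sub (integrable_const m)).const_mul t
    have hmix : Integrable (fun x => θ * Real.exp ((x - m) ^ 2 / (4 * δ ^ 2)) + (1 - θ)) ν :=
      (hint.const_mul θ).add (integrable_const _)
    calc ∫ x, Real.exp (t * (x - m)) ∂ν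
        ≤ ∫ x, (t * (x - m) + (θ * Real.exp ((x - m) ^ 2 / (4 * δ ^ 2)) + (1 - θ))) ∂ν := by
          refine integral_mono_of_nonneg (ae_of_all _ fun x => (Real.exp_pos _).le)
            (hlin.add hmix) (ae_of_all _ fun x => ?_)
          refine (exp_le_self_add_exp_sq _).trans ?_
          have hconv := convexOn_exp.2 (Set.mem_univ ((x - m) ^ 2 / (4 * δ ^ 2)))
            (Set.mem_univ 0) hθ0 (sub_nonneg.2 ht) (by ring)
          simp only [smul_eq_mul, mul_zero, add_zero, Real.exp_zero, mul_one] at hconv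
          have he : (t * (x - m)) ^ 2 = θ * ((x - m) ^ 2 / (4 * δ ^ 2)) := by
            rw [hθ]; field_simp
          rw [he]
          linarith
      _ = θ * ∫ x, Real.exp ((x - m) ^ 2 / (4 * δ ^ 2)) ∂ν + (1 - θ) := by
          rw [integral_add hlin hmix, integral_add (hint.const_mul θ) (integrable_const _),
            integral_const_mul, integral_const_mul,
            integral_sub (integrable_id_of_tail hδ htail) (integrable_const m), ← hm]
          simp
      _ ≤ θ * (K - 1) + 1 := by nlinarith
      _ ≤ Real.exp (θ * (K - 1)) := Real.add_one_le_exp _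
      _ ≤ _ := by
          rw [Real.exp_le_exp, hθ, hK]
          nlinarith [sq_nonneg (t * δ)]
  · calc ∫ x, Real.exp (t * (x - m)) ∂ν
        ≤ ∫ x, Real.exp (t ^ 2 * δ ^ 2) * Real.exp ((x - m) ^ 2 / (4 * δ ^ 2)) ∂ν :=
          integral_mono_of_nonneg (ae_of_all _ fun x => (Real.exp_pos _).le)
            (hint.const_mul _) (ae_of_all _ fun x => hyoung t x)
      _ ≤ Real.exp (t ^ 2 * δ ^ 2) * K := by
          rw [integral_const_mul]; gcongr
      _ ≤ Real.exp (t ^ 2 * δ ^ 2) * Real.exp (K - 1) := by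
          gcongr
          have := Real.add_one_le_exp (K - 1)
          linarith
      _ ≤ _ := by
          rw [← Real.exp_add, Real.exp_le_exp]
          have : t ^ 2 * δ ^ 2 ≤ t ^ 2 * (4 * δ ^ 2) := by nlinarith [sq_nonneg (t * δ)]
          have : K - 1 ≤ (K - 1) * (t ^ 2 * (4 * δ ^ 2)) := by nlinarith
          rw [hK] at *
          nlinarith [sq_nonneg (t * δ)]

end Tail

open ProbabilityTheory in
lemma pi_abs_sum_sub_mean_ge_le {ι : Type*} [Fintype ι] {ν : ι → Measure ℝ}
    [∀ i, IsProbabilityMeasure (ν i)] {δ : ℝ} (hδ : 0 < δ)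
    (htail : ∀ i, ∀ x : ℝ, 0 ≤ x → (ν i).real {y | x < |y|} ≤ 2 * Real.exp (-x ^ 2 / δ ^ 2))
    (S : Finset ι) {ε : ℝ} (hε : 0 ≤ ε) :
    (Measure.pi ν).real {ω | ε ≤ |∑ i ∈ S, (ω i - ∫ y, y ∂(ν i))|} ≤
      2 * Real.exp (-ε ^ 2 / (2 * (S.card * (24 * Real.exp 2 * δ ^ 2)))) := by
  have hind : iIndepFun (fun i (ω : ι → ℝ) => ω i - ∫ y, y ∂(ν i)) (Measure.pi ν) :=
    iIndepFun_pi (X := fun i x => x - ∫ y, y ∂(ν i)) fun i => by fun_prop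
  have hsub : ∀ i, HasSubgaussianMGF (fun ω : ι → ℝ => ω i - ∫ y, y ∂(ν i))
      (Real.toNNReal (24 * Real.exp 2 * δ ^ 2)) (Measure.pi ν) := by
    intro i
    refine HasSubgaussianMGF.of_map (X := fun x => x - ∫ y, y ∂(ν i))
      (Y := fun ω : ι → ℝ => ω i) (measurable_pi_apply i).aemeasurable ?_
    rw [(measurePreserving_eval ν i).map_eq]
    exact hasSubgaussianMGF_of_tail hδ (htail i)
  have hsum := HasSubgaussianMGF.sum_of_iIndepFun hind (s := S) (fun i _ => hsub i)
  have h1 := hsum.measure_ge_le hε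
  have h2 := hsum.neg.measure_ge_le hε
  simp only [Finset.sum_const, nsmul_eq_mul, NNReal.coe_mul, NNReal.coe_natCast,
    Real.coe_toNNReal _ (show 0 ≤ 24 * Real.exp 2 * δ ^ 2 by positivity), Pi.neg_apply] at h1 h2
  calc _ ≤ (Measure.pi ν).real ({ω | ε ≤ ∑ i ∈ S, (ω i - ∫ y, y ∂(ν i))} ∪
        {ω | ε ≤ -∑ i ∈ S, (ω i - ∫ y, y ∂(ν i))}) := by
        refine measureReal_mono fun ω hω => ?_
        exact le_abs.1 (Set.mem_ofPred_eq ▸ hω)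
    _ ≤ _ := measureReal_union_le _ _
    _ ≤ _ := by linarith

/-! ### The bias of window estimates under a variation budget -/

lemma sum_sq_increments_le {T : ℕ} {μ : ℕ → ℝ} {lo hi : ℝ}
    (hμ : ∀ t ∈ Finset.Icc 1 T, μ t ∈ Set.Icc lo hi) {K : ℕ} {t : Fin (K + 1) → ℕ}
    (ht : StrictMono t) (hmem : ∀ k, t k ∈ Finset.Icc 1 T) :
    ∑ k : Fin K, |μ (t k.succ) - μ (t k.castSucc)| ^ 2 ≤ demandVariation T μ := by
  refine le_csSup ⟨T * (hi - lo) ^ 2, ?_⟩ ⟨K, t, ht, hmem, rfl⟩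
  rintro x ⟨K', t', ht', hmem', rfl⟩
  have hcard : K' + 1 ≤ T := by
    have := Finset.card_le_card_of_injOn t' (s := Finset.univ) (t := Finset.Icc 1 T)
      (fun k _ => hmem' k) ht'.injective.injOn
    simpa using this
  calc _ ≤ ∑ k : Fin K', (hi - lo) ^ 2 := by
        refine Finset.sum_le_sum fun k _ => ?_
        have h1 := hμ _ (hmem' k.succ)
        have h2 := hμ _ (hmem' k.castSucc)
        refine pow_le_pow_left₀ (abs_nonneg _) ?_ 2
        rw [abs_le]
        constructor <;> linarith [h1.1, h1.2, h2.1, h2.2]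
    _ = K' * (hi - lo) ^ 2 := by simp
    _ ≤ _ := by
        gcongr
        omega

/-- The increments over `r` periods split into `r` chains, one for each residue modulo `r`. -/
lemma sum_sq_lag_le {T : ℕ} {μ : ℕ → ℝ} {lo hi V : ℝ}
    (hμ : ∀ t ∈ Finset.Icc 1 T, μ t ∈ Set.Icc lo hi) (hV : demandVariation T μ ≤ V) {r : ℕ}
    (hr : 1 ≤ r) :
    ∑ t ∈ Finset.Icc (r + 1) T, |μ (t - r) - μ t| ^ 2 ≤ r * V := by
  have hV0 : 0 ≤ V := by
    rcases Nat.eq_zero_or_pos T with rfl | hT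
    · refine le_trans (Real.sSup_nonneg ?_) hV
      rintro x ⟨K', t', ht', hmem', rfl⟩
      positivity
    · have := sum_sq_increments_le hμ (K := 0) (t := fun _ => 1) (fun i j h => by omega)
        (fun _ => by simp; omega)
      simp at this
      linarith
  have hmaps : ∀ t ∈ Finset.Icc (r + 1) T, t % r ∈ Finset.range r := fun t _ =>
    Finset.mem_range.2 (Nat.mod_lt _ hr)
  rw [← Finset.sum_fiberwise_of_maps_to hmaps]
  calc _ ≤ ∑ c ∈ Finset.range r, V := by
        refine Finset.sum_le_sum fun c hc => ?_
        have hcr := Finset.mem_range.1 hc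
        -- the chain of residue `c` starts at `c`, or at `r` if `c = 0`
        obtain ⟨c₀, hc1, hcr', hcmod⟩ : ∃ c₀, 1 ≤ c₀ ∧ c₀ ≤ r ∧ c₀ % r = c := by
          rcases Nat.eq_zero_or_pos c with rfl | h
          · exact ⟨r, hr, le_rfl, Nat.mod_self r⟩
          · exact ⟨c, h, hcr.le, Nat.mod_eq_of_lt hcr⟩
        by_cases hcT : T < c₀
        · rw [Finset.sum_eq_zero]
          · exact hV0
          · intro t ht
            simp at ht
            omega
        set K := (T - c₀) / r with hK
        have hKr : K * r ≤ T - c₀ := Nat.div_mul_le_self _ _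
        have hmono : StrictMono fun k : Fin (K + 1) => c₀ + k.val * r := by
          intro i j hij
          have : i.val < j.val := hij
          have := Nat.mul_lt_mul_of_pos_right this hr
          simp only
          omega
        refine le_trans (le_of_eq ?_) ((sum_sq_increments_le hμ hmono fun k => ?_).trans hV)
        · simp only [Fin.val_succ, Fin.val_castSucc]
          rw [Fin.sum_univ_eq_sum_range
            (fun k => |μ (c₀ + (k + 1) * r) - μ (c₀ + k * r)| ^ 2) K]
          symm
          refine Finset.sum_bij (fun k _ => c₀ + (k + 1) * r) ?_ ?_ ?_ ?_
          · intro k hk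
            have hk' := Finset.mem_range.1 hk
            have : (k + 1) * r ≤ K * r := Nat.mul_le_mul_right r hk'
            have h2 : (k + 1) * r = k * r + r := by ring
            simp only [Finset.mem_filter, Finset.mem_Icc, Nat.add_mul_mod_self_right]
            exact ⟨⟨by omega, by omega⟩, hcmod⟩
          · intro k _ k' _ h
            have : (k + 1) * r = (k' + 1) * r := by simpa using h
            have := Nat.eq_of_mul_eq_mul_right hr this
            omega
          · intro t ht
            simp only [Finset.mem_filter, Finset.mem_Icc] at ht
            obtain ⟨⟨h1, h2⟩, h3⟩ := ht
            have hdvd : r ∣ t - c₀ :=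
              (Nat.modEq_iff_dvd' (by omega)).1 (hcmod.trans h3.symm)
            obtain ⟨k, hk⟩ := hdvd
            have hkpos : 1 ≤ k := by
              rcases Nat.eq_zero_or_pos k with rfl | h
              · simp at hk; omega
              · exact h
            refine ⟨k - 1, ?_, ?_⟩
            · rw [Finset.mem_range]
              have : k ≤ K := by
                rw [hK, Nat.le_div_iff_mul_le hr, mul_comm, ← hk]
                omega
              omega
            · rw [Nat.sub_add_cancel hkpos, mul_comm, ← hk]
              omega
          · intro k _
            have h2 : (k + 1) * r = k * r + r := by ring
            have : c₀ + (k + 1) * r - r = c₀ + k * r := by omega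
            rw [this, abs_sub_comm]
        · have : k.val * r ≤ K * r := Nat.mul_le_mul_right r (by omega)
          simp only [Finset.mem_Icc]
          omega
    _ = r * V := by simp

/-- The total bias of a moving average of window `n`, by Cauchy–Schwarz over periods and lags. -/
lemma sum_avg_bias_le {T L n : ℕ} {μ : ℕ → ℝ} {lo hi V : ℝ}
    (hμ : ∀ t ∈ Finset.Icc 1 T, μ t ∈ Set.Icc lo hi) (hV : demandVariation T μ ≤ V) (hn : 1 ≤ n) (hnL : n ≤ L) :
    ∑ t ∈ Finset.Icc (L + 1) T, (∑ s ∈ Finset.Ico (t - n) t, |μ s - μ t|) / n ≤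
      √(T * V * ((n + 1) / 2)) := by
  have hn0 : (0 : ℝ) < n := by exact_mod_cast hn
  have hlag : ∀ t ∈ Finset.Icc (L + 1) T, ∑ s ∈ Finset.Ico (t - n) t, |μ s - μ t| =
      ∑ r ∈ Finset.Icc 1 n, |μ (t - r) - μ t| := by
    intro t ht
    have h1 := (Finset.mem_Icc.1 ht).1
    refine Finset.sum_bij' (fun s _ => t - s) (fun r _ => t - r) ?_ ?_ ?_ ?_ ?_
    · intro s hs; simp at hs ⊢; omega
    · intro s hs; simp at hs ⊢; omega
    · intro s hs; simp at hs ⊢; omega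
    · intro s hs; simp at hs ⊢; omega
    · intro s hs
      have : t - (t - s) = s := by simp at hs; omega
      simp only [this]
  rw [← Finset.sum_div, Finset.sum_congr rfl hlag, Finset.sum_comm, ← Finset.sum_product']
  have hCS := sq_sum_le_card_mul_sum_sq (s := Finset.Icc 1 n ×ˢ Finset.Icc (L + 1) T)
    (f := fun p => |μ (p.2 - p.1) - μ p.2|)
  set A := ∑ x ∈ Finset.Icc 1 n ×ˢ Finset.Icc (L + 1) T, |μ (x.2 - x.1) - μ x.2|
  have hsum : ∑ x ∈ Finset.Icc 1 n ×ˢ Finset.Icc (L + 1) T, |μ (x.2 - x.1) - μ x.2| ^ 2 ≤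
      n * (n + 1) / 2 * V := by
    rw [Finset.sum_product]
    calc _ ≤ ∑ r ∈ Finset.Icc 1 n, (r : ℝ) * V := by
          refine Finset.sum_le_sum fun r hr => ?_
          have hr' := Finset.mem_Icc.1 hr
          refine le_trans ?_ (sum_sq_lag_le hμ hV hr'.1)
          refine Finset.sum_le_sum_of_subset_of_nonneg ?_ fun _ _ _ => by positivity
          exact Finset.Icc_subset_Icc_left (by omega)
      _ = _ := by
          rw [← Finset.sum_mul]
          congr 1
          have := Finset.sum_range_id_mul_two (n + 1)
          have h2 : ∑ r ∈ Finset.Icc 1 n, (r : ℝ) = ∑ r ∈ Finset.range (n + 1), (r : ℝ) := by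
            rw [Finset.range_eq_Ico, Finset.sum_eq_sum_Ico_succ_bot (by omega)]
            simp [Finset.Ico_add_one_right_eq_Icc]
          rw [h2]
          have h3 : ((∑ r ∈ Finset.range (n + 1), r : ℕ) : ℝ) * 2 = (n + 1) * n := by
            exact_mod_cast this
          push_cast at h3
          linarith
  have hcard : ((Finset.Icc 1 n ×ˢ Finset.Icc (L + 1) T).card : ℝ) ≤ n * T := by
    rw [Finset.card_product]
    simp only [Nat.card_Icc]
    push_cast
    gcongr
    exact_mod_cast (by omega : T - L ≤ T)
  refine Real.le_sqrt_of_sq_le ?_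
  rw [div_pow, div_le_iff₀ (by positivity)]
  calc A ^ 2 ≤ _ := hCS
    _ ≤ (n * T) * (n * (n + 1) / 2 * V) := by gcongr
    _ = _ := by ring

/-! ### The grid of candidate variation parameters -/

lemma log_natCast_pos {T : ℕ} (hT : 2 ≤ T) : 0 < Real.log T :=
  Real.log_pos (by exact_mod_cast hT)

lemma half_le_log {T : ℕ} (hT : 2 ≤ T) : 1 / 2 ≤ Real.log T := by
  have h := Real.log_two_gt_d9
  have h2 : Real.log 2 ≤ Real.log T := Real.log_le_log (by norm_num) (by exact_mod_cast hT)
  linarith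

lemma candidate_pos {T : ℕ} (hT : 2 ≤ T) (j : ℕ) : 0 < candidate T j := by
  have := log_natCast_pos hT
  unfold candidate
  positivity

lemma candidate_lt {T : ℕ} (hT : 2 ≤ T) {i j : ℕ} (hi : 1 ≤ i) (hij : i < j) :
    candidate T i < candidate T j := by
  have := log_natCast_pos hT
  unfold candidate
  gcongr
  · have : 0 < 1 / Real.log T := by positivity
    linarith

/-- By Bernoulli's inequality, `⌈log² T⌉ + 1` steps of the geometric grid reach `1`. -/
lemma numCandidates_spec {T : ℕ} (hT : 2 ≤ T) :
    1 ≤ numCandidates T ∧ 1 ≤ candidate T (numCandidates T) ∧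
      (numCandidates T : ℝ) ≤ 9 * Real.log T ^ 2 := by
  have hl := log_natCast_pos hT
  have hmem : ⌈Real.log T ^ 2⌉₊ + 1 ∈ {k | 1 ≤ k ∧ 1 ≤ candidate T k} := by
    refine ⟨by omega, ?_⟩
    have h1 : Real.log T ^ 2 ≤ ⌈Real.log T ^ 2⌉₊ := Nat.le_ceil _
    have h2 := one_add_mul_le_pow (a := 1 / Real.log T)
      (by have : 0 < 1 / Real.log T := by positivity
          linarith) ⌈Real.log T ^ 2⌉₊
    have h3 : Real.log T ≤ (1 + 1 / Real.log T) ^ ⌈Real.log T ^ 2⌉₊ := by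
      refine le_trans ?_ h2
      have : Real.log T = Real.log T ^ 2 * (1 / Real.log T) := by field_simp
      have : Real.log T ^ 2 * (1 / Real.log T) ≤ ⌈Real.log T ^ 2⌉₊ * (1 / Real.log T) := by gcongr
      linarith
    unfold candidate
    rw [Nat.add_sub_cancel, mul_one_div, le_div_iff₀ hl]
    linarith
  have hinf := Nat.sInf_mem (⟨_, hmem⟩ : {k | 1 ≤ k ∧ 1 ≤ candidate T k}.Nonempty)
  refine ⟨hinf.1, hinf.2, ?_⟩
  have hle : numCandidates T ≤ ⌈Real.log T ^ 2⌉₊ + 1 := Nat.sInf_le hmem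
  have hc := Nat.ceil_lt_add_one (sq_nonneg (Real.log T))
  have hh := half_le_log hT
  have : (numCandidates T : ℝ) ≤ ⌈Real.log T ^ 2⌉₊ + 1 := by exact_mod_cast hle
  nlinarith

/-- Some candidate exceeds `v` by at most `1 / log T`, which costs only a constant factor in
`T ^ v`. -/
lemma exists_candidate_near {T : ℕ} (hT : 2 ≤ T) {v : ℝ} (hv : v ∈ Set.Icc (0 : ℝ) 1) :
    ∃ j, 1 ≤ j ∧ j ≤ numCandidates T ∧ v ≤ candidate T j ∧
      candidate T j ≤ v + 1 / Real.log T := by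
  classical
  have hl := log_natCast_pos hT
  obtain ⟨hk1, hk2, -⟩ := numCandidates_spec hT
  have hex : ∃ j, 1 ≤ j ∧ v ≤ candidate T j := ⟨_, hk1, hv.2.trans hk2⟩
  obtain ⟨h1, h2⟩ := Nat.find_spec hex
  refine ⟨Nat.find hex, h1, Nat.find_min' hex ⟨hk1, hv.2.trans hk2⟩, h2, ?_⟩
  have hmin := fun m (hm : m < Nat.find hex) => Nat.find_min hex hm
  set j := Nat.find hex
  rcases Nat.lt_or_ge 1 j with hj | hj
  · have hlt : candidate T (j - 1) < v := by
      by_contra hcon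
      exact hmin (j - 1) (by omega) ⟨by omega, not_lt.1 hcon⟩
    have hrec : candidate T j = (1 + 1 / Real.log T) * candidate T (j - 1) := by
      unfold candidate
      have : j - 1 = (j - 1 - 1) + 1 := by omega
      rw [this, pow_succ]
      simp only [Nat.add_sub_cancel]
      ring
    rw [hrec]
    have : 0 < 1 / Real.log T := by positivity
    nlinarith [hv.2]
  · have : j = 1 := by omega
    rw [this]
    unfold candidate
    simp only [Nat.sub_self, pow_zero, one_mul]
    linarith [hv.1]

/-! ### The Shrinking-Time-Window Policy on a fixed demand sequence -/

/-- Half of the value at which the test against candidate `j` triggers; also the bound on the total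
estimation error of window `j` when `v ≤ v_j`. -/
noncomputable def errorBound (κ γ : ℝ) (T j : ℕ) : ℝ :=
  (γ * √(Real.log T) + √κ) * (T : ℝ) ^ ((3 + candidate T j) / 4)

lemma errorBound_nonneg {κ γ : ℝ} (hγ : 0 < γ) (T j : ℕ) : 0 ≤ errorBound κ γ T j := by
  unfold errorBound; positivity

lemma errorBound_lt {κ γ : ℝ} (hγ : 0 < γ) {T : ℕ} (hT : 2 ≤ T) {i j : ℕ} (hi : 1 ≤ i)
    (hij : i < j) : errorBound κ γ T i < errorBound κ γ T j := by
  have hl := log_natCast_pos hT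
  have hc := candidate_lt hT hi hij
  unfold errorBound
  have hT1 : (1 : ℝ) < T := by exact_mod_cast hT
  gcongr ?_ * ?_
  exact Real.rpow_lt_rpow_of_exponent_lt hT1 (by linarith)

namespace Model

variable {M : Model}

lemma clip_mem (hM : M.muMin ≤ M.muMax) (x : ℝ) : M.clip x ∈ Set.Icc M.muMin M.muMax :=
  ⟨le_max_left _ _, max_le hM (min_le_right _ _)⟩

lemma abs_clip_sub_le {m : ℝ} (hm : m ∈ Set.Icc M.muMin M.muMax) (x : ℝ) :
    |M.clip x - m| ≤ |x - m| := by
  have h : M.clip m = m := by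
    unfold clip
    rw [min_eq_left hm.2, max_eq_right hm.1]
  calc |M.clip x - m| = |M.clip x - M.clip m| := by rw [h]
    _ ≤ |min x M.muMax - min m M.muMax| := by
        unfold clip
        simpa only [max_comm M.muMin] using abs_max_sub_max_le_abs _ _ _
    _ ≤ |x - m| := by
        simpa using abs_min_sub_min_le_max x M.muMax m M.muMax

lemma abs_sub_le_range {x y : ℝ} (hx : x ∈ Set.Icc M.muMin M.muMax)
    (hy : y ∈ Set.Icc M.muMin M.muMax) : |x - y| ≤ M.muMax - M.muMin := by
  rw [abs_le]
  constructor <;> linarith [hx.1, hx.2, hy.1, hy.2]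

lemma windowEstimate_mem (hM : M.muMin ≤ M.muMax) (κ : ℝ) (T : ℕ) (d : ℕ → ℝ) (j t : ℕ) :
    M.windowEstimate κ T d j t ∈ Set.Icc M.muMin M.muMax := clip_mem hM _

lemma shrinkingState_of_le (κ γ : ℝ) (T : ℕ) (d : ℕ → ℝ) {t : ℕ} (ht : t ≤ initialLength T) :
    M.shrinkingState κ γ T d t = (1, initialLength T + 1) := by
  induction t with
  | zero => rfl
  | succ t ih =>
    rw [shrinkingState, if_neg (by omega)]
    rw [ih (by omega)]

/-- If all windows from `j₀` on have total estimation error within `errorBound`, then the policy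
never leaves window `j₀` once it gets there, and in each earlier epoch its estimates stay close to
those of window `j₀`. The period of a switch is not tested against the new window, whence the term
`muMax - muMin`. -/
lemma sum_abs_shrinking_sub_le (hM : M.muMin ≤ M.muMax) {κ γ : ℝ} (hγ : 0 < γ) {T : ℕ}
    (hT : 2 ≤ T) {d μ : ℕ → ℝ} {j₀ : ℕ} (hj1 : 1 ≤ j₀) (hjk : j₀ ≤ numCandidates T)
    (hLT : initialLength T ≤ T)
    (herr : ∀ j ∈ Finset.Icc j₀ (numCandidates T),
      ∑ t ∈ Finset.Icc (initialLength T + 1) T, |M.windowEstimate κ T d j t - μ t| ≤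
        errorBound κ γ T j) :
    ∑ t ∈ Finset.Icc (initialLength T + 1) T,
        |M.windowEstimate κ T d (M.shrinkingState κ γ T d t).1 t - μ t| ≤
      errorBound κ γ T j₀ +
        numCandidates T * (2 * errorBound κ γ T j₀ + (M.muMax - M.muMin)) := by
  set L := initialLength T with hL
  set E := M.windowEstimate κ T d with hE
  set R := M.muMax - M.muMin with hR
  set B := 2 * errorBound κ γ T j₀ + R with hB
  have hθ := errorBound_nonneg (κ := κ) hγ T j₀
  have hR0 : 0 ≤ R := sub_nonneg.2 hM
  have hER : ∀ i j t, |E i t - E j t| ≤ R := fun i j t =>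
    abs_sub_le_range (windowEstimate_mem hM κ T d i t) (windowEstimate_mem hM κ T d j t)
  -- window `j₀` is never abandoned
  have hkeep : ∀ f t j, L + 1 ≤ f → t ≤ T → j₀ < j → j ≤ numCandidates T →
      ∑ s ∈ Finset.Icc f t, |E j₀ s - E j s| < 2 * errorBound κ γ T j := by
    intro f t j hf ht hj hjn
    calc ∑ s ∈ Finset.Icc f t, |E j₀ s - E j s|
        ≤ ∑ s ∈ Finset.Icc (L + 1) T, |E j₀ s - E j s| :=
          Finset.sum_le_sum_of_subset_of_nonneg (Finset.Icc_subset_Icc hf ht)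
            fun _ _ _ => abs_nonneg _
      _ ≤ ∑ s ∈ Finset.Icc (L + 1) T, (|E j₀ s - μ s| + |E j s - μ s|) :=
          Finset.sum_le_sum fun s _ => by
            rw [abs_sub_comm (E j s) (μ s)]; exact abs_sub_le _ _ _
      _ ≤ errorBound κ γ T j₀ + errorBound κ γ T j := by
          rw [Finset.sum_add_distrib]
          exact add_le_add (herr j₀ (Finset.mem_Icc.2 ⟨le_rfl, hjk⟩))
            (herr j (Finset.mem_Icc.2 ⟨hj.le, hjn⟩))
      _ < _ := by
          have := errorBound_lt (κ := κ) hγ hT hj1 hj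
          linarith
  have hinv : ∀ t, L ≤ t → t ≤ T →
      1 ≤ (M.shrinkingState κ γ T d t).1 ∧ (M.shrinkingState κ γ T d t).1 ≤ j₀ ∧
      L + 1 ≤ (M.shrinkingState κ γ T d t).2 ∧ (M.shrinkingState κ γ T d t).2 ≤ t + 1 ∧
      ∑ s ∈ Finset.Icc (M.shrinkingState κ γ T d t).2 t,
        |E (M.shrinkingState κ γ T d t).1 s - E j₀ s| ≤ B ∧
      ∑ s ∈ Finset.Icc (L + 1) t, |E (M.shrinkingState κ γ T d s).1 s - E j₀ s| ≤
        ((M.shrinkingState κ γ T d t).1 - 1) * B +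
        ∑ s ∈ Finset.Icc (M.shrinkingState κ γ T d t).2 t,
          |E (M.shrinkingState κ γ T d t).1 s - E j₀ s| := by
    intro t ht
    induction t, ht using Nat.le_induction with
    | base =>
      intro _
      rw [shrinkingState_of_le κ γ T d le_rfl]
      simp only [← hL]
      refine ⟨le_rfl, hj1, le_rfl, le_rfl, ?_, ?_⟩
      · simp; positivity
      · simp
    | succ t ht ih =>
      intro htT
      obtain ⟨h1, h2, h3, h4, h5, h6⟩ := ih (by omega)
      rw [← Finset.insert_Icc_right_eq_Icc_add_one (a := L + 1) (b := t) (by omega),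
        Finset.sum_insert (by simp)]
      have hstep := shrinkingState.eq_2 M κ γ T d t
      set i := (M.shrinkingState κ γ T d t).1
      set f := (M.shrinkingState κ γ T d t).2
      rw [Nat.succ_eq_add_one] at hstep
      split_ifs at hstep with htrig
      · simp only [hstep]
        obtain ⟨-, j, hij, hjn, htr⟩ := htrig
        have hij₀ : i < j₀ := by
          refine lt_of_le_of_ne h2 fun hcon => ?_
          have := hkeep f (t + 1) j h3 htT (hcon ▸ hij) hjn
          rw [hcon] at htr
          unfold errorBound at this
          linarith
        rw [Finset.Icc_self, Finset.sum_singleton]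
        refine ⟨by omega, by omega, by omega, by omega, ?_, ?_⟩
        · have := hER (i + 1) j₀ (t + 1)
          linarith
        · push_cast
          linarith
      · simp only [hstep]
        rw [← Finset.insert_Icc_right_eq_Icc_add_one (a := f) (b := t) (by omega),
          Finset.sum_insert (by simp)]
        refine ⟨h1, h2, h3, by omega, ?_, by linarith⟩
        rcases eq_or_lt_of_le h2 with heq | hlt
        · rw [heq]
          simp
          positivity
        · have hno : ∑ s ∈ Finset.Icc f (t + 1), |E i s - E j₀ s| < 2 * errorBound κ γ T j₀ := by
            by_contra hcon
            refine htrig ⟨by omega, j₀, hlt, hjk, ?_⟩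
            unfold errorBound at hcon
            linarith
          rw [← Finset.insert_Icc_right_eq_Icc_add_one (a := f) (b := t) (by omega),
            Finset.sum_insert (by simp)] at hno
          linarith
  obtain ⟨h1, h2, h3, h4, h5, h6⟩ := hinv T hLT le_rfl
  have hi : ((M.shrinkingState κ γ T d T).1 : ℝ) ≤ numCandidates T := by
    exact_mod_cast h2.trans hjk
  have hB0 : 0 ≤ B := by positivity
  calc _ ≤ ∑ t ∈ Finset.Icc (L + 1) T,
        (|E j₀ t - μ t| + |E (M.shrinkingState κ γ T d t).1 t - E j₀ t|) :=
        Finset.sum_le_sum fun s _ => by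
          rw [add_comm]; exact abs_sub_le _ _ _
    _ ≤ errorBound κ γ T j₀ + ((M.shrinkingState κ γ T d T).1 : ℝ) * B := by
        rw [Finset.sum_add_distrib]
        refine add_le_add (herr j₀ (Finset.mem_Icc.2 ⟨le_rfl, hjk⟩)) ?_
        linarith
    _ ≤ _ := by gcongr

end Model

/-! ### Estimation errors of the windows -/

lemma rpow_mul_sqrt_rpow {T : ℕ} (hT : 2 ≤ T) (u : ℝ) :
    (T : ℝ) ^ ((3 + u) / 4) * √((T : ℝ) ^ ((1 - u) / 2)) = T := by
  have hT0 : (0 : ℝ) < T := by positivity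
  rw [Real.sqrt_eq_rpow, ← Real.rpow_mul hT0.le, ← Real.rpow_add hT0]
  convert Real.rpow_one (T : ℝ) using 2
  ring

lemma window_pos {κ : ℝ} (hκ : 0 < κ) {T : ℕ} (hT : 2 ≤ T) (j : ℕ) : 0 < window κ T j := by
  have hT0 : (0 : ℝ) < T := by positivity
  exact Nat.ceil_pos.2 (by positivity)

/-- For horizons that are long relative to `κ`, all windows used after the initial phase are
complete. -/
lemma window_le_initialLength {κ : ℝ} (hκ : 0 < κ) {T : ℕ} (hT : 2 ≤ T)
    (hTκ : (κ + 2) ^ 4 ≤ T) (j : ℕ) : window κ T j ≤ initialLength T := by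
  have hT0 : (0 : ℝ) < T := by positivity
  have hT1 : (1 : ℝ) ≤ T := by exact_mod_cast (by omega : 1 ≤ T)
  have hx : (T : ℝ) ^ ((1 - candidate T j) / 2) ≤ (T : ℝ) ^ (1 / 2 : ℝ) :=
    Real.rpow_le_rpow_of_exponent_le hT1 (by linarith [candidate_pos hT j])
  have hy1 : (1 : ℝ) ≤ (T : ℝ) ^ (1 / 2 : ℝ) := Real.one_le_rpow hT1 (by norm_num)
  have hz : κ + 2 ≤ (T : ℝ) ^ (1 / 4 : ℝ) := by
    calc κ + 2 = ((κ + 2) ^ 4) ^ (1 / 4 : ℝ) := by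
          rw [← Real.rpow_natCast, ← Real.rpow_mul (by positivity)]; norm_num
      _ ≤ _ := Real.rpow_le_rpow (by positivity) hTκ (by norm_num)
  have hmul : (T : ℝ) ^ (3 / 4 : ℝ) = (T : ℝ) ^ (1 / 4 : ℝ) * (T : ℝ) ^ (1 / 2 : ℝ) := by
    rw [← Real.rpow_add hT0]; norm_num
  refine Nat.le_floor ?_
  have hc : (window κ T j : ℝ) < κ * (T : ℝ) ^ ((1 - candidate T j) / 2) + 1 :=
    Nat.ceil_lt_add_one (by positivity)
  rw [hmul]
  nlinarith [mul_le_mul_of_nonneg_left hx hκ.le]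

lemma initialLength_le {T : ℕ} (hT : 2 ≤ T) : initialLength T ≤ T := by
  have hT1 : (1 : ℝ) ≤ T := by exact_mod_cast (by omega : 1 ≤ T)
  refine Nat.floor_le_of_le ?_
  calc (T : ℝ) ^ (3 / 4 : ℝ) ≤ (T : ℝ) ^ (1 : ℝ) :=
        Real.rpow_le_rpow_of_exponent_le hT1 (by norm_num)
    _ = T := Real.rpow_one _

/-- The size of the average noise of window `j` that is exceeded with small probability only. -/
noncomputable def noiseLevel (γ : ℝ) (T j : ℕ) : ℝ :=
  γ * √(Real.log T) / √((T : ℝ) ^ ((1 - candidate T j) / 2))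

lemma natCast_mul_noiseLevel {T : ℕ} (hT : 2 ≤ T) (γ : ℝ) (j : ℕ) :
    T * noiseLevel γ T j = γ * √(Real.log T) * (T : ℝ) ^ ((3 + candidate T j) / 4) := by
  have hT0 : (0 : ℝ) < T := by positivity
  have h := rpow_mul_sqrt_rpow hT (candidate T j)
  have hs : 0 < √((T : ℝ) ^ ((1 - candidate T j) / 2)) := Real.sqrt_pos.2 (by positivity)
  unfold noiseLevel
  rw [mul_div_assoc', div_eq_iff hs.ne']
  nth_rw 1 [← h]
  ring

lemma noiseLevel_nonneg {γ : ℝ} (hγ : 0 < γ) (T j : ℕ) : 0 ≤ noiseLevel γ T j := by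
  unfold noiseLevel; positivity

lemma large_product {κ γ δ : ℝ} (hδ : 0 < δ)
    (hγ_large : 5 / 2 ≤ κ * γ ^ 2 / (144 * Real.exp 1 * δ ^ 2)) :
    360 * Real.exp 1 * δ ^ 2 ≤ κ * γ ^ 2 := by
  rw [le_div_iff₀ (by positivity)] at hγ_large
  linarith

/-- On the event of small noise, window `j` has total estimation error within `errorBound` as soon
as `v ≤ v_j`. If the window is so short that rounding up its length matters, the bound exceeds
`T` times the length of the mean range and holds trivially. -/
lemma Model.Valid.sum_abs_windowEstimate_sub_le {M : Model} {QMax δ ℓ : ℝ}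
    (hM : M.Valid QMax δ ℓ) (hδ : 0 < δ) {κ γ : ℝ} (hκ : 0 < κ) (hγ : 0 < γ)
    (hγ_large : 5 / 2 ≤ κ * γ ^ 2 / (144 * Real.exp 1 * δ ^ 2)) {T : ℕ} (hT : 2 ≤ T)
    {μ d : ℕ → ℝ} {v : ℝ} (hμ : μ ∈ M.instances T v) {j : ℕ}
    (hj : v ≤ candidate T j) (hnL : window κ T j ≤ initialLength T)
    (hnoise : ∀ t ∈ Finset.Icc (initialLength T + 1) T,
      |∑ s ∈ Finset.Ico (t - window κ T j) t, (d s - μ s)| ≤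
        window κ T j * noiseLevel γ T j) :
    ∑ t ∈ Finset.Icc (initialLength T + 1) T, |M.windowEstimate κ T d j t - μ t| ≤
      errorBound κ γ T j := by
  have hT0 : (0 : ℝ) < T := by positivity
  have hT1 : (1 : ℝ) ≤ T := by exact_mod_cast (by omega : 1 ≤ T)
  have hl := half_le_log hT
  have hl0 := log_natCast_pos hT
  have hn := window_pos hκ hT j
  have hn0 : (0 : ℝ) < window κ T j := by exact_mod_cast hn
  have hbig := large_product hδ hγ_large
  have he : 1 ≤ Real.exp 1 := Real.one_le_exp zero_le_one
  have hTn := natCast_mul_noiseLevel hT γ j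
  have hwc : (window κ T j : ℝ) < κ * (T : ℝ) ^ ((1 - candidate T j) / 2) + 1 :=
    Nat.ceil_lt_add_one (by positivity)
  have hμT : ∀ t ∈ Finset.Icc (initialLength T + 1) T, μ t ∈ Set.Icc M.muMin M.muMax := by
    intro t ht
    refine hμ.1 t (Finset.Icc_subset_Icc_left (by omega) ht)
  have hcard : ((Finset.Icc (initialLength T + 1) T).card : ℝ) ≤ T := by
    rw [Nat.card_Icc]
    exact_mod_cast (by omega : T + 1 - (initialLength T + 1) ≤ T)
  have hmain : γ * √(Real.log T) * (T : ℝ) ^ ((3 + candidate T j) / 4) ≤ errorBound κ γ T j := by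
    unfold errorBound
    gcongr
    linarith [Real.sqrt_nonneg κ]
  rcases lt_or_ge (κ * (T : ℝ) ^ ((1 - candidate T j) / 2)) 2 with hx | hx
  -- a window of bounded length: the mean range has length at most `4 δ`
  · refine le_trans ?_ hmain
    rw [← hTn]
    have hlev : 4 * δ ≤ noiseLevel γ T j := by
      unfold noiseLevel
      have hxpos : 0 < (T : ℝ) ^ ((1 - candidate T j) / 2) := by positivity
      set x := (T : ℝ) ^ ((1 - candidate T j) / 2)
      rw [le_div_iff₀ (Real.sqrt_pos.2 hxpos)]
      refine le_of_sq_le_sq ?_ (by positivity)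
      rw [mul_pow, mul_pow, mul_pow, Real.sq_sqrt hxpos.le, Real.sq_sqrt hl0.le]
      have h1 : κ * (16 * δ ^ 2 * x) ≤ κ * (γ ^ 2 * (1 / 2)) := by
        have : 0 < δ ^ 2 := by positivity
        nlinarith
      have h2 := le_of_mul_le_mul_left h1 hκ
      nlinarith [sq_nonneg γ]
    calc _ ≤ ∑ t ∈ Finset.Icc (initialLength T + 1) T, 4 * δ :=
          Finset.sum_le_sum fun t ht =>
            (Model.abs_sub_le_range (Model.windowEstimate_mem hM.mu_le κ T d j t)
              (hμT t ht)).trans (hM.range_le hδ)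
      _ = (Finset.Icc (initialLength T + 1) T).card * (4 * δ) := by simp
      _ ≤ _ := by gcongr
  -- otherwise rounding up is harmless: `(n + 1) / 2 ≤ κ T ^ ((1 - v_j) / 2)`
  · have hterm : ∀ t ∈ Finset.Icc (initialLength T + 1) T,
        |M.windowEstimate κ T d j t - μ t| ≤ noiseLevel γ T j +
          (∑ s ∈ Finset.Ico (t - window κ T j) t, |μ s - μ t|) / window κ T j := by
      intro t ht
      have ht' := Finset.mem_Icc.1 ht
      refine (Model.abs_clip_sub_le (hμT t ht) _).trans ?_
      rw [max_eq_right (by omega : 1 ≤ t - window κ T j)]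
      have hcardI : (Finset.Ico (t - window κ T j) t).card = window κ T j := by
        rw [Nat.card_Ico]; omega
      have hsplit : (∑ s ∈ Finset.Ico (t - window κ T j) t, d s) / window κ T j - μ t =
          ((∑ s ∈ Finset.Ico (t - window κ T j) t, (d s - μ s)) +
            ∑ s ∈ Finset.Ico (t - window κ T j) t, (μ s - μ t)) / window κ T j := by
        rw [← Finset.sum_add_distrib]
        simp only [sub_add_sub_cancel]
        rw [Finset.sum_sub_distrib, Finset.sum_const, hcardI, nsmul_eq_mul]
        field_simp
      rw [hsplit, abs_div, abs_of_pos hn0, div_le_iff₀ hn0, add_mul,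
        div_mul_cancel₀ _ hn0.ne', mul_comm (noiseLevel γ T j)]
      exact (abs_add_le _ _).trans (add_le_add (hnoise t ht) (Finset.abs_sum_le_sum_abs _ _))
    have hbias := sum_avg_bias_le hμ.1 hμ.2 hn hnL
    calc _ ≤ _ := Finset.sum_le_sum hterm
      _ ≤ T * noiseLevel γ T j +
          √(T * (T : ℝ) ^ v * ((window κ T j + 1) / 2)) := by
          rw [Finset.sum_add_distrib, Finset.sum_const, nsmul_eq_mul]
          have := noiseLevel_nonneg hγ T j
          gcongr
      _ ≤ errorBound κ γ T j := by
          rw [hTn]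
          unfold errorBound
          rw [add_mul]
          gcongr
          calc √(T * (T : ℝ) ^ v * ((window κ T j + 1) / 2))
              ≤ √(κ * ((T : ℝ) ^ ((3 + candidate T j) / 4)) ^ 2) := by
                refine Real.sqrt_le_sqrt ?_
                have h1 : ((window κ T j : ℝ) + 1) / 2 ≤
                    κ * (T : ℝ) ^ ((1 - candidate T j) / 2) := by linarith
                calc _ ≤ T * (T : ℝ) ^ v * (κ * (T : ℝ) ^ ((1 - candidate T j) / 2)) := by gcongr
                  _ = κ * (T : ℝ) ^ (1 + v + (1 - candidate T j) / 2) := by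
                      rw [Real.rpow_add hT0, Real.rpow_add hT0, Real.rpow_one]
                      ring
                  _ ≤ _ := by
                      rw [← Real.rpow_natCast, ← Real.rpow_mul hT0.le]
                      gcongr
                      push_cast
                      linarith
            _ = _ := by
                rw [Real.sqrt_mul hκ.le, Real.sqrt_sq (by positivity)]

lemma extend_coe {T : ℕ} (x : Finset.Icc 1 T → ℝ) (i : Finset.Icc 1 T) : extend x i = x i := by
  simp only [extend, i.2, dite_true]

/-- The event that some window has a large average noise in some period. -/
def noiseEvent (κ γ : ℝ) (T : ℕ) (μ : ℕ → ℝ) : Set (Finset.Icc 1 T → ℝ) :=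
  ⋃ j ∈ Finset.Icc 1 (numCandidates T), ⋃ t ∈ Finset.Icc (initialLength T + 1) T,
    {x | window κ T j * noiseLevel γ T j ≤
      |∑ s ∈ Finset.Ico (t - window κ T j) t, (extend x s - μ s)|}

/-- Hoeffding's inequality and a union bound over windows and periods. -/
lemma Model.Valid.measure_noiseEvent_le {M : Model} {QMax δ ℓ : ℝ}
    (hM : M.Valid QMax δ ℓ) (hδ : 0 < δ) {κ γ : ℝ} (hκ : 0 < κ) (hγ : 0 < γ)
    (hγ_large : 5 / 2 ≤ κ * γ ^ 2 / (144 * Real.exp 1 * δ ^ 2)) {T : ℕ} (hT : 2 ≤ T)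
    {μ : ℕ → ℝ} (hμ : ∀ t ∈ Finset.Icc 1 T, μ t ∈ Set.Icc M.muMin M.muMax)
    (hnL : ∀ j, window κ T j ≤ initialLength T) :
    (Measure.pi fun t : Finset.Icc 1 T => M.dist (μ t)) (noiseEvent κ γ T μ) ≤
      ENNReal.ofReal (2 * numCandidates T / T) := by
  have hP : ∀ t : Finset.Icc 1 T, IsProbabilityMeasure (M.dist (μ t)) :=
    fun t => hM.prob _ (hμ t t.2)
  have hT0 : (0 : ℝ) < T := by positivity
  have hl0 := log_natCast_pos hT
  have hbig := large_product hδ hγ_large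
  have hone : ∀ j ∈ Finset.Icc 1 (numCandidates T), ∀ t ∈ Finset.Icc (initialLength T + 1) T,
      (Measure.pi fun t : Finset.Icc 1 T => M.dist (μ t))
        {x | window κ T j * noiseLevel γ T j ≤
          |∑ s ∈ Finset.Ico (t - window κ T j) t, (extend x s - μ s)|} ≤
        ENNReal.ofReal (2 / T ^ 2) := by
    intro j hj t ht
    have ht' := Finset.mem_Icc.1 ht
    have hn := window_pos hκ hT j
    have hn0 : (0 : ℝ) < window κ T j := by exact_mod_cast hn
    have hnj := hnL j
    set n := window κ T j with hn_def
    set S := (Finset.Ico (t - n) t).subtype (· ∈ Finset.Icc 1 T) with hS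
    have hsub : ∀ s ∈ Finset.Ico (t - n) t, s ∈ Finset.Icc 1 T := by
      intro s hs
      simp only [Finset.mem_Ico, Finset.mem_Icc] at hs ⊢
      omega
    have hScard : S.card = n := by
      rw [hS, Finset.card_subtype, Finset.filter_true_of_mem hsub, Nat.card_Ico]
      omega
    have hsum : ∀ x : Finset.Icc 1 T → ℝ, ∑ s ∈ Finset.Ico (t - n) t, (extend x s - μ s) =
        ∑ i ∈ S, (x i - ∫ y, y ∂(M.dist (μ i))) := by
      intro x
      rw [← Finset.sum_subtype_of_mem (fun s => extend x s - μ s) hsub]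
      refine Finset.sum_congr rfl fun i _ => ?_
      rw [extend_coe, hM.mean _ (hμ i i.2)]
    have hε : 0 ≤ n * noiseLevel γ T j := mul_nonneg hn0.le (noiseLevel_nonneg hγ T j)
    have h := pi_abs_sum_sub_mean_ge_le (ν := fun t : Finset.Icc 1 T => M.dist (μ t)) hδ
      (fun i => hM.subGaussian _ (hμ i i.2)) S hε
    simp only [hsum]
    rw [← ofReal_measureReal]
    refine ENNReal.ofReal_le_ofReal (h.trans ?_)
    rw [hScard, div_eq_mul_inv (2 : ℝ)]
    gcongr
    rw [← Real.exp_log (show (0 : ℝ) < ((T : ℝ) ^ 2)⁻¹ by positivity), Real.exp_le_exp, Real.log_inv,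
      Real.log_pow, neg_div, neg_le_neg_iff, le_div_iff₀ (by positivity)]
    have hx : 0 < (T : ℝ) ^ ((1 - candidate T j) / 2) := by positivity
    have hwn : κ * (T : ℝ) ^ ((1 - candidate T j) / 2) ≤ n := Nat.le_ceil _
    have hlev : κ * (γ ^ 2 * Real.log T) ≤ n * noiseLevel γ T j ^ 2 := by
      unfold noiseLevel
      rw [div_pow, mul_pow, Real.sq_sqrt hl0.le, Real.sq_sqrt hx.le, mul_div_assoc',
        le_div_iff₀ hx]
      have : 0 ≤ γ ^ 2 * Real.log T := by positivity
      nlinarith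
    -- the exponent `360 e / (48 e²)` exceeds `2`, so that one event has probability `O(T⁻²)`
    have hexp2 : Real.exp 2 = Real.exp 1 * Real.exp 1 := by rw [← Real.exp_add]; norm_num
    have he3 : Real.exp 1 < 3 := Real.exp_one_lt_three
    have he0 := Real.exp_pos 1
    have hkey : 2 * (2 * (24 * Real.exp 2 * δ ^ 2)) ≤ κ * γ ^ 2 := by
      refine le_trans ?_ hbig
      rw [hexp2]
      have : 0 < Real.exp 1 * δ ^ 2 := by positivity
      nlinarith
    push_cast
    calc 2 * Real.log T * (2 * (n * (24 * Real.exp 2 * δ ^ 2)))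
        = n * (2 * (2 * (24 * Real.exp 2 * δ ^ 2)) * Real.log T) := by ring
      _ ≤ n * (κ * γ ^ 2 * Real.log T) := by gcongr
      _ ≤ n * (n * noiseLevel γ T j ^ 2) := by
          refine mul_le_mul_of_nonneg_left ?_ hn0.le
          linarith
      _ = _ := by ring
  calc _ ≤ ∑ j ∈ Finset.Icc 1 (numCandidates T), ∑ t ∈ Finset.Icc (initialLength T + 1) T,
        ENNReal.ofReal (2 / T ^ 2) := by
        refine (measure_biUnion_finset_le _ _).trans (Finset.sum_le_sum fun j hj => ?_)
        exact (measure_biUnion_finset_le _ _).trans (Finset.sum_le_sum (hone j hj))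
    _ = ENNReal.ofReal (numCandidates T * ((T - initialLength T : ℕ) * (2 / T ^ 2))) := by
        simp only [Finset.sum_const, Nat.card_Icc, nsmul_eq_mul, Nat.add_sub_cancel,
          Nat.add_sub_add_right]
        rw [ENNReal.ofReal_mul (by positivity), ENNReal.ofReal_mul (by positivity),
          ENNReal.ofReal_natCast, ENNReal.ofReal_natCast]
    _ ≤ _ := by
        refine ENNReal.ofReal_le_ofReal ?_
        have : ((T - initialLength T : ℕ) : ℝ) ≤ T := by exact_mod_cast Nat.sub_le _ _
        calc _ ≤ numCandidates T * (T * (2 / (T : ℝ) ^ 2)) := by gcongr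
          _ = _ := by field_simp

/-! ### Regret of the Prediction Policy and the Shrinking-Time-Window Policy -/

/-- The factor in the regret bound of the Shrinking-Time-Window Policy; `c` is a bound for
`costSup`. Its last summand accounts for horizons that are short relative to `κ`. -/
noncomputable def shrinkingFactor (c δ ℓ κ γ : ℝ) : ℝ :=
  44 * c + (108 * (γ + 2 * √κ) + 72 * δ) * (2 * ℓ) + 8 * ((κ + 2) ^ 4 * c)

namespace Model

variable {M : Model}

lemma Valid.isProbabilityMeasure_law {QMax δ ℓ : ℝ} (hM : M.Valid QMax δ ℓ) {T : ℕ} {μ : ℕ → ℝ}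
    (hμ : ∀ t ∈ Finset.Icc 1 T, μ t ∈ Set.Icc M.muMin M.muMax) :
    IsProbabilityMeasure (M.law T μ) := by
  have hP : ∀ t : Finset.Icc 1 T, IsProbabilityMeasure (M.dist (μ t)) :=
    fun t => hM.prob _ (hμ t t.2)
  have hU : IsProbabilityMeasure ((volume : Measure ℝ).restrict (Set.Icc 0 1)) := ⟨by simp⟩
  unfold law
  infer_instance

/-- Ordering optimally for a wrong mean `m` costs at most the Lipschitz error twice. -/
lemma Valid.expCost_best_sub_optCost_le {QMax δ ℓ : ℝ} (hM : M.Valid QMax δ ℓ) {T : ℕ}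
    {b h : ℕ → ℝ} {best : ℕ → ℝ → ℝ} (hbest : M.IsBestResponse T b h best) {t : ℕ}
    (ht : t ∈ Finset.Icc 1 T) (hb : b t ∈ Set.Icc 0 M.bMax) (hh : h t ∈ Set.Icc 0 M.hMax)
    {m μ : ℝ} (hm : m ∈ Set.Icc M.muMin M.muMax) (hμ : μ ∈ Set.Icc M.muMin M.muMax) :
    M.expCost (b t) (h t) μ (best t m) - M.optCost (b t) (h t) μ ≤ 2 * ℓ * |m - μ| := by
  have hle : M.expCost (b t) (h t) μ (best t m) - 2 * ℓ * |m - μ| ≤ M.optCost (b t) (h t) μ := by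
    refine le_csInf (hM.Q_nonempty.image _) ?_
    rintro _ ⟨q, hq, rfl⟩
    have h1 := abs_le.1 (hM.lipschitz _ hb _ hh _ (hbest.mem t ht m hm) m hm μ hμ)
    have h2 := abs_le.1 (hM.lipschitz _ hb _ hh _ hq m hm μ hμ)
    have h3 := hbest.isMin t ht m hm q hq
    linarith [h1.1, h2.2]
  linarith

lemma regret_le_of_forall_le {T : ℕ} {μ pred b h : ℕ → ℝ} [IsProbabilityMeasure (M.law T μ)]
    {π : Policy} {c : ℝ}
    (hc : ∀ d u : ℕ → ℝ, ∑ t ∈ Finset.Icc 1 T, (M.expCost (b t) (h t) (μ t) (π pred d u t)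
      - M.optCost (b t) (h t) (μ t)) ≤ c) :
    M.regret T b h π μ pred ≤ ENNReal.ofReal c := by
  calc M.regret T b h π μ pred ≤ ∫⁻ _, ENNReal.ofReal c ∂(M.law T μ) :=
        lintegral_mono fun ω => ENNReal.ofReal_le_ofReal (hc _ _)
    _ = _ := by simp

/-- The trivial bound for policies that order in `Q`. -/
lemma Valid.regret_le {QMax δ ℓ : ℝ} (hM : M.Valid QMax δ ℓ) (hδ : 0 < δ) {T : ℕ}
    {μ pred b h : ℕ → ℝ}
    (hbh : ∀ t ∈ Finset.Icc 1 T, b t ∈ Set.Icc 0 M.bMax ∧ h t ∈ Set.Icc 0 M.hMax)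
    (hμ : ∀ t ∈ Finset.Icc 1 T, μ t ∈ Set.Icc M.muMin M.muMax) {π : Policy}
    (hπ : ∀ d u : ℕ → ℝ, ∀ t ∈ Finset.Icc 1 T, π pred d u t ∈ M.Q) :
    M.regret T b h π μ pred ≤ ENNReal.ofReal (T * M.costSup) := by
  have := hM.isProbabilityMeasure_law hμ
  refine regret_le_of_forall_le fun d u => ?_
  calc _ ≤ ∑ t ∈ Finset.Icc 1 T, M.costSup := by
        refine Finset.sum_le_sum fun t ht => ?_
        have h1 := expCost_le_costSup hM hδ (hbh t ht).1 (hbh t ht).2 (hμ t ht) (hπ d u t ht)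
        have h2 := optCost_nonneg (M := M) (hbh t ht).1.1 (hbh t ht).2.1 (μ t)
        linarith
    _ = _ := by simp

lemma Valid.regret_predictionPolicy_le {QMax δ ℓ : ℝ} (hM : M.Valid QMax δ ℓ) (hℓ : 0 ≤ ℓ)
    {T : ℕ} {μ pred b h : ℕ → ℝ}
    (hbh : ∀ t ∈ Finset.Icc 1 T, b t ∈ Set.Icc 0 M.bMax ∧ h t ∈ Set.Icc 0 M.hMax)
    (hμ : ∀ t ∈ Finset.Icc 1 T, μ t ∈ Set.Icc M.muMin M.muMax)
    {best : ℕ → ℝ → ℝ} (hbest : M.IsBestResponse T b h best) :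
    M.regret T b h (M.predictionPolicy best) μ pred ≤
      ENNReal.ofReal (2 * ℓ * predictionError T pred μ) := by
  have := hM.isProbabilityMeasure_law hμ
  refine regret_le_of_forall_le fun d u => ?_
  unfold predictionError
  rw [Finset.mul_sum]
  refine Finset.sum_le_sum fun t ht => ?_
  refine (hM.expCost_best_sub_optCost_le hbest ht (hbh t ht).1 (hbh t ht).2
    (clip_mem hM.mu_le _) (hμ t ht)).trans ?_
  have := abs_clip_sub_le (hμ t ht) (pred t)
  gcongr

lemma shrinkingPolicy_mem (hM : M.muMin ≤ M.muMax) {κ γ : ℝ} {T : ℕ} {b h : ℕ → ℝ}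
    {best : ℕ → ℝ → ℝ} (hbest : M.IsBestResponse T b h best) {init : ℕ → (ℕ → ℝ) → ℝ}
    (hinit : M.IsInitialRule T init) (pred d u : ℕ → ℝ) {t : ℕ} (ht : t ∈ Finset.Icc 1 T) :
    M.shrinkingPolicy κ γ T best init pred d u t ∈ M.Q := by
  unfold shrinkingPolicy
  split_ifs
  · exact hinit.mem t ht d
  · exact hbest.mem t ht _ (windowEstimate_mem hM _ _ _ _ _)

lemma predictionPolicy_mem (hM : M.muMin ≤ M.muMax) {T : ℕ} {b h : ℕ → ℝ}
    {best : ℕ → ℝ → ℝ} (hbest : M.IsBestResponse T b h best) (pred d u : ℕ → ℝ) {t : ℕ}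
    (ht : t ∈ Finset.Icc 1 T) : M.predictionPolicy best pred d u t ∈ M.Q :=
  hbest.mem t ht _ (clip_mem hM _)

/-- Outside the noise event, the regret of the Shrinking-Time-Window Policy on a demand sequence
is that of the initial phase plus the total error of the estimates in use. -/
lemma Valid.sum_regret_shrinking_le {QMax δ ℓ : ℝ} (hM : M.Valid QMax δ ℓ) (hδ : 0 < δ)
    (hℓ : 0 ≤ ℓ) {κ γ : ℝ} (hκ : 0 < κ) (hγ : 0 < γ)
    (hγ_large : 5 / 2 ≤ κ * γ ^ 2 / (144 * Real.exp 1 * δ ^ 2)) {T : ℕ} (hT : 2 ≤ T)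
    (hTκ : (κ + 2) ^ 4 ≤ T) {b h : ℕ → ℝ}
    (hbh : ∀ t ∈ Finset.Icc 1 T, b t ∈ Set.Icc 0 M.bMax ∧ h t ∈ Set.Icc 0 M.hMax)
    {best : ℕ → ℝ → ℝ} (hbest : M.IsBestResponse T b h best) {init : ℕ → (ℕ → ℝ) → ℝ}
    (hinit : M.IsInitialRule T init) {v : ℝ} (hv : v ∈ Set.Icc (0 : ℝ) 1) {μ : ℕ → ℝ}
    (hμ : μ ∈ M.instances T v) (pred u : ℕ → ℝ) {x : Finset.Icc 1 T → ℝ}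
    (hx : x ∉ noiseEvent κ γ T μ) :
    ∑ t ∈ Finset.Icc 1 T, (M.expCost (b t) (h t) (μ t)
        (M.shrinkingPolicy κ γ T best init pred (extend x) u t) - M.optCost (b t) (h t) (μ t)) ≤
      (T : ℝ) ^ (3 / 4 : ℝ) * M.costSup +
        (108 * (γ + 2 * √κ) + 72 * δ) * (2 * ℓ) *
          ((T : ℝ) ^ ((3 + v) / 4) * (Real.log T ^ 2 * √(Real.log T))) := by
  have hT0 : (0 : ℝ) < T := by positivity
  have hT1 : (1 : ℝ) ≤ T := by exact_mod_cast (by omega : 1 ≤ T)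
  have hl := half_le_log hT
  have hl0 := log_natCast_pos hT
  have hLT := initialLength_le hT
  obtain ⟨j₀, hj1, hjk, hj2, hj3⟩ := exists_candidate_near hT hv
  obtain ⟨hk1, -, hk3⟩ := numCandidates_spec hT
  have hsum := sum_abs_shrinking_sub_le (M := M) (κ := κ) (d := extend x) (μ := μ) hM.mu_le hγ hT
    hj1 hjk hLT fun j hj => by
      have hj' := Finset.mem_Icc.1 hj
      have hjv : v ≤ candidate T j := by
        rcases eq_or_lt_of_le hj'.1 with heq | hlt
        · rwa [← heq]
        · exact hj2.trans (candidate_lt hT hj1 hlt).le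
      refine hM.sum_abs_windowEstimate_sub_le hδ hκ hγ hγ_large hT hμ hjv
        (window_le_initialLength hκ hT hTκ j) fun t ht => ?_
      by_contra hcon
      refine hx (Set.mem_biUnion (Finset.mem_Icc.2 ⟨by omega, hj'.2⟩) (Set.mem_biUnion ht ?_))
      exact (not_le.1 hcon).le
  set L := initialLength T with hL
  have hθ : errorBound κ γ T j₀ ≤
      2 * (γ + 2 * √κ) * (√(Real.log T) * (T : ℝ) ^ ((3 + v) / 4)) := by
    have hpow : (T : ℝ) ^ ((3 + candidate T j₀) / 4) ≤ 2 * (T : ℝ) ^ ((3 + v) / 4) := by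
      calc (T : ℝ) ^ ((3 + candidate T j₀) / 4)
          ≤ (T : ℝ) ^ ((3 + v) / 4 + 1 / Real.log T * (1 / 4)) :=
            Real.rpow_le_rpow_of_exponent_le hT1 (by linarith)
        _ = (T : ℝ) ^ ((3 + v) / 4) * Real.exp (1 / 4) := by
            rw [Real.rpow_add hT0]
            congr 1
            rw [Real.rpow_def_of_pos hT0]
            congr 1
            field_simp
        _ ≤ (T : ℝ) ^ ((3 + v) / 4) * 2 := by
            gcongr
            have h1 : Real.exp (1 / 4) ^ 4 = Real.exp 1 := by
              rw [← Real.exp_nat_mul]; norm_num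
            have h2 := Real.exp_one_lt_three
            refine le_of_pow_le_pow_left₀ (n := 4) (by norm_num) (by norm_num) ?_
            rw [h1]; linarith
        _ = _ := mul_comm _ _
    have hsq : 1 ≤ 2 * √(Real.log T) := by
      have : 1 / 2 ≤ √(Real.log T) := Real.le_sqrt_of_sq_le (by linarith)
      linarith
    unfold errorBound
    calc (γ * √(Real.log T) + √κ) * (T : ℝ) ^ ((3 + candidate T j₀) / 4)
        ≤ (γ * √(Real.log T) + √κ * (2 * √(Real.log T))) * (2 * (T : ℝ) ^ ((3 + v) / 4)) := by
          gcongr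
          nlinarith [Real.sqrt_nonneg κ]
      _ = _ := by ring
  have hk0 : (1 : ℝ) ≤ numCandidates T := by exact_mod_cast hk1
  have hθ0 := errorBound_nonneg (κ := κ) hγ T j₀
  have hR := hM.range_le hδ
  have hTv : 1 ≤ (T : ℝ) ^ ((3 + v) / 4) := Real.one_le_rpow hT1 (by linarith [hv.1])
  have hsq1 : 1 ≤ 2 * √(Real.log T) := by
    have : 1 / 2 ≤ √(Real.log T) := Real.le_sqrt_of_sq_le (by linarith)
    linarith
  have htotal : ∑ t ∈ Finset.Icc (L + 1) T,
      |M.windowEstimate κ T (extend x) (M.shrinkingState κ γ T (extend x) t).1 t - μ t| ≤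
      (108 * (γ + 2 * √κ) + 72 * δ) *
          ((T : ℝ) ^ ((3 + v) / 4) * (Real.log T ^ 2 * √(Real.log T))) := by
    calc _ ≤ _ := hsum
      _ ≤ numCandidates T * (3 * errorBound κ γ T j₀ + 4 * δ) := by nlinarith
      _ ≤ 9 * Real.log T ^ 2 *
          (3 * (2 * (γ + 2 * √κ) * (√(Real.log T) * (T : ℝ) ^ ((3 + v) / 4))) +
            4 * δ * ((T : ℝ) ^ ((3 + v) / 4) * (2 * √(Real.log T)))) := by
          have hδ4 := le_mul_of_one_le_right (show 0 ≤ 4 * δ by positivity)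
            (one_le_mul_of_one_le_of_one_le hTv hsq1)
          exact mul_le_mul hk3 (add_le_add (by gcongr) hδ4) (by positivity) (by positivity)
      _ ≤ _ := by
          have : 0 ≤ (γ + 2 * √κ) * ((T : ℝ) ^ ((3 + v) / 4) * (Real.log T ^ 2 * √(Real.log T))) := by
            positivity
          linarith
  have hsplit : Finset.Icc 1 T = Finset.Icc 1 L ∪ Finset.Icc (L + 1) T := by
    ext t; simp; omega
  have hdisj : Disjoint (Finset.Icc 1 L) (Finset.Icc (L + 1) T) := by
    rw [Finset.disjoint_left]; intro t ht ht'; simp at ht ht'; omega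
  rw [hsplit, Finset.sum_union hdisj]
  refine add_le_add ?_ ?_
  · calc _ ≤ ∑ t ∈ Finset.Icc 1 L, M.costSup := by
          refine Finset.sum_le_sum fun t ht => ?_
          have htT : t ∈ Finset.Icc 1 T := hsplit ▸ Finset.mem_union_left _ ht
          have h1 := expCost_le_costSup hM hδ (hbh t htT).1 (hbh t htT).2 (hμ.1 t htT)
            (shrinkingPolicy_mem (κ := κ) (γ := γ) hM.mu_le hbest hinit pred (extend x) u htT)
          have h2 := optCost_nonneg (M := M) (hbh t htT).1.1 (hbh t htT).2.1 (μ t)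
          linarith
      _ = L * M.costSup := by simp
      _ ≤ _ := by
          have hT1' : 1 ∈ Finset.Icc 1 T := Finset.mem_Icc.2 ⟨le_rfl, by omega⟩
          have hC : 0 ≤ M.costSup := (expCost_nonneg (hbh 1 hT1').1.1 (hbh 1 hT1').2.1 _ _).trans
            (expCost_le_costSup hM hδ (hbh 1 hT1').1 (hbh 1 hT1').2 (hμ.1 1 hT1')
              hM.Q_nonempty.some_mem)
          gcongr
          exact Nat.floor_le (by positivity)
  · calc _ ≤ ∑ t ∈ Finset.Icc (L + 1) T, 2 * ℓ *
        |M.windowEstimate κ T (extend x) (M.shrinkingState κ γ T (extend x) t).1 t - μ t| := by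
          refine Finset.sum_le_sum fun t ht => ?_
          have htT : t ∈ Finset.Icc 1 T := hsplit ▸ Finset.mem_union_right _ ht
          have hLt := (Finset.mem_Icc.1 ht).1
          have hpol : M.shrinkingPolicy κ γ T best init pred (extend x) u t =
              best t (M.windowEstimate κ T (extend x)
                (M.shrinkingState κ γ T (extend x) t).1 t) := by
            unfold shrinkingPolicy
            rw [if_neg (by omega)]
          rw [hpol]
          exact hM.expCost_best_sub_optCost_le hbest htT (hbh t htT).1 (hbh t htT).2
            (windowEstimate_mem hM.mu_le _ _ _ _ _) (hμ.1 t htT)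
      _ ≤ 2 * ℓ * ((108 * (γ + 2 * √κ) + 72 * δ) *
          ((T : ℝ) ^ ((3 + v) / 4) * (Real.log T ^ 2 * √(Real.log T)))) := by
          rw [← Finset.mul_sum]
          exact mul_le_mul_of_nonneg_left htotal (by positivity)
      _ = _ := by ring

lemma Valid.regret_shrinkingPolicy_le {QMax δ ℓ : ℝ} (hM : M.Valid QMax δ ℓ) (hδ : 0 < δ)
    (hℓ : 0 ≤ ℓ) {κ γ : ℝ} (hκ : 0 < κ) (hγ : 0 < γ)
    (hγ_large : 5 / 2 ≤ κ * γ ^ 2 / (144 * Real.exp 1 * δ ^ 2)) {T : ℕ} (hT : 2 ≤ T)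
    {b h : ℕ → ℝ}
    (hbh : ∀ t ∈ Finset.Icc 1 T, b t ∈ Set.Icc 0 M.bMax ∧ h t ∈ Set.Icc 0 M.hMax)
    {best : ℕ → ℝ → ℝ} (hbest : M.IsBestResponse T b h best) {init : ℕ → (ℕ → ℝ) → ℝ}
    (hinit : M.IsInitialRule T init) {v : ℝ} (hv : v ∈ Set.Icc (0 : ℝ) 1) {μ : ℕ → ℝ}
    (hμ : μ ∈ M.instances T v) (pred : ℕ → ℝ) :
    M.regret T b h (M.shrinkingPolicy κ γ T best init) μ pred ≤
      ENNReal.ofReal (shrinkingFactor (3 * costScale M.bMax M.hMax QMax δ) δ ℓ κ γ *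
        ((T : ℝ) ^ ((3 + v) / 4) * (Real.log T ^ 2 * √(Real.log T)))) := by
  have hT0 : (0 : ℝ) < T := by positivity
  have hT1 : (1 : ℝ) ≤ T := by exact_mod_cast (by omega : 1 ≤ T)
  have hl := half_le_log hT
  have hl0 := log_natCast_pos hT
  have hTm : 1 ∈ Finset.Icc 1 T := Finset.mem_Icc.2 ⟨le_rfl, by omega⟩
  have hc := costSup_le hM hδ (hbh 1 hTm).1 (hbh 1 hTm).2 (hμ.1 1 hTm) hM.Q_nonempty.some_mem
  have hc0 : 0 ≤ M.costSup := (expCost_nonneg (hbh 1 hTm).1.1 (hbh 1 hTm).2.1 _ _).trans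
    (expCost_le_costSup hM hδ (hbh 1 hTm).1 (hbh 1 hTm).2 (hμ.1 1 hTm) hM.Q_nonempty.some_mem)
  set c := 3 * costScale M.bMax M.hMax QMax δ
  have hc0' : 0 ≤ c := hc0.trans hc
  have hTv : 1 ≤ (T : ℝ) ^ ((3 + v) / 4) := Real.one_le_rpow hT1 (by linarith [hv.1])
  have hsq1 : 1 ≤ 2 * √(Real.log T) := by
    have : 1 / 2 ≤ √(Real.log T) := Real.le_sqrt_of_sq_le (by linarith)
    linarith
  have hlog : Real.log T ^ 2 ≤ 2 * (Real.log T ^ 2 * √(Real.log T)) := by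
    nlinarith [sq_nonneg (Real.log T)]
  have hlog8 : 1 ≤ 8 * (Real.log T ^ 2 * √(Real.log T)) := by nlinarith
  set Λ := Real.log T ^ 2 * √(Real.log T) with hΛ
  set P := (T : ℝ) ^ ((3 + v) / 4) with hP
  have hΛ0 : 0 ≤ Λ := by positivity
  have hPΛ : 1 ≤ 8 * (P * Λ) := by nlinarith
  have hfac : 0 ≤ (108 * (γ + 2 * √κ) + 72 * δ) * (2 * ℓ) := by positivity
  have hPL0 : 0 ≤ P * Λ := by positivity
  rcases lt_or_ge (T : ℝ) ((κ + 2) ^ 4) with hsmall | hTκ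
  · refine (hM.regret_le hδ hbh hμ.1 fun d u t ht =>
      shrinkingPolicy_mem hM.mu_le hbest hinit pred d u ht).trans (ENNReal.ofReal_le_ofReal ?_)
    calc T * M.costSup ≤ (κ + 2) ^ 4 * c := by gcongr
      _ ≤ (κ + 2) ^ 4 * c * (8 * (P * Λ)) := le_mul_of_one_le_right (by positivity) hPΛ
      _ = 8 * ((κ + 2) ^ 4 * c) * (P * Λ) := by ring
      _ ≤ _ := by
          unfold shrinkingFactor
          gcongr
          linarith
  have hPr := hM.isProbabilityMeasure_law hμ.1
  have hPd : ∀ t : Finset.Icc 1 T, IsProbabilityMeasure (M.dist (μ t)) :=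
    fun t => hM.prob _ (hμ.1 t t.2)
  have hU : IsProbabilityMeasure ((volume : Measure ℝ).restrict (Set.Icc 0 1)) := ⟨by simp⟩
  obtain ⟨-, -, hk3⟩ := numCandidates_spec hT
  set A := (T : ℝ) ^ (3 / 4 : ℝ) * M.costSup +
        (108 * (γ + 2 * √κ) + 72 * δ) * (2 * ℓ) * (P * Λ) with hA
  have hA0 : 0 ≤ A := by positivity
  have hbound : M.regret T b h (M.shrinkingPolicy κ γ T best init) μ pred ≤
      ∫⁻ ω, (ENNReal.ofReal A + (noiseEvent κ γ T μ ×ˢ Set.univ).indicator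
        (fun _ => ENNReal.ofReal (T * M.costSup)) ω) ∂(M.law T μ) := by
    refine lintegral_mono fun ω => ?_
    by_cases hω : ω.1 ∈ noiseEvent κ γ T μ
    · rw [Set.indicator_of_mem (Set.mk_mem_prod hω (Set.mem_univ _))]
      refine le_trans (ENNReal.ofReal_le_ofReal ?_) le_add_self
      calc _ ≤ ∑ t ∈ Finset.Icc 1 T, M.costSup := by
            refine Finset.sum_le_sum fun t ht => ?_
            have h1 := expCost_le_costSup hM hδ (hbh t ht).1 (hbh t ht).2 (hμ.1 t ht)
              (shrinkingPolicy_mem (κ := κ) (γ := γ) hM.mu_le hbest hinit pred (extend ω.1)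
                (extend ω.2) ht)
            have h2 := optCost_nonneg (M := M) (hbh t ht).1.1 (hbh t ht).2.1 (μ t)
            linarith
        _ = _ := by simp
    · exact le_trans (ENNReal.ofReal_le_ofReal (hM.sum_regret_shrinking_le hδ hℓ hκ hγ hγ_large hT
        hTκ hbh hbest hinit hv hμ pred _ hω)) le_self_add
  refine hbound.trans ?_
  rw [lintegral_add_left measurable_const]
  have hmeas : M.law T μ (noiseEvent κ γ T μ ×ˢ Set.univ) ≤
      ENNReal.ofReal (2 * numCandidates T / T) := by
    unfold law
    rw [Measure.prod_prod, measure_univ, mul_one]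
    exact hM.measure_noiseEvent_le hδ hκ hγ hγ_large hT hμ.1
      (window_le_initialLength hκ hT hTκ)
  calc _ ≤ ENNReal.ofReal A + ENNReal.ofReal (T * M.costSup) *
        ENNReal.ofReal (2 * numCandidates T / T) := by
        gcongr
        · simp
        · exact (lintegral_indicator_const_le _ _).trans (by gcongr)
    _ = ENNReal.ofReal (A + T * M.costSup * (2 * numCandidates T / T)) := by
        rw [← ENNReal.ofReal_mul (by positivity), ← ENNReal.ofReal_add hA0 (by positivity)]
    _ ≤ _ := by
        refine ENNReal.ofReal_le_ofReal ?_
        have hT34 : (T : ℝ) ^ (3 / 4 : ℝ) ≤ P :=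
          Real.rpow_le_rpow_of_exponent_le hT1 (by linarith [hv.1])
        have h1 : (T : ℝ) ^ (3 / 4 : ℝ) * M.costSup ≤ 8 * c * (P * Λ) := by
          calc _ ≤ P * c := by gcongr
            _ ≤ P * c * (8 * Λ) := le_mul_of_one_le_right (by positivity) hlog8
            _ = _ := by ring
        have h2 : T * M.costSup * (2 * numCandidates T / T) ≤ 36 * c * (P * Λ) := by
          calc _ = 2 * M.costSup * numCandidates T := by field_simp
            _ ≤ 2 * c * (9 * (2 * Λ)) := by
                gcongr
                exact hk3.trans (by gcongr)
            _ = 36 * c * (1 * Λ) := by ring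
            _ ≤ _ := by gcongr
        have h3 : 0 ≤ 8 * ((κ + 2) ^ 4 * c) * (P * Λ) := by positivity
        unfold shrinkingFactor
        rw [hA]
        linarith

end Model

/-! ### Exponential weights on a fixed sequence of losses -/

lemma exp_neg_le_quadratic {z : ℝ} (hz : 0 ≤ z) : Real.exp (-z) ≤ 1 - z + z ^ 2 / 2 := by
  have h := Real.quadratic_le_exp_of_nonneg hz
  rw [Real.exp_neg, inv_le_iff_one_le_mul₀ (Real.exp_pos z)]
  have h2 : 0 ≤ 1 - z + z ^ 2 / 2 := by nlinarith [sq_nonneg (z - 1)]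
  nlinarith [mul_le_mul_of_nonneg_left h h2, sq_nonneg (z ^ 2)]

/-- Exponential weights with unbounded nonnegative losses `x`, `y`: the weighted average losses
exceed the losses of either alternative by at most the initial entropy and a second-order term.
The proof bounds the sum of the weights, from above with `exp (-z) ≤ 1 - z + z² / 2` and from
below by one of the weights. -/
lemma exponential_weights {η : ℝ} (hη : 0 < η) {T : ℕ} {w₁ w₂ x y : ℕ → ℝ} (h₁ : w₁ 0 = 1)
    (h₂ : w₂ 0 = 1) (hw₁ : ∀ t, w₁ (t + 1) = w₁ t * Real.exp (-η * x (t + 1) / 2))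
    (hw₂ : ∀ t, w₂ (t + 1) = w₂ t * Real.exp (-η * y (t + 1) / 2))
    (hx : ∀ t ∈ Finset.Icc 1 T, 0 ≤ x t) (hy : ∀ t ∈ Finset.Icc 1 T, 0 ≤ y t) :
    ∑ t ∈ Finset.Icc 1 T, (w₁ (t - 1) / (w₁ (t - 1) + w₂ (t - 1)) * x t +
        w₂ (t - 1) / (w₁ (t - 1) + w₂ (t - 1)) * y t) ≤
      min (∑ t ∈ Finset.Icc 1 T, x t) (∑ t ∈ Finset.Icc 1 T, y t) + 2 * Real.log 2 / η +
      η / 4 * ∑ t ∈ Finset.Icc 1 T, (w₁ (t - 1) / (w₁ (t - 1) + w₂ (t - 1)) * x t ^ 2 +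
        w₂ (t - 1) / (w₁ (t - 1) + w₂ (t - 1)) * y t ^ 2) := by
  have hclosed : ∀ (w x : ℕ → ℝ), w 0 = 1 →
      (∀ t, w (t + 1) = w t * Real.exp (-η * x (t + 1) / 2)) →
      ∀ n, w n = Real.exp (-(η / 2) * ∑ t ∈ Finset.Icc 1 n, x t) := by
    intro w x h0 hw n
    induction n with
    | zero => simp [h0]
    | succ n ih =>
      rw [hw, ih, ← Real.exp_add, Finset.sum_Icc_succ_top (by omega)]
      congr 1
      ring
  have hc₁ := hclosed w₁ x h₁ hw₁
  have hc₂ := hclosed w₂ y h₂ hw₂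
  have hpos₁ : ∀ n, 0 < w₁ n := fun n => hc₁ n ▸ Real.exp_pos _
  have hpos₂ : ∀ n, 0 < w₂ n := fun n => hc₂ n ▸ Real.exp_pos _
  set m : ℕ → ℝ := fun t => w₁ (t - 1) / (w₁ (t - 1) + w₂ (t - 1)) * x t +
        w₂ (t - 1) / (w₁ (t - 1) + w₂ (t - 1)) * y t with hm
  set s : ℕ → ℝ := fun t => w₁ (t - 1) / (w₁ (t - 1) + w₂ (t - 1)) * x t ^ 2 +
        w₂ (t - 1) / (w₁ (t - 1) + w₂ (t - 1)) * y t ^ 2 with hs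
  have hpot : ∀ n, n ≤ T → w₁ n + w₂ n ≤
      2 * Real.exp (-(η / 2) * ∑ t ∈ Finset.Icc 1 n, m t +
        η ^ 2 / 8 * ∑ t ∈ Finset.Icc 1 n, s t) := by
    intro n
    induction n with
    | zero => intro _; simp [h₁, h₂]; norm_num
    | succ n ih =>
      intro hn
      have hmem : n + 1 ∈ Finset.Icc 1 T := Finset.mem_Icc.2 ⟨by omega, hn⟩
      have hx' := hx _ hmem
      have hy' := hy _ hmem
      have hW : 0 < w₁ n + w₂ n := add_pos (hpos₁ n) (hpos₂ n)
      have hstep : w₁ (n + 1) + w₂ (n + 1) ≤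
          (w₁ n + w₂ n) * Real.exp (-(η / 2) * m (n + 1) + η ^ 2 / 8 * s (n + 1)) := by
        calc w₁ (n + 1) + w₂ (n + 1)
            = w₁ n * Real.exp (-(η * x (n + 1) / 2)) +
                w₂ n * Real.exp (-(η * y (n + 1) / 2)) := by
              rw [hw₁, hw₂]; congr 3 <;> ring
          _ ≤ w₁ n * (1 - η * x (n + 1) / 2 + (η * x (n + 1) / 2) ^ 2 / 2) +
                w₂ n * (1 - η * y (n + 1) / 2 + (η * y (n + 1) / 2) ^ 2 / 2) := by
              have := (hpos₁ n).le
              have := (hpos₂ n).le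
              gcongr
              · exact exp_neg_le_quadratic (by positivity)
              · exact exp_neg_le_quadratic (by positivity)
          _ = (w₁ n + w₂ n) * (-(η / 2) * m (n + 1) + η ^ 2 / 8 * s (n + 1) + 1) := by
              simp only [hm, hs, Nat.add_sub_cancel]
              field_simp
              ring
          _ ≤ _ := by
              gcongr
              exact Real.add_one_le_exp _
      refine hstep.trans ?_
      rw [Finset.sum_Icc_succ_top (by omega), Finset.sum_Icc_succ_top (by omega)]
      calc _ ≤ 2 * Real.exp (-(η / 2) * ∑ t ∈ Finset.Icc 1 n, m t +
            η ^ 2 / 8 * ∑ t ∈ Finset.Icc 1 n, s t) *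
            Real.exp (-(η / 2) * m (n + 1) + η ^ 2 / 8 * s (n + 1)) := by
            gcongr
            exact ih (by omega)
        _ = _ := by
            rw [mul_assoc, ← Real.exp_add]
            congr 2
            ring
  have hfin : ∀ z : ℝ, Real.exp (-(η / 2) * z) ≤ w₁ T + w₂ T →
      ∑ t ∈ Finset.Icc 1 T, m t ≤ z + 2 * Real.log 2 / η +
        η / 4 * ∑ t ∈ Finset.Icc 1 T, s t := by
    intro z hz
    have h := hz.trans (hpot T le_rfl)
    rw [← Real.exp_log (show (0 : ℝ) < 2 by norm_num), ← Real.exp_add, Real.exp_le_exp,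
      Real.exp_log (by norm_num)] at h
    have h' : η / 2 * ∑ t ∈ Finset.Icc 1 T, m t ≤ η / 2 * (z + 2 * Real.log 2 / η +
        η / 4 * ∑ t ∈ Finset.Icc 1 T, s t) := by
      have : η / 2 * (z + 2 * Real.log 2 / η + η / 4 * ∑ t ∈ Finset.Icc 1 T, s t) =
          η / 2 * z + Real.log 2 + η ^ 2 / 8 * ∑ t ∈ Finset.Icc 1 T, s t := by
        field_simp
        ring
      rw [this]
      linarith
    exact le_of_mul_le_mul_left h' (by positivity)
  rcases le_total (∑ t ∈ Finset.Icc 1 T, x t) (∑ t ∈ Finset.Icc 1 T, y t) with hle | hle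
  · rw [min_eq_left hle]
    exact hfin _ (by rw [← hc₁]; linarith [hpos₂ T])
  · rw [min_eq_right hle]
    exact hfin _ (by rw [← hc₂]; linarith [hpos₁ T])

/-! ### Conditioning on the past by resampling one period -/

/-- Redrawing one coordinate of a product measure does not change integrals. -/
lemma lintegral_pi_resample {ι : Type*} [Fintype ι] [DecidableEq ι] {ν : ι → Measure ℝ}
    [∀ i, IsProbabilityMeasure (ν i)] (i : ι) {f : (ι → ℝ) → ℝ≥0∞} (hf : Measurable f) :
    ∫⁻ x, f x ∂(Measure.pi ν) = ∫⁻ x, ∫⁻ y, f (Function.update x i y) ∂(ν i) ∂(Measure.pi ν) := by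
  have hg : Measurable fun x => ∫⁻ y, f (Function.update x i y) ∂(ν i) := by
    refine Measurable.lintegral_prod_right' (f := fun p : (ι → ℝ) × ℝ => f (Function.update p.1 i p.2))
      (hf.comp ?_)
    exact measurable_update'
  have hi := Finset.mem_univ i
  rw [lintegral_eq_lmarginal_univ 0, lintegral_eq_lmarginal_univ 0,
    lmarginal_erase' f hf hi, lmarginal_erase' _ hg hi]
  simp

lemma measurable_extend {T : ℕ} : Measurable (extend (T := T)) := by
  refine measurable_pi_lambda _ fun t => ?_
  unfold extend
  split_ifs with ht
  · exact measurable_pi_apply _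
  · exact measurable_const

lemma extend_update_of_ne {T : ℕ} (x : Finset.Icc 1 T → ℝ) (i : Finset.Icc 1 T) (y : ℝ) {s : ℕ}
    (hs : s ≠ i) : extend (Function.update x i y) s = extend x s := by
  unfold extend
  split_ifs with h
  · rw [Function.update_of_ne]
    exact fun hcon => hs (congrArg Subtype.val hcon)
  · rfl

lemma lintegral_law_resample {M : Model} {T : ℕ} {μ : ℕ → ℝ}
    (hP : ∀ t : Finset.Icc 1 T, IsProbabilityMeasure (M.dist (μ t))) (i : Finset.Icc 1 T)
    {F : (Finset.Icc 1 T → ℝ) × (Finset.Icc 1 T → ℝ) → ℝ≥0∞} (hF : Measurable F) :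
    ∫⁻ ω, F ω ∂(M.law T μ) = ∫⁻ ω, ∫⁻ y, (∫⁻ z in Set.Icc (0 : ℝ) 1,
      F (Function.update ω.1 i y, Function.update ω.2 i z)) ∂(M.dist (μ i)) ∂(M.law T μ) := by
  have hU : IsProbabilityMeasure ((volume : Measure ℝ).restrict (Set.Icc 0 1)) := ⟨by simp⟩
  unfold Model.law
  have hmeas : Measurable fun p : (((Finset.Icc 1 T → ℝ) × (Finset.Icc 1 T → ℝ)) × ℝ) × ℝ =>
      F (Function.update p.1.1.1 i p.1.2, Function.update p.1.1.2 i p.2) := by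
    refine hF.comp (Measurable.prodMk ?_ ?_)
    · exact measurable_update'.comp (f := fun p : (((Finset.Icc 1 T → ℝ) ×
        (Finset.Icc 1 T → ℝ)) × ℝ) × ℝ => (p.1.1.1, p.1.2)) (by fun_prop)
    · exact measurable_update'.comp (f := fun p : (((Finset.Icc 1 T → ℝ) ×
        (Finset.Icc 1 T → ℝ)) × ℝ) × ℝ => (p.1.1.2, p.2)) (by fun_prop)
  have hmeas1 : Measurable fun p : ((Finset.Icc 1 T → ℝ) × (Finset.Icc 1 T → ℝ)) × ℝ =>
      ∫⁻ z in Set.Icc (0 : ℝ) 1,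
        F (Function.update p.1.1 i p.2, Function.update p.1.2 i z) := hmeas.lintegral_prod_right'
  have hmeas2 : Measurable fun p : (Finset.Icc 1 T → ℝ) × (Finset.Icc 1 T → ℝ) =>
      ∫⁻ y, (∫⁻ z in Set.Icc (0 : ℝ) 1,
        F (Function.update p.1 i y, Function.update p.2 i z)) ∂(M.dist (μ i)) :=
    hmeas1.lintegral_prod_right'
  rw [lintegral_prod _ hF.aemeasurable, lintegral_prod _ hmeas2.aemeasurable,
    lintegral_pi_resample i hF.lintegral_prod_right']
  refine lintegral_congr fun x => ?_
  refine Eq.trans ?_ (lintegral_lintegral_swap ?_).symm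
  · refine lintegral_congr fun y => ?_
    exact lintegral_pi_resample (ν := fun _ : Finset.Icc 1 T =>
      (volume : Measure ℝ).restrict (Set.Icc 0 1)) i
      (f := fun u => F (Function.update x i y, u)) (by fun_prop)
  · refine Measurable.aemeasurable ?_
    exact hmeas1.comp (f := fun p : (Finset.Icc 1 T → ℝ) × ℝ => ((x, p.1), p.2)) (by fun_prop)

/-! ### Expected losses of the importance-weighted estimates -/

namespace Model

variable {M : Model}

/-- A rule `A d t` for the order quantities that orders in `Q` and uses in period `t` only the
demands before period `t`. -/
structure IsPredictable (M : Model) (T : ℕ) (A : (ℕ → ℝ) → ℕ → ℝ) : Prop where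
  measurable : ∀ t ∈ Finset.Icc 1 T, Measurable fun d => A d t
  mem : ∀ t ∈ Finset.Icc 1 T, ∀ d, A d t ∈ M.Q
  adapted : ∀ t ∈ Finset.Icc 1 T, ∀ d d' : ℕ → ℝ,
    (∀ s ∈ Finset.Ico 1 t, d s = d' s) → A d t = A d' t

/-- A function of the demands and the seeds that does not depend on those of period `i`. -/
def IgnoresPeriod {T : ℕ} (i : Finset.Icc 1 T)
    (f : (Finset.Icc 1 T → ℝ) × (Finset.Icc 1 T → ℝ) → ℝ) : Prop :=
  ∀ ω y z, f (Function.update ω.1 i y, Function.update ω.2 i z) = f ω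

/-- Integrating out the demand and the seed of period `i`. Here `χ` is the indicator of the choice
of an arm and `P` the probability of that choice. -/
lemma Valid.lintegral_choice_mul_cost_pow {QMax δ ℓ : ℝ} (hM : M.Valid QMax δ ℓ) (hδ : 0 < δ)
    {T : ℕ} {μ : ℕ → ℝ} (hμ : ∀ t ∈ Finset.Icc 1 T, μ t ∈ Set.Icc M.muMin M.muMax)
    (i : Finset.Icc 1 T) {b h : ℝ} (hb : b ∈ Set.Icc 0 M.bMax) (hh : h ∈ Set.Icc 0 M.hMax)
    {m : ℕ} (hm : m ≤ 3) {G p P q : (Finset.Icc 1 T → ℝ) × (Finset.Icc 1 T → ℝ) → ℝ}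
    (hGm : Measurable G) (hpm : Measurable p) (hqm : Measurable q)
    (hGi : IgnoresPeriod i G) (hpi : IgnoresPeriod i p) (hqi : IgnoresPeriod i q)
    (hG0 : ∀ ω, 0 ≤ G ω) (hP0 : ∀ ω, 0 ≤ P ω) (hq : ∀ ω, q ω ∈ M.Q) {χ : ℝ → ℝ → ℝ}
    (hχm : Measurable fun x : ℝ × ℝ => χ x.1 x.2) (hχ0 : ∀ z x, 0 ≤ χ z x)
    (hχP : ∀ ω, ∫⁻ z in Set.Icc (0 : ℝ) 1, ENNReal.ofReal (χ z (p ω)) = ENNReal.ofReal (P ω)) :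
    ∫⁻ ω, ENNReal.ofReal (G ω * χ (ω.2 i) (p ω) * cost b h (ω.1 i) (q ω) ^ m) ∂(M.law T μ) =
      ∫⁻ ω, ENNReal.ofReal (G ω * P ω * ∫ y, cost b h y (q ω) ^ m ∂(M.dist (μ i)))
        ∂(M.law T μ) := by
  have hP : ∀ t : Finset.Icc 1 T, IsProbabilityMeasure (M.dist (μ t)) :=
    fun t => hM.prob _ (hμ t t.2)
  rw [lintegral_law_resample hP i]
  · refine lintegral_congr fun ω => ?_
    simp only [Function.update_self, hGi ω, hpi ω, hqi ω]
    have hc : ∀ y, 0 ≤ cost b h y (q ω) ^ m := fun y => pow_nonneg (cost_nonneg hb.1 hh.1 _ _) m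
    have hcm : Measurable fun y => ENNReal.ofReal (cost b h y (q ω) ^ m) :=
      ((measurable_cost_left b h (q ω)).pow_const m).ennreal_ofReal
    have hχm' : Measurable fun z => ENNReal.ofReal (χ z (p ω)) :=
      (hχm.comp (f := fun z : ℝ => (z, p ω)) (by fun_prop)).ennreal_ofReal
    calc _ = ∫⁻ y, ENNReal.ofReal (G ω) * ENNReal.ofReal (P ω) *
          ENNReal.ofReal (cost b h y (q ω) ^ m) ∂(M.dist (μ i)) := by
          refine lintegral_congr fun y => ?_
          rw [← hχP ω, ← lintegral_const_mul _ hχm',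
            ← lintegral_mul_const _ (hχm'.const_mul _)]
          refine lintegral_congr fun z => ?_
          rw [ENNReal.ofReal_mul (mul_nonneg (hG0 ω) (hχ0 _ _)), ENNReal.ofReal_mul (hG0 ω)]
      _ = _ := by
          rw [lintegral_const_mul _ hcm, ← ofReal_integral_eq_lintegral_ofReal
            (integrable_cost_pow hM hδ hb hh (hμ i i.2) (hq ω) hm) (ae_of_all _ hc),
            ← ENNReal.ofReal_mul (hG0 ω), ← ENNReal.ofReal_mul (mul_nonneg (hG0 ω) (hP0 ω))]
  · refine Measurable.ennreal_ofReal ?_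
    refine (hGm.mul (hχm.comp (f := fun ω : (Finset.Icc 1 T → ℝ) × (Finset.Icc 1 T → ℝ) =>
      (ω.2 i, p ω)) (by fun_prop))).mul (Measurable.pow_const ?_ m)
    exact (measurable_cost b h).comp (f := fun ω : (Finset.Icc 1 T → ℝ) × (Finset.Icc 1 T → ℝ) =>
      (ω.1 i, q ω)) (by fun_prop)

/-- The loss estimate `χ c / P` of an arm is unbiased, also after weighting with the normalized
weight `r` of the arm, and its weighted second moment is bounded. -/
lemma Valid.lintegral_estimate {QMax δ ℓ : ℝ} (hM : M.Valid QMax δ ℓ) (hδ : 0 < δ)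
    {T : ℕ} {μ : ℕ → ℝ} (hμ : ∀ t ∈ Finset.Icc 1 T, μ t ∈ Set.Icc M.muMin M.muMax)
    (i : Finset.Icc 1 T) {b h : ℝ} (hb : b ∈ Set.Icc 0 M.bMax) (hh : h ∈ Set.Icc 0 M.hMax)
    {p P q r : (Finset.Icc 1 T → ℝ) × (Finset.Icc 1 T → ℝ) → ℝ}
    (hpm : Measurable p) (hPm : Measurable P) (hqm : Measurable q) (hrm : Measurable r)
    (hpi : IgnoresPeriod i p) (hPi : IgnoresPeriod i P) (hqi : IgnoresPeriod i q)
    (hri : IgnoresPeriod i r) (hP0 : ∀ ω, 0 < P ω) (hr0 : ∀ ω, 0 ≤ r ω)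
    (hrP : ∀ ω, r ω ≤ 2 * P ω) (hq : ∀ ω, q ω ∈ M.Q) {χ : ℝ → ℝ → ℝ}
    (hχm : Measurable fun x : ℝ × ℝ => χ x.1 x.2) (hχ01 : ∀ z x, χ z x = 0 ∨ χ z x = 1)
    (hχP : ∀ ω, ∫⁻ z in Set.Icc (0 : ℝ) 1, ENNReal.ofReal (χ z (p ω)) = ENNReal.ofReal (P ω))
    {S : ℝ} (hS : ∀ q ∈ M.Q, ∫ y, cost b h y q ^ 2 ∂(M.dist (μ i)) ≤ S) :
    ∫⁻ ω, ENNReal.ofReal (χ (ω.2 i) (p ω) * M.expCost b h (μ i) (q ω)) ∂(M.law T μ) =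
      ∫⁻ ω, ENNReal.ofReal (P ω * M.expCost b h (μ i) (q ω)) ∂(M.law T μ) ∧
    ∫⁻ ω, ENNReal.ofReal (χ (ω.2 i) (p ω) * cost b h (ω.1 i) (q ω) / P ω) ∂(M.law T μ) =
      ∫⁻ ω, ENNReal.ofReal (M.expCost b h (μ i) (q ω)) ∂(M.law T μ) ∧
    ∫⁻ ω, ENNReal.ofReal (r ω * (χ (ω.2 i) (p ω) * cost b h (ω.1 i) (q ω) / P ω)) ∂(M.law T μ) =
      ∫⁻ ω, ENNReal.ofReal (r ω * M.expCost b h (μ i) (q ω)) ∂(M.law T μ) ∧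
    ∫⁻ ω, ENNReal.ofReal (r ω * (χ (ω.2 i) (p ω) * cost b h (ω.1 i) (q ω) / P ω) ^ 2)
      ∂(M.law T μ) ≤ ENNReal.ofReal (2 * S) := by
  have hPr := hM.isProbabilityMeasure_law hμ
  have hPi' : IsProbabilityMeasure (M.dist (μ i)) := hM.prob _ (hμ i i.2)
  have hχ0 : ∀ z x, 0 ≤ χ z x := fun z x => by rcases hχ01 z x with h | h <;> simp [h]
  have hCm : Measurable fun ω => M.expCost b h (μ i) (q ω) :=
    (measurable_expCost M b h).comp hqm
  have hC0 : ∀ ω, 0 ≤ M.expCost b h (μ i) (q ω) := fun ω => expCost_nonneg hb.1 hh.1 _ _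
  refine ⟨?_, ?_, ?_, ?_⟩
  · have := hM.lintegral_choice_mul_cost_pow hδ hμ i hb hh (m := 0) (by norm_num) hCm hpm hqm
      (fun ω y z => by simp only [hqi ω]) hpi hqi hC0 (fun ω => (hP0 ω).le) hq hχm hχ0 hχP
    simpa [mul_comm] using this
  · have := hM.lintegral_choice_mul_cost_pow hδ hμ i hb hh (m := 1) (by norm_num)
      (G := fun ω => 1 / P ω) (by fun_prop) hpm hqm
      (fun ω y z => by simp only [hPi ω]) hpi hqi (fun ω => (one_div_pos.2 (hP0 ω)).le)
      (fun ω => (hP0 ω).le) hq hχm hχ0 hχP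
    refine Eq.trans (lintegral_congr fun ω => ?_) (this.trans (lintegral_congr fun ω => ?_))
    · congr 1; ring
    · have := (hP0 ω).ne'
      simp only [pow_one]
      congr 1
      unfold expCost
      field_simp
  · have := hM.lintegral_choice_mul_cost_pow hδ hμ i hb hh (m := 1) (by norm_num)
      (G := fun ω => r ω / P ω) (by fun_prop) hpm hqm
      (fun ω y z => by simp only [hPi ω, hri ω]) hpi hqi (fun ω => div_nonneg (hr0 ω) (hP0 ω).le)
      (fun ω => (hP0 ω).le) hq hχm hχ0 hχP
    refine Eq.trans (lintegral_congr fun ω => ?_) (this.trans (lintegral_congr fun ω => ?_))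
    · congr 1; ring
    · have := (hP0 ω).ne'
      simp only [pow_one]
      congr 1
      unfold expCost
      field_simp
  · have := hM.lintegral_choice_mul_cost_pow hδ hμ i hb hh (m := 2) (by norm_num)
      (G := fun ω => r ω / P ω ^ 2) (by fun_prop) hpm hqm
      (fun ω y z => by simp only [hPi ω, hri ω]) hpi hqi (fun ω => div_nonneg (hr0 ω) (sq_nonneg _))
      (fun ω => (hP0 ω).le) hq hχm hχ0 hχP
    calc _ = _ := lintegral_congr fun ω => ?_
      _ = _ := this
      _ ≤ ∫⁻ ω, ENNReal.ofReal (2 * S) ∂(M.law T μ) := by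
          refine lintegral_mono fun ω => ENNReal.ofReal_le_ofReal ?_
          have hp := hP0 ω
          have h1 : r ω / P ω ^ 2 * P ω = r ω / P ω := by field_simp
          have h2 : r ω / P ω ≤ 2 := (div_le_iff₀ hp).2 (hrP ω)
          have h3 : 0 ≤ ∫ y, cost b h y (q ω) ^ 2 ∂(M.dist (μ i)) :=
            integral_nonneg fun y => sq_nonneg _
          rw [h1]
          exact mul_le_mul h2 (hS _ (hq ω)) h3 (by norm_num)
      _ = _ := by simp
    congr 1
    have hsq : χ (ω.2 i) (p ω) ^ 2 = χ (ω.2 i) (p ω) := by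
      rcases hχ01 (ω.2 i) (p ω) with h | h <;> rw [h] <;> norm_num
    rw [div_pow, mul_pow, hsq]
    ring

end Model

/-- The indicator that a seed `z` selects the first arm, of probability `p`. -/
noncomputable def chooseFirst (z p : ℝ) : ℝ := if z < p then 1 else 0

lemma measurable_chooseFirst : Measurable fun x : ℝ × ℝ => chooseFirst x.1 x.2 :=
  Measurable.ite (measurableSet_lt measurable_fst measurable_snd) measurable_const measurable_const

lemma chooseFirst_eq (z p : ℝ) : chooseFirst z p = 0 ∨ chooseFirst z p = 1 := by
  unfold chooseFirst; split_ifs <;> simp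

lemma lintegral_chooseFirst {p : ℝ} (hp : p ∈ Set.Icc (0 : ℝ) 1) :
    ∫⁻ z in Set.Icc (0 : ℝ) 1, ENNReal.ofReal (chooseFirst z p) = ENNReal.ofReal p := by
  have h : ∀ z, ENNReal.ofReal (chooseFirst z p) = (Set.Iio p).indicator 1 z := by
    intro z
    by_cases hz : z < p <;> simp [chooseFirst, hz]
  simp only [h]
  rw [lintegral_indicator_one measurableSet_Iio, Measure.restrict_apply measurableSet_Iio]
  have : Set.Iio p ∩ Set.Icc 0 1 = Set.Ico 0 p := by
    ext z
    simp only [Set.mem_inter_iff, Set.mem_Iio, Set.mem_Icc, Set.mem_Ico]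
    constructor
    · rintro ⟨h1, h2, h3⟩; exact ⟨h2, h1⟩
    · rintro ⟨h1, h2⟩; exact ⟨h2, h1, h2.le.trans hp.2⟩
  rw [this, Real.volume_Ico, sub_zero]

lemma lintegral_one_sub_chooseFirst {p : ℝ} (hp : p ∈ Set.Icc (0 : ℝ) 1) :
    ∫⁻ z in Set.Icc (0 : ℝ) 1, ENNReal.ofReal (1 - chooseFirst z p) = ENNReal.ofReal (1 - p) := by
  have h : ∀ z, ENNReal.ofReal (1 - chooseFirst z p) = (Set.Ici p).indicator 1 z := by
    intro z
    by_cases hz : z < p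
    · simp [chooseFirst, hz]
    · simp [chooseFirst, hz, not_lt.1 hz]
  simp only [h]
  rw [lintegral_indicator_one measurableSet_Ici, Measure.restrict_apply measurableSet_Ici]
  have : Set.Ici p ∩ Set.Icc 0 1 = Set.Icc p 1 := by
    ext z
    simp only [Set.mem_inter_iff, Set.mem_Ici, Set.mem_Icc]
    constructor
    · rintro ⟨h1, h2, h3⟩; exact ⟨h1, h3⟩
    · rintro ⟨h1, h2⟩; exact ⟨h1, hp.1.trans h1, h2⟩
  rw [this, Real.volume_Icc]

/-! ### Regret of Exp3 -/

namespace Model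

variable {M : Model}

lemma exp3Rate_nonneg (M : Model) (T : ℕ) : 0 ≤ M.exp3Rate T := by
  unfold exp3Rate; positivity

lemma exp3Rate_le_one (M : Model) (T : ℕ) : M.exp3Rate T ≤ 1 := min_le_left _ _

lemma exp3Prob_mem {T : ℕ} {w w' : ℝ} (hw : 0 < w) (hw' : 0 < w') :
    M.exp3Prob T w w' ∈ Set.Icc (0 : ℝ) 1 := by
  have h0 := M.exp3Rate_nonneg T
  have h1 := M.exp3Rate_le_one T
  have h2 : 0 ≤ w / (w + w') := by positivity
  have h3 : w / (w + w') ≤ 1 := (div_le_one (by positivity)).2 (by linarith)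
  unfold exp3Prob
  constructor <;> nlinarith

lemma exp3Prob_pos {T : ℕ} (hη : 0 < M.exp3Rate T) {w w' : ℝ} (hw : 0 < w) (hw' : 0 < w') :
    0 < M.exp3Prob T w w' := by
  have h1 := M.exp3Rate_le_one T
  have h2 : 0 ≤ w / (w + w') := by positivity
  unfold exp3Prob
  nlinarith

lemma exp3Prob_swap {T : ℕ} {w w' : ℝ} (hw : 0 < w) (hw' : 0 < w') :
    M.exp3Prob T w' w = 1 - M.exp3Prob T w w' := by
  unfold exp3Prob
  rw [add_comm w' w]
  field_simp
  ring

lemma exp3Prob_le {T : ℕ} {w w' : ℝ} (hw : 0 < w) (hw' : 0 < w') :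
    M.exp3Prob T w w' ≤ w / (w + w') + M.exp3Rate T / 2 := by
  have h0 := M.exp3Rate_nonneg T
  have h2 : 0 ≤ w / (w + w') := by positivity
  unfold exp3Prob
  nlinarith

/-- This bounds the importance weights, at the price of excluding rates near `1`. -/
lemma le_two_mul_exp3Prob {T : ℕ} (hη : M.exp3Rate T ≤ 1 / 2) {w w' : ℝ} (hw : 0 < w)
    (hw' : 0 < w') : w / (w + w') ≤ 2 * M.exp3Prob T w w' := by
  have h0 := M.exp3Rate_nonneg T
  have h2 : 0 ≤ w / (w + w') := by positivity
  unfold exp3Prob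
  nlinarith

lemma exp3Weights_pos (M : Model) (T : ℕ) (b h q₁ q₂ d u : ℕ → ℝ) (t : ℕ) :
    0 < (M.exp3Weights T b h q₁ q₂ d u t).1 ∧ 0 < (M.exp3Weights T b h q₁ q₂ d u t).2 := by
  induction t with
  | zero => simp [exp3Weights]
  | succ t ih =>
    obtain ⟨h1, h2⟩ := ih
    simp only [exp3Weights]
    split_ifs
    · exact ⟨by positivity, h2⟩
    · exact ⟨h1, by positivity⟩

lemma exp3Weights_congr (M : Model) {T : ℕ} {b h q₁ q₂ d u q₁' q₂' d' u' : ℕ → ℝ} {n : ℕ}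
    (h1 : ∀ s ∈ Finset.Icc 1 n, q₁ s = q₁' s) (h2 : ∀ s ∈ Finset.Icc 1 n, q₂ s = q₂' s)
    (hd : ∀ s ∈ Finset.Icc 1 n, d s = d' s) (hu : ∀ s ∈ Finset.Icc 1 n, u s = u' s) :
    M.exp3Weights T b h q₁ q₂ d u n = M.exp3Weights T b h q₁' q₂' d' u' n := by
  induction n with
  | zero => rfl
  | succ n ih =>
    have hsub : Finset.Icc 1 n ⊆ Finset.Icc 1 (n + 1) := Finset.Icc_subset_Icc_right (by omega)
    have hmem : n + 1 ∈ Finset.Icc 1 (n + 1) := Finset.mem_Icc.2 ⟨by omega, le_rfl⟩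
    simp only [exp3Weights, ih (fun s hs => h1 s (hsub hs)) (fun s hs => h2 s (hsub hs))
      (fun s hs => hd s (hsub hs)) (fun s hs => hu s (hsub hs)), h1 _ hmem, h2 _ hmem,
      hd _ hmem, hu _ hmem]

/-- The weights of Exp3 as functions of demands and seeds, for two predictable arms. -/
noncomputable def armWeights (M : Model) (T : ℕ) (b h : ℕ → ℝ) (A₁ A₂ : (ℕ → ℝ) → ℕ → ℝ) (t : ℕ)
    (ω : (Finset.Icc 1 T → ℝ) × (Finset.Icc 1 T → ℝ)) : ℝ × ℝ :=
  M.exp3Weights T b h (A₁ (extend ω.1)) (A₂ (extend ω.1)) (extend ω.1) (extend ω.2) t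

lemma measurable_exp3Prob {Ω : Type*} [MeasurableSpace Ω] {T : ℕ} {f g : Ω → ℝ}
    (hf : Measurable f) (hg : Measurable g) : Measurable fun ω => M.exp3Prob T (f ω) (g ω) := by
  unfold exp3Prob; fun_prop

lemma measurable_extend_fst {T : ℕ} (t : ℕ) :
    Measurable fun ω : (Finset.Icc 1 T → ℝ) × (Finset.Icc 1 T → ℝ) => extend ω.1 t :=
  (measurable_pi_apply t).comp (measurable_extend.comp measurable_fst)

lemma measurable_extend_snd {T : ℕ} (t : ℕ) :
    Measurable fun ω : (Finset.Icc 1 T → ℝ) × (Finset.Icc 1 T → ℝ) => extend ω.2 t :=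
  (measurable_pi_apply t).comp (measurable_extend.comp measurable_snd)

lemma IsPredictable.measurable_comp {T : ℕ} {A : (ℕ → ℝ) → ℕ → ℝ} (hA : M.IsPredictable T A)
    {t : ℕ} (ht : t ∈ Finset.Icc 1 T) :
    Measurable fun ω : (Finset.Icc 1 T → ℝ) × (Finset.Icc 1 T → ℝ) => A (extend ω.1) t :=
  (hA.measurable t ht).comp (measurable_extend.comp measurable_fst)

lemma measurable_armWeights {T : ℕ} {b h : ℕ → ℝ} {A₁ A₂ : (ℕ → ℝ) → ℕ → ℝ}
    (h₁ : M.IsPredictable T A₁) (h₂ : M.IsPredictable T A₂) {t : ℕ} (ht : t ≤ T) :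
    Measurable (M.armWeights T b h A₁ A₂ t) := by
  induction t with
  | zero => exact measurable_const
  | succ t ih =>
    have hmem : t + 1 ∈ Finset.Icc 1 T := Finset.mem_Icc.2 ⟨by omega, ht⟩
    have hw := ih (by omega)
    have hc : ∀ {A : (ℕ → ℝ) → ℕ → ℝ}, M.IsPredictable T A →
        Measurable fun ω : (Finset.Icc 1 T → ℝ) × (Finset.Icc 1 T → ℝ) =>
          cost (b (t + 1)) (h (t + 1)) (extend ω.1 (t + 1)) (A (extend ω.1) (t + 1)) := fun hA =>
      (measurable_cost _ _).comp ((measurable_extend_fst _).prodMk (hA.measurable_comp hmem))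
    have hc₁ := hc h₁
    have hc₂ := hc h₂
    have hp₁ := measurable_exp3Prob (M := M) (T := T) hw.fst hw.snd
    have hp₂ := measurable_exp3Prob (M := M) (T := T) hw.snd hw.fst
    have hu := measurable_extend_snd (T := T) (t + 1)
    unfold armWeights at hw hp₁ hp₂ ⊢
    simp only [exp3Weights]
    refine Measurable.ite (measurableSet_lt hu hp₁) ?_ ?_
    · exact (hw.fst.mul ((((hc₁.div hp₁).const_mul _).div_const _).exp)).prodMk hw.snd
    · exact hw.fst.prodMk (hw.snd.mul ((((hc₂.div hp₂).const_mul _).div_const _).exp))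

lemma IsPredictable.ignoresPeriod {T : ℕ} {A : (ℕ → ℝ) → ℕ → ℝ} (hA : M.IsPredictable T A)
    (i : Finset.Icc 1 T) {t : ℕ} (ht : t ∈ Finset.Icc 1 T) (hti : t ≤ i) :
    IgnoresPeriod i fun ω => A (extend ω.1) t := by
  intro ω y z
  refine hA.adapted t ht _ _ fun s hs => extend_update_of_ne _ _ _ ?_
  have := (Finset.mem_Ico.1 hs).2
  omega

lemma armWeights_update {T : ℕ} {b h : ℕ → ℝ} {A₁ A₂ : (ℕ → ℝ) → ℕ → ℝ}
    (h₁ : M.IsPredictable T A₁) (h₂ : M.IsPredictable T A₂) (i : Finset.Icc 1 T)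
    (ω : (Finset.Icc 1 T → ℝ) × (Finset.Icc 1 T → ℝ)) (y z : ℝ) :
    M.armWeights T b h A₁ A₂ (i - 1) (Function.update ω.1 i y, Function.update ω.2 i z) =
      M.armWeights T b h A₁ A₂ (i - 1) ω := by
  have hi := Finset.mem_Icc.1 i.2
  have hlt : ∀ s ∈ Finset.Icc 1 ((i : ℕ) - 1), s ∈ Finset.Icc 1 T ∧ s < i := by
    intro s hs
    have := Finset.mem_Icc.1 hs
    exact ⟨Finset.mem_Icc.2 ⟨by omega, by omega⟩, by omega⟩
  refine M.exp3Weights_congr (fun s hs => ?_) (fun s hs => ?_) (fun s hs => ?_) fun s hs => ?_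
  · exact h₁.ignoresPeriod i (hlt s hs).1 (hlt s hs).2.le ω y z
  · exact h₂.ignoresPeriod i (hlt s hs).1 (hlt s hs).2.le ω y z
  · exact extend_update_of_ne _ _ _ (hlt s hs).2.ne
  · exact extend_update_of_ne _ _ _ (hlt s hs).2.ne

/-- Exp3 incurs at most the expected cost of the better arm, the cost of exploration, the entropy
term and the second-order term of `exponential_weights`. -/
lemma Valid.sum_lintegral_exp3_le {QMax δ ℓ : ℝ} (hM : M.Valid QMax δ ℓ) (hδ : 0 < δ)
    {T : ℕ} {b h μ : ℕ → ℝ}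
    (hbh : ∀ t ∈ Finset.Icc 1 T, b t ∈ Set.Icc 0 M.bMax ∧ h t ∈ Set.Icc 0 M.hMax)
    (hμ : ∀ t ∈ Finset.Icc 1 T, μ t ∈ Set.Icc M.muMin M.muMax) {A₁ A₂ : (ℕ → ℝ) → ℕ → ℝ}
    (h₁ : M.IsPredictable T A₁) (h₂ : M.IsPredictable T A₂) (hη : 0 < M.exp3Rate T)
    (hη2 : M.exp3Rate T ≤ 1 / 2) (hC0 : 0 ≤ M.costSup) {S : ℝ} (hS0 : 0 ≤ S)
    (hS : ∀ t ∈ Finset.Icc 1 T, ∀ q ∈ M.Q, ∫ y, cost (b t) (h t) y q ^ 2 ∂(M.dist (μ t)) ≤ S)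
    {π₁ π₂ : Policy} {pred : ℕ → ℝ} (hπ₁ : ∀ d u, π₁ pred d u = A₁ d)
    (hπ₂ : ∀ d u, π₂ pred d u = A₂ d) :
    ∑ t ∈ Finset.Icc 1 T, ∫⁻ ω, ENNReal.ofReal (M.expCost (b t) (h t) (μ t)
        (M.exp3Policy T b h π₁ π₂ pred (extend ω.1) (extend ω.2) t)) ∂(M.law T μ) ≤
      min (∑ t ∈ Finset.Icc 1 T, ∫⁻ ω, ENNReal.ofReal
          (M.expCost (b t) (h t) (μ t) (A₁ (extend ω.1) t)) ∂(M.law T μ))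
        (∑ t ∈ Finset.Icc 1 T, ∫⁻ ω, ENNReal.ofReal
          (M.expCost (b t) (h t) (μ t) (A₂ (extend ω.1) t)) ∂(M.law T μ)) +
      ENNReal.ofReal (T * M.exp3Rate T * M.costSup + 2 * Real.log 2 / M.exp3Rate T +
        M.exp3Rate T * T * S) := by
  have hPr := hM.isProbabilityMeasure_law hμ
  set η := M.exp3Rate T with hηdef
  set W := M.armWeights T b h A₁ A₂ with hW
  have hWpos : ∀ t ω, 0 < (W t ω).1 ∧ 0 < (W t ω).2 := fun t ω => exp3Weights_pos ..
  set p₁ : ℕ → (Finset.Icc 1 T → ℝ) × (Finset.Icc 1 T → ℝ) → ℝ :=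
    fun t ω => M.exp3Prob T (W (t - 1) ω).1 (W (t - 1) ω).2 with hp₁
  set p₂ : ℕ → (Finset.Icc 1 T → ℝ) × (Finset.Icc 1 T → ℝ) → ℝ :=
    fun t ω => M.exp3Prob T (W (t - 1) ω).2 (W (t - 1) ω).1 with hp₂
  set r₁ : ℕ → (Finset.Icc 1 T → ℝ) × (Finset.Icc 1 T → ℝ) → ℝ :=
    fun t ω => (W (t - 1) ω).1 / ((W (t - 1) ω).1 + (W (t - 1) ω).2) with hr₁
  set r₂ : ℕ → (Finset.Icc 1 T → ℝ) × (Finset.Icc 1 T → ℝ) → ℝ :=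
    fun t ω => (W (t - 1) ω).2 / ((W (t - 1) ω).1 + (W (t - 1) ω).2) with hr₂
  set C₁ : ℕ → (Finset.Icc 1 T → ℝ) × (Finset.Icc 1 T → ℝ) → ℝ :=
    fun t ω => M.expCost (b t) (h t) (μ t) (A₁ (extend ω.1) t) with hC₁
  set C₂ : ℕ → (Finset.Icc 1 T → ℝ) × (Finset.Icc 1 T → ℝ) → ℝ :=
    fun t ω => M.expCost (b t) (h t) (μ t) (A₂ (extend ω.1) t) with hC₂
  set X : ℕ → (Finset.Icc 1 T → ℝ) × (Finset.Icc 1 T → ℝ) → ℝ :=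
    fun t ω => chooseFirst (extend ω.2 t) (p₁ t ω) *
      cost (b t) (h t) (extend ω.1 t) (A₁ (extend ω.1) t) / p₁ t ω with hX
  set Y : ℕ → (Finset.Icc 1 T → ℝ) × (Finset.Icc 1 T → ℝ) → ℝ :=
    fun t ω => (1 - chooseFirst (extend ω.2 t) (p₁ t ω)) *
      cost (b t) (h t) (extend ω.1 t) (A₂ (extend ω.1) t) / p₂ t ω with hY
  have hp₁pos : ∀ t ω, 0 < p₁ t ω := fun t ω => exp3Prob_pos hη (hWpos _ ω).1 (hWpos _ ω).2
  have hp₂pos : ∀ t ω, 0 < p₂ t ω := fun t ω => exp3Prob_pos hη (hWpos _ ω).2 (hWpos _ ω).1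
  have hp₁mem : ∀ t ω, p₁ t ω ∈ Set.Icc (0 : ℝ) 1 := fun t ω =>
    exp3Prob_mem (hWpos _ ω).1 (hWpos _ ω).2
  have hp₂eq : ∀ t ω, p₂ t ω = 1 - p₁ t ω := fun t ω =>
    exp3Prob_swap (hWpos _ ω).1 (hWpos _ ω).2
  have hr₁0 : ∀ t ω, 0 ≤ r₁ t ω := fun t ω =>
    div_nonneg (hWpos _ ω).1.le (add_pos (hWpos _ ω).1 (hWpos _ ω).2).le
  have hr₂0 : ∀ t ω, 0 ≤ r₂ t ω := fun t ω =>
    div_nonneg (hWpos _ ω).2.le (add_pos (hWpos _ ω).1 (hWpos _ ω).2).le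
  have hpr₁ : ∀ t ω, p₁ t ω ≤ r₁ t ω + η / 2 := fun t ω =>
    exp3Prob_le (hWpos _ ω).1 (hWpos _ ω).2
  have hpr₂ : ∀ t ω, p₂ t ω ≤ r₂ t ω + η / 2 := fun t ω => by
    have := exp3Prob_le (M := M) (T := T) (hWpos (t - 1) ω).2 (hWpos (t - 1) ω).1
    rwa [add_comm (W (t - 1) ω).2] at this
  have hrp₁ : ∀ t ω, r₁ t ω ≤ 2 * p₁ t ω := fun t ω =>
    le_two_mul_exp3Prob hη2 (hWpos _ ω).1 (hWpos _ ω).2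
  have hrp₂ : ∀ t ω, r₂ t ω ≤ 2 * p₂ t ω := fun t ω => by
    have := le_two_mul_exp3Prob (M := M) (T := T) hη2 (hWpos (t - 1) ω).2 (hWpos (t - 1) ω).1
    rwa [add_comm (W (t - 1) ω).2] at this
  have hχ0 : ∀ z p, 0 ≤ chooseFirst z p := fun z p => by
    rcases chooseFirst_eq z p with h | h <;> simp [h]
  have hχ1 : ∀ z p, 0 ≤ 1 - chooseFirst z p := fun z p => by
    rcases chooseFirst_eq z p with h | h <;> simp [h]
  have hX0 : ∀ t ∈ Finset.Icc 1 T, ∀ ω, 0 ≤ X t ω := fun t ht ω =>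
    div_nonneg (mul_nonneg (hχ0 _ _) (cost_nonneg (hbh t ht).1.1 (hbh t ht).2.1 _ _))
      (hp₁pos t ω).le
  have hY0 : ∀ t ∈ Finset.Icc 1 T, ∀ ω, 0 ≤ Y t ω := fun t ht ω =>
    div_nonneg (mul_nonneg (hχ1 _ _) (cost_nonneg (hbh t ht).1.1 (hbh t ht).2.1 _ _))
      (hp₂pos t ω).le
  have hC₁0 : ∀ t ∈ Finset.Icc 1 T, ∀ ω, 0 ≤ C₁ t ω := fun t ht ω =>
    expCost_nonneg (hbh t ht).1.1 (hbh t ht).2.1 _ _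
  have hC₂0 : ∀ t ∈ Finset.Icc 1 T, ∀ ω, 0 ≤ C₂ t ω := fun t ht ω =>
    expCost_nonneg (hbh t ht).1.1 (hbh t ht).2.1 _ _
  have hC₁le : ∀ t ∈ Finset.Icc 1 T, ∀ ω, C₁ t ω ≤ M.costSup := fun t ht ω =>
    expCost_le_costSup hM hδ (hbh t ht).1 (hbh t ht).2 (hμ t ht) (h₁.mem t ht _)
  have hC₂le : ∀ t ∈ Finset.Icc 1 T, ∀ ω, C₂ t ω ≤ M.costSup := fun t ht ω =>
    expCost_le_costSup hM hδ (hbh t ht).1 (hbh t ht).2 (hμ t ht) (h₂.mem t ht _)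
  -- measurability
  have hWm : ∀ t ∈ Finset.Icc 1 T, Measurable (W (t - 1)) := fun t ht =>
    measurable_armWeights h₁ h₂ (by have := Finset.mem_Icc.1 ht; omega)
  have hp₁m : ∀ t ∈ Finset.Icc 1 T, Measurable (p₁ t) := fun t ht =>
    measurable_exp3Prob (hWm t ht).fst (hWm t ht).snd
  have hp₂m : ∀ t ∈ Finset.Icc 1 T, Measurable (p₂ t) := fun t ht =>
    measurable_exp3Prob (hWm t ht).snd (hWm t ht).fst
  have hr₁m : ∀ t ∈ Finset.Icc 1 T, Measurable (r₁ t) := fun t ht =>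
    (hWm t ht).fst.div ((hWm t ht).fst.add (hWm t ht).snd)
  have hr₂m : ∀ t ∈ Finset.Icc 1 T, Measurable (r₂ t) := fun t ht =>
    (hWm t ht).snd.div ((hWm t ht).fst.add (hWm t ht).snd)
  have hC₁m : ∀ t ∈ Finset.Icc 1 T, Measurable (C₁ t) := fun t ht => by
    have := hM.prob _ (hμ t ht)
    exact (measurable_expCost M _ _).comp (h₁.measurable_comp ht)
  have hC₂m : ∀ t ∈ Finset.Icc 1 T, Measurable (C₂ t) := fun t ht => by
    have := hM.prob _ (hμ t ht)
    exact (measurable_expCost M _ _).comp (h₂.measurable_comp ht)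
  have hχm : ∀ t ∈ Finset.Icc 1 T, Measurable fun ω : (Finset.Icc 1 T → ℝ) ×
      (Finset.Icc 1 T → ℝ) => chooseFirst (extend ω.2 t) (p₁ t ω) := fun t ht =>
    measurable_chooseFirst.comp ((measurable_extend_snd t).prodMk (hp₁m t ht))
  have hXm : ∀ t ∈ Finset.Icc 1 T, Measurable (X t) := fun t ht =>
    ((hχm t ht).mul ((measurable_cost _ _).comp ((measurable_extend_fst t).prodMk
      (h₁.measurable_comp ht)))).div (hp₁m t ht)
  have hYm : ∀ t ∈ Finset.Icc 1 T, Measurable (Y t) := fun t ht =>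
    (((hχm t ht).const_sub 1).mul ((measurable_cost _ _).comp ((measurable_extend_fst t).prodMk
      (h₂.measurable_comp ht)))).div (hp₂m t ht)
  -- expectations of the estimates
  have hest₁ := fun t (ht : t ∈ Finset.Icc 1 T) =>
    hM.lintegral_estimate hδ hμ ⟨t, ht⟩ (hbh t ht).1 (hbh t ht).2 (hp₁m t ht) (hp₁m t ht)
      (h₁.measurable_comp ht) (hr₁m t ht)
      (fun ω y z => by simp only [hp₁, hW, armWeights_update h₁ h₂ ⟨t, ht⟩ ω y z])
      (fun ω y z => by simp only [hp₁, hW, armWeights_update h₁ h₂ ⟨t, ht⟩ ω y z])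
      (h₁.ignoresPeriod ⟨t, ht⟩ ht le_rfl)
      (fun ω y z => by simp only [hr₁, hW, armWeights_update h₁ h₂ ⟨t, ht⟩ ω y z])
      (hp₁pos t) (hr₁0 t) (hrp₁ t) (fun ω => h₁.mem t ht _) (χ := chooseFirst)
      measurable_chooseFirst chooseFirst_eq (fun ω => lintegral_chooseFirst (hp₁mem t ω))
      (hS t ht)
  have hest₂ := fun t (ht : t ∈ Finset.Icc 1 T) =>
    hM.lintegral_estimate hδ hμ ⟨t, ht⟩ (hbh t ht).1 (hbh t ht).2 (hp₁m t ht) (hp₂m t ht)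
      (h₂.measurable_comp ht) (hr₂m t ht)
      (fun ω y z => by simp only [hp₁, hW, armWeights_update h₁ h₂ ⟨t, ht⟩ ω y z])
      (fun ω y z => by simp only [hp₂, hW, armWeights_update h₁ h₂ ⟨t, ht⟩ ω y z])
      (h₂.ignoresPeriod ⟨t, ht⟩ ht le_rfl)
      (fun ω y z => by simp only [hr₂, hW, armWeights_update h₁ h₂ ⟨t, ht⟩ ω y z])
      (hp₂pos t) (hr₂0 t) (hrp₂ t) (fun ω => h₂.mem t ht _) (χ := fun z p => 1 - chooseFirst z p)
      (measurable_chooseFirst.const_sub 1)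
      (fun z p => by rcases chooseFirst_eq z p with h | h <;> simp [h])
      (fun ω => by rw [hp₂eq]; exact lintegral_one_sub_chooseFirst (hp₁mem t ω))
      (hS t ht)
  simp only [← extend_coe] at hest₁ hest₂
  -- the expected cost of one period
  have hperiod : ∀ t ∈ Finset.Icc 1 T,
      ∫⁻ ω, ENNReal.ofReal (M.expCost (b t) (h t) (μ t)
        (M.exp3Policy T b h π₁ π₂ pred (extend ω.1) (extend ω.2) t)) ∂(M.law T μ) ≤
      ∫⁻ ω, ENNReal.ofReal (r₁ t ω * X t ω + r₂ t ω * Y t ω) ∂(M.law T μ) +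
        ENNReal.ofReal (η * M.costSup) := by
    intro t ht
    obtain ⟨a₁, -, c₁, -⟩ := hest₁ t ht
    obtain ⟨a₂, -, c₂, -⟩ := hest₂ t ht
    have hexplore : ∀ (p r C : (Finset.Icc 1 T → ℝ) × (Finset.Icc 1 T → ℝ) → ℝ),
        (∀ ω, p ω ≤ r ω + η / 2) → (∀ ω, 0 ≤ r ω) → (∀ ω, 0 ≤ C ω) → (∀ ω, C ω ≤ M.costSup) →
        ∫⁻ ω, ENNReal.ofReal (p ω * C ω) ∂(M.law T μ) ≤
          ∫⁻ ω, ENNReal.ofReal (r ω * C ω) ∂(M.law T μ) +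
            ENNReal.ofReal (η / 2 * M.costSup) := by
      intro p r C hpr hr hC hCle
      calc _ ≤ ∫⁻ ω, (ENNReal.ofReal (r ω * C ω) + ENNReal.ofReal (η / 2 * M.costSup))
            ∂(M.law T μ) := by
            refine lintegral_mono fun ω => ?_
            rw [← ENNReal.ofReal_add (mul_nonneg (hr ω) (hC ω)) (by positivity)]
            refine ENNReal.ofReal_le_ofReal ?_
            calc p ω * C ω ≤ (r ω + η / 2) * C ω := mul_le_mul_of_nonneg_right (hpr ω) (hC ω)
              _ = r ω * C ω + η / 2 * C ω := by ring
              _ ≤ _ := by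
                  have := hCle ω
                  gcongr
        _ = _ := by rw [lintegral_add_right _ measurable_const]; simp
    have e₁ := hexplore (p₁ t) (r₁ t) (C₁ t) (hpr₁ t) (hr₁0 t) (hC₁0 t ht) (hC₁le t ht)
    have e₂ := hexplore (p₂ t) (r₂ t) (C₂ t) (hpr₂ t) (hr₂0 t) (hC₂0 t ht) (hC₂le t ht)
    have hXr : ∀ ω, 0 ≤ r₁ t ω * X t ω := fun ω => mul_nonneg (hr₁0 t ω) (hX0 t ht ω)
    have hYr : ∀ ω, 0 ≤ r₂ t ω * Y t ω := fun ω => mul_nonneg (hr₂0 t ω) (hY0 t ht ω)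
    calc ∫⁻ ω, ENNReal.ofReal (M.expCost (b t) (h t) (μ t)
          (M.exp3Policy T b h π₁ π₂ pred (extend ω.1) (extend ω.2) t)) ∂(M.law T μ)
        = ∫⁻ ω, (ENNReal.ofReal (chooseFirst (extend ω.2 t) (p₁ t ω) * C₁ t ω) +
            ENNReal.ofReal ((1 - chooseFirst (extend ω.2 t) (p₁ t ω)) * C₂ t ω))
            ∂(M.law T μ) := by
          refine lintegral_congr fun ω => ?_
          by_cases hlt : extend ω.2 t < p₁ t ω
          · have : M.exp3Policy T b h π₁ π₂ pred (extend ω.1) (extend ω.2) t =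
                A₁ (extend ω.1) t := by
              unfold exp3Policy
              simp only [hπ₁, hπ₂]
              exact if_pos hlt
            simp [this, chooseFirst, hlt, hC₁]
          · have : M.exp3Policy T b h π₁ π₂ pred (extend ω.1) (extend ω.2) t =
                A₂ (extend ω.1) t := by
              unfold exp3Policy
              simp only [hπ₁, hπ₂]
              exact if_neg hlt
            simp [this, chooseFirst, hlt, hC₂]
      _ = ∫⁻ ω, ENNReal.ofReal (p₁ t ω * C₁ t ω) ∂(M.law T μ) +
            ∫⁻ ω, ENNReal.ofReal (p₂ t ω * C₂ t ω) ∂(M.law T μ) := by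
          have hm : Measurable fun ω => ENNReal.ofReal (chooseFirst (extend ω.2 t) (p₁ t ω) * C₁ t ω) :=
            ((hχm t ht).mul (hC₁m t ht)).ennreal_ofReal
          rw [lintegral_add_left hm]
          exact congrArg₂ _ a₁ a₂
      _ ≤ (∫⁻ ω, ENNReal.ofReal (r₁ t ω * C₁ t ω) ∂(M.law T μ) +
            ENNReal.ofReal (η / 2 * M.costSup)) +
          (∫⁻ ω, ENNReal.ofReal (r₂ t ω * C₂ t ω) ∂(M.law T μ) +
            ENNReal.ofReal (η / 2 * M.costSup)) := add_le_add e₁ e₂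
      _ = (∫⁻ ω, ENNReal.ofReal (r₁ t ω * X t ω) ∂(M.law T μ) +
            ∫⁻ ω, ENNReal.ofReal (r₂ t ω * Y t ω) ∂(M.law T μ)) +
          ENNReal.ofReal (η * M.costSup) := by
          rw [add_add_add_comm, ← ENNReal.ofReal_add (by positivity) (by positivity)]
          congr 1
          · exact congrArg₂ _ c₁.symm c₂.symm
          · congr 1; ring
      _ = _ := by
          have hm : Measurable fun ω => ENNReal.ofReal (r₁ t ω * X t ω) :=
            ((hr₁m t ht).mul (hXm t ht)).ennreal_ofReal
          rw [← lintegral_add_left hm]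
          congr 1
          exact lintegral_congr fun ω => (ENNReal.ofReal_add (hXr ω) (hYr ω)).symm
  -- the bound for each sequence of demands and seeds
  have hpath : ∀ ω, ∑ t ∈ Finset.Icc 1 T, (r₁ t ω * X t ω + r₂ t ω * Y t ω) ≤
      min (∑ t ∈ Finset.Icc 1 T, X t ω) (∑ t ∈ Finset.Icc 1 T, Y t ω) + 2 * Real.log 2 / η +
      η / 4 * ∑ t ∈ Finset.Icc 1 T, (r₁ t ω * X t ω ^ 2 + r₂ t ω * Y t ω ^ 2) := by
    intro ω
    refine exponential_weights (w₁ := fun t => (W t ω).1) (w₂ := fun t => (W t ω).2)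
      (x := fun t => X t ω) (y := fun t => Y t ω) hη rfl rfl (fun t => ?_) (fun t => ?_)
      (fun t ht => hX0 t ht ω) (fun t ht => hY0 t ht ω)
    · simp only [hX, hp₁, hW, armWeights, chooseFirst, exp3Weights, Nat.add_sub_cancel]
      split_ifs <;> simp [hηdef]
    · simp only [hY, hp₁, hp₂, hW, armWeights, chooseFirst, exp3Weights, Nat.add_sub_cancel]
      split_ifs <;> simp [hηdef]
  have hmm : ∀ t ∈ Finset.Icc 1 T, Measurable fun ω =>
      ENNReal.ofReal (r₁ t ω * X t ω + r₂ t ω * Y t ω) := fun t ht =>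
    (((hr₁m t ht).mul (hXm t ht)).add ((hr₂m t ht).mul (hYm t ht))).ennreal_ofReal
  have hsm : ∀ t ∈ Finset.Icc 1 T, Measurable fun ω =>
      ENNReal.ofReal (r₁ t ω * X t ω ^ 2 + r₂ t ω * Y t ω ^ 2) := fun t ht =>
    (((hr₁m t ht).mul ((hXm t ht).pow_const 2)).add
      ((hr₂m t ht).mul ((hYm t ht).pow_const 2))).ennreal_ofReal
  have hsecond : ∀ t ∈ Finset.Icc 1 T,
      ∫⁻ ω, ENNReal.ofReal (r₁ t ω * X t ω ^ 2 + r₂ t ω * Y t ω ^ 2) ∂(M.law T μ) ≤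
        ENNReal.ofReal (4 * S) := by
    intro t ht
    calc _ = ∫⁻ ω, ENNReal.ofReal (r₁ t ω * X t ω ^ 2) ∂(M.law T μ) +
          ∫⁻ ω, ENNReal.ofReal (r₂ t ω * Y t ω ^ 2) ∂(M.law T μ) := by
          have hm : Measurable fun ω => ENNReal.ofReal (r₁ t ω * X t ω ^ 2) :=
            ((hr₁m t ht).mul ((hXm t ht).pow_const 2)).ennreal_ofReal
          rw [← lintegral_add_left hm]
          exact lintegral_congr fun ω => ENNReal.ofReal_add
            (mul_nonneg (hr₁0 t ω) (sq_nonneg _)) (mul_nonneg (hr₂0 t ω) (sq_nonneg _))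
      _ ≤ ENNReal.ofReal (2 * S) + ENNReal.ofReal (2 * S) :=
          add_le_add (hest₁ t ht).2.2.2 (hest₂ t ht).2.2.2
      _ = _ := by
          rw [← ENNReal.ofReal_add (by positivity) (by positivity)]
          congr 1; ring
  have hlog2 : 0 < Real.log 2 := Real.log_pos (by norm_num)
  -- comparison with one of the arms
  have harm : ∀ Z : ℕ → (Finset.Icc 1 T → ℝ) × (Finset.Icc 1 T → ℝ) → ℝ,
      (∀ t ∈ Finset.Icc 1 T, ∀ ω, 0 ≤ Z t ω) → (∀ t ∈ Finset.Icc 1 T, Measurable (Z t)) →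
      (∀ ω, min (∑ t ∈ Finset.Icc 1 T, X t ω) (∑ t ∈ Finset.Icc 1 T, Y t ω) ≤
        ∑ t ∈ Finset.Icc 1 T, Z t ω) →
      ∑ t ∈ Finset.Icc 1 T, ∫⁻ ω, ENNReal.ofReal (M.expCost (b t) (h t) (μ t)
        (M.exp3Policy T b h π₁ π₂ pred (extend ω.1) (extend ω.2) t)) ∂(M.law T μ) ≤
      ∑ t ∈ Finset.Icc 1 T, ∫⁻ ω, ENNReal.ofReal (Z t ω) ∂(M.law T μ) +
      ENNReal.ofReal (T * η * M.costSup + 2 * Real.log 2 / η + η * T * S) := by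
    intro Z hZ0 hZm hZ
    calc _ ≤ ∑ t ∈ Finset.Icc 1 T,
          (∫⁻ ω, ENNReal.ofReal (r₁ t ω * X t ω + r₂ t ω * Y t ω) ∂(M.law T μ) +
            ENNReal.ofReal (η * M.costSup)) := Finset.sum_le_sum hperiod
      _ = ∫⁻ ω, ENNReal.ofReal (∑ t ∈ Finset.Icc 1 T, (r₁ t ω * X t ω + r₂ t ω * Y t ω))
            ∂(M.law T μ) + ENNReal.ofReal (T * (η * M.costSup)) := by
          rw [Finset.sum_add_distrib, ← lintegral_finsetSum' _ fun t ht => (hmm t ht).aemeasurable]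
          congr 1
          · refine lintegral_congr fun ω => ?_
            rw [ENNReal.ofReal_sum_of_nonneg]
            exact fun t ht => add_nonneg (mul_nonneg (hr₁0 t ω) (hX0 t ht ω))
              (mul_nonneg (hr₂0 t ω) (hY0 t ht ω))
          · rw [Finset.sum_const, Nat.card_Icc, nsmul_eq_mul, Nat.add_sub_cancel,
              ENNReal.ofReal_mul T.cast_nonneg, ENNReal.ofReal_natCast]
      _ ≤ ∫⁻ ω, (∑ t ∈ Finset.Icc 1 T, ENNReal.ofReal (Z t ω) +
            (ENNReal.ofReal (2 * Real.log 2 / η) + ENNReal.ofReal (η / 4) *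
            ∑ t ∈ Finset.Icc 1 T, ENNReal.ofReal (r₁ t ω * X t ω ^ 2 + r₂ t ω * Y t ω ^ 2)))
            ∂(M.law T μ) + ENNReal.ofReal (T * (η * M.costSup)) := by
          refine add_le_add (lintegral_mono fun ω => ?_) le_rfl
          have hs0 : ∀ t ∈ Finset.Icc 1 T, 0 ≤ r₁ t ω * X t ω ^ 2 + r₂ t ω * Y t ω ^ 2 :=
            fun t _ => add_nonneg (mul_nonneg (hr₁0 t ω) (sq_nonneg _))
              (mul_nonneg (hr₂0 t ω) (sq_nonneg _))
          have hs0' := Finset.sum_nonneg hs0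
          rw [← ENNReal.ofReal_sum_of_nonneg hs0,
            ← ENNReal.ofReal_sum_of_nonneg fun t ht => hZ0 t ht ω,
            ← ENNReal.ofReal_mul (by positivity),
            ← ENNReal.ofReal_add (by positivity) (by positivity),
            ← ENNReal.ofReal_add (Finset.sum_nonneg fun t ht => hZ0 t ht ω) (by positivity)]
          refine ENNReal.ofReal_le_ofReal ((hpath ω).trans ?_)
          linarith [hZ ω]
      _ ≤ (∑ t ∈ Finset.Icc 1 T, ∫⁻ ω, ENNReal.ofReal (Z t ω) ∂(M.law T μ) +
            (ENNReal.ofReal (2 * Real.log 2 / η) + ENNReal.ofReal (η / 4) *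
              ENNReal.ofReal (T * (4 * S)))) + ENNReal.ofReal (T * (η * M.costSup)) := by
          refine add_le_add ?_ le_rfl
          rw [lintegral_add_left (Finset.measurable_sum _ fun t ht => (hZm t ht).ennreal_ofReal),
            lintegral_add_left measurable_const,
            lintegral_const_mul _ (Finset.measurable_sum _ hsm),
            lintegral_finsetSum' _ fun t ht => (hsm t ht).aemeasurable,
            lintegral_finsetSum' _ fun t ht => (hZm t ht).ennreal_ofReal.aemeasurable]
          gcongr
          · simp
          · refine (Finset.sum_le_sum hsecond).trans_eq ?_
            rw [Finset.sum_const, Nat.card_Icc, nsmul_eq_mul, Nat.add_sub_cancel,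
              ENNReal.ofReal_mul T.cast_nonneg, ENNReal.ofReal_natCast]
      _ = _ := by
          rw [add_assoc, ← ENNReal.ofReal_mul (by positivity),
            ← ENNReal.ofReal_add (by positivity) (by positivity),
            ← ENNReal.ofReal_add (by positivity) (by positivity)]
          congr 2
          ring
  rw [min_add]
  refine le_min ?_ ?_
  · refine (harm X hX0 hXm fun ω => min_le_left _ _).trans_eq ?_
    congr 1
    exact Finset.sum_congr rfl fun t ht => (hest₁ t ht).2.1
  · refine (harm Y hY0 hYm fun ω => min_le_right _ _).trans_eq ?_
    congr 1
    exact Finset.sum_congr rfl fun t ht => (hest₂ t ht).2.1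

/-- The expected cost of a policy is its regret plus the cost of the clairvoyant. -/
lemma Valid.sum_lintegral_expCost_eq {QMax δ ℓ : ℝ} (hM : M.Valid QMax δ ℓ) {T : ℕ}
    {b h μ pred : ℕ → ℝ}
    (hbh : ∀ t ∈ Finset.Icc 1 T, b t ∈ Set.Icc 0 M.bMax ∧ h t ∈ Set.Icc 0 M.hMax)
    (hμ : ∀ t ∈ Finset.Icc 1 T, μ t ∈ Set.Icc M.muMin M.muMax) {π : Policy}
    (hπ : ∀ d u : ℕ → ℝ, ∀ t ∈ Finset.Icc 1 T, π pred d u t ∈ M.Q)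
    (hπm : ∀ t ∈ Finset.Icc 1 T, Measurable fun ω : (Finset.Icc 1 T → ℝ) × (Finset.Icc 1 T → ℝ) =>
      π pred (extend ω.1) (extend ω.2) t) :
    ∑ t ∈ Finset.Icc 1 T, ∫⁻ ω, ENNReal.ofReal (M.expCost (b t) (h t) (μ t)
        (π pred (extend ω.1) (extend ω.2) t)) ∂(M.law T μ) =
      M.regret T b h π μ pred +
        ENNReal.ofReal (∑ t ∈ Finset.Icc 1 T, M.optCost (b t) (h t) (μ t)) := by
  have hPr := hM.isProbabilityMeasure_law hμ
  have hm : ∀ t ∈ Finset.Icc 1 T, Measurable fun ω : (Finset.Icc 1 T → ℝ) ×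
      (Finset.Icc 1 T → ℝ) => M.expCost (b t) (h t) (μ t)
        (π pred (extend ω.1) (extend ω.2) t) := fun t ht => by
    have := hM.prob _ (hμ t ht)
    exact (measurable_expCost M _ _).comp (hπm t ht)
  have hopt : 0 ≤ ∑ t ∈ Finset.Icc 1 T, M.optCost (b t) (h t) (μ t) :=
    Finset.sum_nonneg fun t ht => optCost_nonneg (hbh t ht).1.1 (hbh t ht).2.1 _
  rw [← lintegral_finsetSum' _ fun t ht => (hm t ht).ennreal_ofReal.aemeasurable]
  calc _ = ∫⁻ ω, (ENNReal.ofReal (∑ t ∈ Finset.Icc 1 T,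
        (M.expCost (b t) (h t) (μ t) (π pred (extend ω.1) (extend ω.2) t)
          - M.optCost (b t) (h t) (μ t))) +
        ENNReal.ofReal (∑ t ∈ Finset.Icc 1 T, M.optCost (b t) (h t) (μ t))) ∂(M.law T μ) := by
        refine lintegral_congr fun ω => ?_
        rw [← ENNReal.ofReal_add _ hopt, ← Finset.sum_add_distrib]
        · simp only [sub_add_cancel]
          rw [ENNReal.ofReal_sum_of_nonneg]
          exact fun t ht => expCost_nonneg (hbh t ht).1.1 (hbh t ht).2.1 _ _
        · exact Finset.sum_nonneg fun t ht => sub_nonneg.2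
            (optCost_le (hbh t ht).1.1 (hbh t ht).2.1 _ (hπ _ _ t ht))
    _ = _ := by
        rw [lintegral_add_right _ measurable_const]
        simp [regret]

/-- The factor of `√T` in the regret of Exp3 relative to its arms; `c` is a bound for `costSup` and
`k` the factor in `integral_cost_sq_le`. -/
noncomputable def exp3Factor (c k : ℝ) : ℝ := 4 + 4 * √c + k

/-- The three error terms of `Valid.sum_lintegral_exp3_le` for the rate of the policy. -/
lemma exp3_error_le {T : ℕ} (hT : 2 ≤ T) {c k : ℝ} (hc : M.costSup ≤ c)
    (hbig : 4 < M.costSup * T) (hk : 0 ≤ k) :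
    0 < M.exp3Rate T ∧ M.exp3Rate T ≤ 1 / 2 ∧
      T * M.exp3Rate T * M.costSup + 2 * Real.log 2 / M.exp3Rate T +
        M.exp3Rate T * T * (k * √M.costSup) ≤ exp3Factor c k * √T := by
  have hT0 : (0 : ℝ) < T := by positivity
  have hC : 0 < M.costSup := by
    by_contra hcon
    nlinarith [not_lt.1 hcon]
  have hl1 := Real.log_two_gt_d9
  have hl2 := Real.log_two_lt_d9
  have he1 := Real.exp_one_gt_d9
  have he2 := Real.exp_one_lt_d9
  set C := M.costSup with hCdef
  set a := 2 * Real.log 2 / (Real.exp 1 - 1) with ha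
  have he0 : 0 < Real.exp 1 - 1 := by linarith
  have ha1 : a ≤ 1 := by rw [ha, div_le_one he0]; linarith
  have ha2 : 1 / 4 ≤ a := by rw [ha, le_div_iff₀ he0]; linarith
  have hCT : 0 < C * T := by positivity
  have hsCT : 0 < √(C * T) := Real.sqrt_pos.2 hCT
  have hroot : √(2 * Real.log 2 / ((Real.exp 1 - 1) * C * T)) = √a / √(C * T) := by
    rw [← Real.sqrt_div' _ hCT.le, ha]
    congr 1
    field_simp
  have hsa1 : √a ≤ 1 := Real.sqrt_le_one.2 ha1
  have hsa2 : 1 / 2 ≤ √a := Real.le_sqrt_of_sq_le (by linarith)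
  have hs2 : 2 ≤ √(C * T) := Real.le_sqrt_of_sq_le (by linarith)
  have hηle : √a / √(C * T) ≤ 1 / 2 := by
    rw [div_le_iff₀ hsCT]; linarith
  have hη : M.exp3Rate T = √a / √(C * T) := by
    unfold exp3Rate
    rw [← hCdef, hroot, min_eq_right (by linarith)]
  have hmul : √(C * T) = √C * √T := Real.sqrt_mul hC.le _
  have hsC : 0 < √C := Real.sqrt_pos.2 hC
  have hsT : 0 < √(T : ℝ) := Real.sqrt_pos.2 hT0
  have hCsq : √C * √C = C := Real.mul_self_sqrt hC.le
  have hTsq : √(T : ℝ) * √T = T := Real.mul_self_sqrt hT0.le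
  have hsCc : √C ≤ √c := Real.sqrt_le_sqrt hc
  rw [hη]
  refine ⟨by positivity, hηle, ?_⟩
  have e1 : T * (√a / √(C * T)) * C = √a * (√C * √T) := by
    rw [hmul]
    field_simp
    nlinarith [hCsq, hTsq]
  have e2 : 2 * Real.log 2 / (√a / √(C * T)) = 2 * Real.log 2 / √a * (√C * √T) := by
    rw [hmul]; field_simp
  have e3 : √a / √(C * T) * T * (k * √C) = √a * k * √T := by
    rw [hmul]
    field_simp
    rw [Real.sq_sqrt hT0.le]
  have hlogdiv : 2 * Real.log 2 / √a ≤ 3 := by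
    rw [div_le_iff₀ (by positivity)]; linarith
  rw [e1, e2, e3]
  unfold exp3Factor
  calc √a * (√C * √T) + 2 * Real.log 2 / √a * (√C * √T) + √a * k * √T
      ≤ 1 * (√c * √T) + 3 * (√c * √T) + 1 * k * √T := by gcongr
    _ ≤ _ := by nlinarith

/-- Exp3 over two predictable policies that order in `Q` has, up to a term of order `√T`, at most
the regret of the better one. -/
lemma Valid.regret_exp3Policy_le {QMax δ ℓ : ℝ} (hM : M.Valid QMax δ ℓ) (hδ : 0 < δ)
    {T : ℕ} (hT : 2 ≤ T) {b h μ pred : ℕ → ℝ}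
    (hbh : ∀ t ∈ Finset.Icc 1 T, b t ∈ Set.Icc 0 M.bMax ∧ h t ∈ Set.Icc 0 M.hMax)
    (hμ : ∀ t ∈ Finset.Icc 1 T, μ t ∈ Set.Icc M.muMin M.muMax) {A₁ A₂ : (ℕ → ℝ) → ℕ → ℝ}
    (h₁ : M.IsPredictable T A₁) (h₂ : M.IsPredictable T A₂) {π₁ π₂ : Policy}
    (hπ₁ : ∀ d u, π₁ pred d u = A₁ d) (hπ₂ : ∀ d u, π₂ pred d u = A₂ d) :
    M.regret T b h (M.exp3Policy T b h π₁ π₂) μ pred ≤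
      min (M.regret T b h π₁ μ pred) (M.regret T b h π₂ μ pred) +
        ENNReal.ofReal (exp3Factor (3 * costScale M.bMax M.hMax QMax δ)
          ((1 + 3 * costScale M.bMax M.hMax QMax δ ^ 3) / 2) * √T) := by
  have hTm : 1 ∈ Finset.Icc 1 T := Finset.mem_Icc.2 ⟨le_rfl, by omega⟩
  have hc := costSup_le hM hδ (hbh 1 hTm).1 (hbh 1 hTm).2 (hμ 1 hTm) hM.Q_nonempty.some_mem
  have hC0 : 0 ≤ M.costSup := (expCost_nonneg (hbh 1 hTm).1.1 (hbh 1 hTm).2.1 _ _).trans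
    (expCost_le_costSup hM hδ (hbh 1 hTm).1 (hbh 1 hTm).2 (hμ 1 hTm) hM.Q_nonempty.some_mem)
  have hs := costScale_nonneg (QMax := QMax) ((hbh 1 hTm).1.1.trans (hbh 1 hTm).1.2)
    ((hbh 1 hTm).2.1.trans (hbh 1 hTm).2.2) hδ
  set c := 3 * costScale M.bMax M.hMax QMax δ
  set k := (1 + 3 * costScale M.bMax M.hMax QMax δ ^ 3) / 2 with hk
  have hk0 : 0 ≤ k := by positivity
  have hmem : ∀ d u : ℕ → ℝ, ∀ t ∈ Finset.Icc 1 T,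
      M.exp3Policy T b h π₁ π₂ pred d u t ∈ M.Q := by
    intro d u t ht
    unfold exp3Policy
    simp only [hπ₁, hπ₂]
    split_ifs
    · exact h₁.mem t ht d
    · exact h₂.mem t ht d
  -- if `costSup * T ≤ 4`, the rate may be close to `1` or meaningless, but the regret is bounded
  rcases le_or_gt (M.costSup * T) 4 with hsmall | hbig
  · refine (hM.regret_le hδ hbh hμ hmem).trans (le_trans (ENNReal.ofReal_le_ofReal ?_) le_add_self)
    have hT1 : 1 ≤ √(T : ℝ) := Real.one_le_sqrt.2 (by exact_mod_cast (by omega : 1 ≤ T))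
    have : 0 ≤ √c := Real.sqrt_nonneg c
    unfold exp3Factor
    nlinarith
  obtain ⟨hη, hη2, herr⟩ := exp3_error_le hT hc hbig hk0
  have hCpos : 0 < M.costSup := by
    by_contra hcon
    have : (0 : ℝ) < T := by positivity
    nlinarith [not_lt.1 hcon]
  have hexpm : ∀ t ∈ Finset.Icc 1 T, Measurable fun ω : (Finset.Icc 1 T → ℝ) ×
      (Finset.Icc 1 T → ℝ) =>
      M.exp3Policy T b h π₁ π₂ pred (extend ω.1) (extend ω.2) t := by
    intro t ht
    have hw := measurable_armWeights (b := b) (h := h) h₁ h₂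
      (show t - 1 ≤ T by have := Finset.mem_Icc.1 ht; omega)
    unfold armWeights at hw
    unfold exp3Policy
    simp only [hπ₁, hπ₂]
    exact Measurable.ite (measurableSet_lt (measurable_extend_snd t)
      (measurable_exp3Prob hw.fst hw.snd)) (h₁.measurable_comp ht) (h₂.measurable_comp ht)
  have e0 := hM.sum_lintegral_expCost_eq hbh hμ hmem hexpm
  have e1 := hM.sum_lintegral_expCost_eq (π := π₁) (pred := pred) hbh hμ
    (fun d u t ht => by rw [hπ₁]; exact h₁.mem t ht d)
    (fun t ht => by simp only [hπ₁]; exact h₁.measurable_comp ht)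
  have e2 := hM.sum_lintegral_expCost_eq (π := π₂) (pred := pred) hbh hμ
    (fun d u t ht => by rw [hπ₂]; exact h₂.mem t ht d)
    (fun t ht => by simp only [hπ₂]; exact h₂.measurable_comp ht)
  have hmain := hM.sum_lintegral_exp3_le hδ hbh hμ h₁ h₂ hη hη2 hC0
    (S := k * √M.costSup) (by positivity)
    (fun t ht q hq => integral_cost_sq_le hM hδ (hbh t ht).1 (hbh t ht).2 (hμ t ht) hq hCpos)
    hπ₁ hπ₂
  simp only [hπ₁] at e1
  simp only [hπ₂] at e2
  rw [e0, e1, e2, min_add_add_right, add_right_comm] at hmain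
  refine ((ENNReal.add_le_add_iff_right ENNReal.ofReal_ne_top).1 hmain).trans ?_
  gcongr

/-! ### The two arms are predictable -/

lemma measurable_clip (M : Model) : Measurable M.clip := by
  unfold clip; fun_prop

lemma measurable_windowEstimate (M : Model) (κ : ℝ) (T j t : ℕ) :
    Measurable fun d : ℕ → ℝ => M.windowEstimate κ T d j t := by
  unfold windowEstimate
  exact M.measurable_clip.comp (by fun_prop)

lemma windowEstimate_congr (M : Model) (κ : ℝ) (T j : ℕ) {t : ℕ} {d d' : ℕ → ℝ}
    (hd : ∀ s ∈ Finset.Ico 1 t, d s = d' s) :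
    M.windowEstimate κ T d j t = M.windowEstimate κ T d' j t := by
  unfold windowEstimate
  rw [Finset.sum_congr rfl fun s hs => hd s ?_]
  simp only [Finset.mem_Ico, max_le_iff] at hs ⊢
  omega

/-- The test of period `t + 1` in state `x`. -/
def SwitchTest (M : Model) (κ γ : ℝ) (T t : ℕ) (x : ℕ × ℕ) (d : ℕ → ℝ) : Prop :=
  initialLength T < t + 1 ∧ ∃ j, x.1 < j ∧ j ≤ numCandidates T ∧
    2 * (γ * √(Real.log T) + √κ) * (T : ℝ) ^ ((3 + candidate T j) / 4) ≤
      ∑ s ∈ Finset.Icc x.2 (t + 1),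
        |M.windowEstimate κ T d x.1 s - M.windowEstimate κ T d j s|

open Classical in
lemma shrinkingState_succ (M : Model) (κ γ : ℝ) (T : ℕ) (d : ℕ → ℝ) (t : ℕ) :
    M.shrinkingState κ γ T d (t + 1) =
      if M.SwitchTest κ γ T t (M.shrinkingState κ γ T d t) d
      then ((M.shrinkingState κ γ T d t).1 + 1, t + 1) else M.shrinkingState κ γ T d t := by
  rw [shrinkingState]
  exact if_congr Iff.rfl rfl rfl

lemma switchTest_congr (M : Model) (κ γ : ℝ) (T : ℕ) {t : ℕ} (x : ℕ × ℕ) {d d' : ℕ → ℝ}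
    (hd : ∀ s ∈ Finset.Ico 1 (t + 1), d s = d' s) :
    M.SwitchTest κ γ T t x d ↔ M.SwitchTest κ γ T t x d' := by
  have hest : ∀ j, ∀ s ∈ Finset.Icc x.2 (t + 1),
      M.windowEstimate κ T d j s = M.windowEstimate κ T d' j s := fun j s hs =>
    M.windowEstimate_congr κ T j fun r hr =>
      hd r (Finset.Ico_subset_Ico_right (Finset.mem_Icc.1 hs).2 hr)
  have hsum : ∀ j, ∑ s ∈ Finset.Icc x.2 (t + 1),
      |M.windowEstimate κ T d x.1 s - M.windowEstimate κ T d j s| =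
      ∑ s ∈ Finset.Icc x.2 (t + 1),
      |M.windowEstimate κ T d' x.1 s - M.windowEstimate κ T d' j s| := fun j =>
    Finset.sum_congr rfl fun s hs => by rw [hest x.1 s hs, hest j s hs]
  simp only [SwitchTest, hsum]

lemma shrinkingState_congr (M : Model) (κ γ : ℝ) (T : ℕ) {t : ℕ} {d d' : ℕ → ℝ}
    (hd : ∀ s ∈ Finset.Ico 1 t, d s = d' s) :
    M.shrinkingState κ γ T d t = M.shrinkingState κ γ T d' t := by
  induction t with
  | zero => rfl
  | succ t ih =>
    rw [shrinkingState_succ, shrinkingState_succ,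
      ih fun s hs => hd s (Finset.Ico_subset_Ico_right (by omega) hs)]
    classical
    exact if_congr (M.switchTest_congr κ γ T _ hd) rfl rfl

lemma measurableSet_switchTest (M : Model) (κ γ : ℝ) (T t : ℕ) (x : ℕ × ℕ) :
    MeasurableSet {d | M.SwitchTest κ γ T t x d} := by
  have hset : {d | M.SwitchTest κ γ T t x d} = {_d | initialLength T < t + 1} ∩
      ⋃ j, ({_d | x.1 < j ∧ j ≤ numCandidates T} ∩
        {d | 2 * (γ * √(Real.log T) + √κ) * (T : ℝ) ^ ((3 + candidate T j) / 4) ≤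
          ∑ s ∈ Finset.Icc x.2 (t + 1),
            |M.windowEstimate κ T d x.1 s - M.windowEstimate κ T d j s|}) := by
    ext d
    simp [SwitchTest, and_assoc]
  rw [hset]
  refine (MeasurableSet.const _).inter (MeasurableSet.iUnion fun j =>
    (MeasurableSet.const _).inter (measurableSet_le measurable_const ?_))
  exact Finset.measurable_sum _ fun s _ => ((M.measurable_windowEstimate κ T x.1 s).sub
    (M.measurable_windowEstimate κ T j s)).abs

lemma measurable_shrinkingState (M : Model) (κ γ : ℝ) (T t : ℕ) :
    Measurable fun d : ℕ → ℝ => M.shrinkingState κ γ T d t := by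
  induction t with
  | zero => exact measurable_const
  | succ t ih =>
    classical
    simp only [shrinkingState_succ]
    -- there are only countably many states, so measurability is checked for each of them
    have hstep : Measurable fun p : (ℕ × ℕ) × (ℕ → ℝ) =>
        if M.SwitchTest κ γ T t p.1 p.2 then (p.1.1 + 1, t + 1) else p.1 :=
      measurable_from_prod_countable_right fun x => by
        dsimp only
        exact Measurable.ite (M.measurableSet_switchTest κ γ T t x) measurable_const
          measurable_const
    exact hstep.comp (ih.prodMk measurable_id)

lemma measurable_windowEstimate_state (M : Model) (κ γ : ℝ) (T t : ℕ) :
    Measurable fun d : ℕ → ℝ =>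
      M.windowEstimate κ T d (M.shrinkingState κ γ T d t).1 t := by
  have hstep : Measurable fun p : (ℕ × ℕ) × (ℕ → ℝ) => M.windowEstimate κ T p.2 p.1.1 t :=
    measurable_from_prod_countable_right fun x => by
      dsimp only
      exact M.measurable_windowEstimate κ T x.1 t
  exact hstep.comp (f := fun d => (M.shrinkingState κ γ T d t, d)) ((M.measurable_shrinkingState κ γ T t).prodMk measurable_id)

lemma isPredictable_shrinkingPolicy (hM : M.muMin ≤ M.muMax) (κ γ : ℝ) {T : ℕ} {b h : ℕ → ℝ}
    {best : ℕ → ℝ → ℝ} (hbest : M.IsBestResponse T b h best) {init : ℕ → (ℕ → ℝ) → ℝ}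
    (hinit : M.IsInitialRule T init) (pred u : ℕ → ℝ) :
    M.IsPredictable T fun d => M.shrinkingPolicy κ γ T best init pred d u where
  measurable t ht := by
    unfold shrinkingPolicy
    split_ifs
    · exact hinit.measurable t ht
    · exact (hbest.measurable t ht).comp (M.measurable_windowEstimate_state κ γ T t)
  mem t ht d := shrinkingPolicy_mem hM hbest hinit pred d u ht
  adapted t ht d d' hd := by
    unfold shrinkingPolicy
    split_ifs
    · exact hinit.adapted t ht d d' hd
    · rw [M.shrinkingState_congr κ γ T hd, M.windowEstimate_congr κ T _ hd]

lemma isPredictable_predictionPolicy (hM : M.muMin ≤ M.muMax) {T : ℕ} {b h : ℕ → ℝ}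
    {best : ℕ → ℝ → ℝ} (hbest : M.IsBestResponse T b h best) (pred u : ℕ → ℝ) :
    M.IsPredictable T fun d => M.predictionPolicy best pred d u where
  measurable _ _ := measurable_const
  mem _ ht d := predictionPolicy_mem hM hbest pred d u ht
  adapted _ _ _ _ _ := rfl

end Model

end Newsvendor

theorem mainTheorem9 (bMax hMax QMax δ ℓ κ γ : ℝ) (hδ : 0 < δ) (hℓ : 0 ≤ ℓ) (hκ : 0 < κ)
    (hγ : 0 < γ) (hγ_large : 5 / 2 ≤ κ * γ ^ 2 / (144 * Real.exp 1 * δ ^ 2)) :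
    ∃ C : ℝ, 0 < C ∧
      ∀ M : Newsvendor.Model, M.bMax = bMax → M.hMax = hMax → M.Valid QMax δ ℓ →
      ∀ T : ℕ, 2 ≤ T →
      ∀ b h : ℕ → ℝ, (∀ t ∈ Finset.Icc 1 T, b t ∈ Set.Icc 0 bMax ∧ h t ∈ Set.Icc 0 hMax) →
      ∀ best : ℕ → ℝ → ℝ, M.IsBestResponse T b h best →
      ∀ init : ℕ → (ℕ → ℝ) → ℝ, M.IsInitialRule T init →
      ∀ v ∈ Set.Icc (0 : ℝ) 1, ∀ a ∈ Set.Icc (0 : ℝ) 1,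
        M.worstCaseRegret T b h v a (M.dividePolicy κ γ T b h best init a) ≤
          ENNReal.ofReal
            (C * (T : ℝ) ^ (min ((3 + v) / 4) a) * Real.log T ^ (5 / 2 : ℝ)) := by
  classical
  set c := 3 * Newsvendor.costScale bMax hMax QMax δ with hc
  set k := (1 + 3 * Newsvendor.costScale bMax hMax QMax δ ^ 3) / 2 with hk
  set F := Newsvendor.shrinkingFactor c δ ℓ κ γ with hF
  set G := Newsvendor.Model.exp3Factor c k with hG
  refine ⟨|F| + 16 * ℓ + 8 * |G| + 1, by positivity, ?_⟩
  rintro M rfl rfl hM T hT b h hbh best hbest init hinit v hv a ha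
  have hT0 : (0 : ℝ) < T := by positivity
  have hT1 : (1 : ℝ) ≤ T := by exact_mod_cast (by omega : 1 ≤ T)
  have hl := Newsvendor.half_le_log hT
  have hl0 := Newsvendor.log_natCast_pos hT
  have hΛ : Real.log T ^ (5 / 2 : ℝ) = Real.log T ^ 2 * √(Real.log T) := by
    rw [Real.sqrt_eq_rpow, ← Real.rpow_natCast, ← Real.rpow_add hl0]
    norm_num
  have hsq1 : 1 ≤ 2 * √(Real.log T) := by
    have : 1 / 2 ≤ √(Real.log T) := Real.le_sqrt_of_sq_le (by linarith)
    linarith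
  have hΛ8 : 1 ≤ 8 * (Real.log T ^ 2 * √(Real.log T)) := by nlinarith
  rw [hΛ]
  set Λ := Real.log T ^ 2 * √(Real.log T)
  have hΛ0 : 0 ≤ Λ := by positivity
  refine iSup_le fun μ => iSup_le fun hμ => iSup_le fun pred => iSup_le fun hpred => ?_
  have hPred : M.regret T b h (M.predictionPolicy best) μ pred ≤
      ENNReal.ofReal (16 * ℓ * (T : ℝ) ^ a * Λ) := by
    refine (hM.regret_predictionPolicy_le hℓ hbh hμ.1 hbest).trans (ENNReal.ofReal_le_ofReal ?_)
    calc 2 * ℓ * Newsvendor.predictionError T pred μ ≤ 2 * ℓ * (T : ℝ) ^ a := by gcongr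
      _ ≤ 2 * ℓ * (T : ℝ) ^ a * (8 * Λ) := le_mul_of_one_le_right (by positivity) hΛ8
      _ = _ := by ring
  unfold Newsvendor.Model.dividePolicy
  split_ifs with haa
  · refine hPred.trans (ENNReal.ofReal_le_ofReal ?_)
    rw [min_eq_right (by linarith [hv.1])]
    gcongr
    linarith [abs_nonneg F, abs_nonneg G]
  · have hexp := hM.regret_exp3Policy_le hδ hT hbh hμ.1 (pred := pred)
      (Newsvendor.Model.isPredictable_shrinkingPolicy hM.mu_le κ γ hbest hinit pred 0)
      (Newsvendor.Model.isPredictable_predictionPolicy hM.mu_le hbest pred 0)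
      (π₁ := M.shrinkingPolicy κ γ T best init) (π₂ := M.predictionPolicy best)
      (fun d u => rfl) (fun d u => rfl)
    have hShr := hM.regret_shrinkingPolicy_le hδ hℓ hκ hγ hγ_large hT hbh hbest hinit hv hμ pred
    have hroot : √(T : ℝ) ≤ (T : ℝ) ^ (min ((3 + v) / 4) a) := by
      rw [Real.sqrt_eq_rpow]
      exact Real.rpow_le_rpow_of_exponent_le hT1
        (le_min (by linarith [hv.1]) (by linarith [not_le.1 haa]))
    have hmin : min (M.regret T b h (M.shrinkingPolicy κ γ T best init) μ pred)
        (M.regret T b h (M.predictionPolicy best) μ pred) ≤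
        ENNReal.ofReal ((|F| + 16 * ℓ) * (T : ℝ) ^ (min ((3 + v) / 4) a) * Λ) := by
      rcases le_total ((3 + v) / 4) a with hle | hle
      · rw [min_eq_left hle]
        refine (min_le_left _ _).trans (hShr.trans (ENNReal.ofReal_le_ofReal ?_))
        rw [← mul_assoc]
        gcongr
        linarith [le_abs_self F]
      · rw [min_eq_right hle]
        refine (min_le_right _ _).trans (hPred.trans (ENNReal.ofReal_le_ofReal ?_))
        gcongr
        linarith [abs_nonneg F]
    calc _ ≤ _ := hexp
      _ ≤ ENNReal.ofReal ((|F| + 16 * ℓ) * (T : ℝ) ^ (min ((3 + v) / 4) a) * Λ) +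
          ENNReal.ofReal (8 * |G| * (T : ℝ) ^ (min ((3 + v) / 4) a) * Λ) := by
          refine add_le_add hmin (ENNReal.ofReal_le_ofReal ?_)
          calc G * √T ≤ |G| * (T : ℝ) ^ (min ((3 + v) / 4) a) := by
                gcongr
                exact le_abs_self G
            _ ≤ |G| * (T : ℝ) ^ (min ((3 + v) / 4) a) * (8 * Λ) :=
                le_mul_of_one_le_right (by positivity) hΛ8
            _ = _ := by ring
      _ = ENNReal.ofReal ((|F| + 16 * ℓ) * (T : ℝ) ^ (min ((3 + v) / 4) a) * Λ +
          8 * |G| * (T : ℝ) ^ (min ((3 + v) / 4) a) * Λ) :=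
          (ENNReal.ofReal_add (by positivity) (by positivity)).symm
      _ ≤ _ := by
          refine ENNReal.ofReal_le_ofReal ?_
          have : 0 ≤ (T : ℝ) ^ (min ((3 + v) / 4) a) * Λ := by positivity
          linarith
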